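/- **Setting.** Let $m\ge 1$, let $\beta_{j,i},\gamma_{j,i}\in\mathbb R$ ($0\le j\le 2m-1$, $1\le i\le m$), let $\psi$ be a real polynomial and $\mathcal Q(v)=Q(v,\partial_xv,\dots,\partial_x^{2m-1}v)$ with $Q$ a real polynomial in $2m$ variables (for instance a monomial). Consider, on $(-1,1)$, $$\partial_t v=(-1)^{m+1}\partial_x^{2m}v+\mathcal Q(v)+\psi,\qquad \sum_{j=0}^{2m-1}\beta_{j,i}\,\partial_x^jv(-1)=0,\quad \sum_{j=0}^{2m-1}\gamma_{j,i}\,\partial_x^jv(1)=0\quad(1\le i\le m),\tag{BC}$$ and assume that the $2m\times 2m$ matrix of the boundary conditions (BC) on polynomials of degree less than $2m$ is invertible. Let $\xi_0=1$, $\xi_n=2$ for $n\ge1$, and let $\ell^1_1$ be the space of sequences $U=(U_n)_{n\ge0}$ with $\|U\|_1=\sum_n\xi_n|U_n|<\infty$ (real or complex, as appropriate); operators on it carry the operator norm. Let $\mathcal G_0(U)=\sum_n \xi_nU_nT_n$ with $T_n$ the Chebyshev polynomials of the first kind. Let $\mathcal L^{-1}$ be the solution operator in $\ell^1_1$: $V=\mathcal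 L^{-1}W$ means that $v=\mathcal G_0(V)$ solves $(-1)^{m+1}\partial_x^{2m}v=\mathcal G_0(W)$ with (BC). Put $$\mathcal F(U)=U+\mathcal G_0^{-1}\mathcal Q(\mathcal G_0\mathcal L^{-1}U)+\mathcal G_0^{-1}\psi ,\qquad U\in\ell^1_1 .$$ **Newton–Kantorovich conditions.** Let $\mathcal A$ be a bounded linear operator on the real space $\ell^1_1$, let $\bar U\in\ell^1_1$ be real, $Y,Z_1\ge0$, $Z_2:(0,\infty)\to[0,\infty)$ with $\|\mathcal A\mathcal F(\bar U)\|_1\le Y$, $\|I-\mathcal AD\mathcal F(\bar U)\|_1\le Z_1$ and $\|\mathcal A(D\mathcal F(\bar U+h)-D\mathcal F(\bar U))\|_1\le Z_2(s)s$ for all $s>0$ and all real $h$ with $\|h\|_1\le s$. Let $r>0$ satisfy $\tfrac12Z_2(r)r^2-(1-Z_1)r+Y<0$ and $Z_1+Z_2(r)r<1$, and let $\tilde U$ be the unique zero of $\mathcal F$ in the closed ball of radius $r$ about $\bar U$. Set $\tilde v=\mathcal G_0(\mathcal L^{-1}\tilde U)$, a steady state. The linearization at $\tilde v$ is the operator $v\mapsto(-1)^{m+1}\partial_x^{2m}v+D\mathcal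 Q(\tilde v)v$ on the complex-valued functions $v\in C^{2m}([-1,1])$ that satisfy (BC). **Theorem.** Let $\lambda_{\max}>0$ be such that every eigenvalue $\lambda$ of the linearization with $\operatorname{Re}\lambda\ge0$ satisfies $|\lambda|\le\lambda_{\max}$. Let $N\ge0$, let $\mathcal P_0$ be an invertible complex $(N+1)\times(N+1)$ matrix, let $\mathcal P$ act as $\mathcal P_0$ on the coordinates $0,\dots,N$ and as the identity on the others, and let $$\mathcal M=\mathcal P^{-1}D\mathcal F(\tilde U)^{-1}\mathcal L^{-1}\mathcal P$$ on complex $\ell^1_1$, with matrix $(\mathcal M_{k,n})$, $(\mathcal MU)_k=\sum_n\mathcal M_{k,n}U_n$. The $n$-th Gershgorin disk ($n\ge0$) is the closed disk with center $\mathcal M_{n,n}$ and radius $r_n=\frac1{\xi_n}\sum_{k\ne n}|\mathcal M_{k,n}|\xi_k$. Suppose that for exactly $n_u\in\{0,1,2,\dots\}$ indices $n$ the $n$-th disk is contained in $\{\operatorname{Re}z>0\}$, and that all other disks are disjoint from these and contained in $\{\operatorname{Re}z<0\}\cup\{|z|<1/\lambda_{\max}\}$. Then the linearization at $\tilde v$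 has exactly $n_u$ eigenvalues with positive real part, counted with algebraic multiplicity. -/

import Mathlib

open scoped BigOperators

noncomputable section

namespace GegenbauerStability

/-! ### The sequence space and Chebyshev series -/

/-- The weights `ξ_0 = 1`, `ξ_n = 2` for `n ≥ 1`. -/
def xi (n : ℕ) : ℝ := if n = 0 then 1 else 2

/-- The Banach space `ℓ¹₁` of sequences `U` with norm `|U_0| + 2 ∑_{n ≥ 1} |U_n|`, written in the
isometric coordinates `a_n = ξ_n U_n`, so that the norm is `∑ |a_n|`. In these coordinates the
normalized Schauder basis vector `E_n` is the `n`-th unit vector of `lp`. -/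
abbrev Ell1 (𝕜 : Type) [RCLike 𝕜] : Type := lp (fun _ : ℕ => 𝕜) 1

/-- The `n`-th coefficient `U_n = a_n / ξ_n` of the sequence represented by `a`. -/
def coeff {𝕜 : Type} [RCLike 𝕜] (a : Ell1 𝕜) (n : ℕ) : 𝕜 := (xi n)⁻¹ • a n

/-- The `n`-th canonical (not normalized) unit sequence: `U_n = 1`, `U_k = 0` for `k ≠ n`. -/
def unitSeq (𝕜 : Type) [RCLike 𝕜] (n : ℕ) : Ell1 𝕜 :=
  lp.single (E := fun _ : ℕ => 𝕜) 1 n ((xi n : ℝ) : 𝕜)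

/-- The inclusion of the real space in the complex one. -/
def toComplex (a : Ell1 ℝ) : Ell1 ℂ :=
  ⟨fun n => ((a n : ℝ) : ℂ), by
    have h := (memℓp_gen_iff (p := 1) (by simp)).1 (lp.memℓp a)
    refine (memℓp_gen_iff (p := 1) (by simp)).2 ?_
    simpa using h⟩

/-- The closed interval `[-1, 1]`. -/
abbrev segm : Set ℝ := Set.Icc (-1) 1

/-- `k`-th derivative on `[-1, 1]`, one-sided at the end points. -/
def D {𝕜 : Type} [RCLike 𝕜] (k : ℕ) (v : ℝ → 𝕜) (x : ℝ) : 𝕜 := iteratedDerivWithin k v segm x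

/-- The Chebyshev series `𝒢₀(U) = U_0 + 2 ∑_{n ≥ 1} U_n T_n = ∑ a_n T_n`. -/
def G0 {𝕜 : Type} [RCLike 𝕜] (a : Ell1 𝕜) (x : ℝ) : 𝕜 :=
  ∑' n : ℕ, ((Polynomial.Chebyshev.T ℝ (n : ℤ)).eval x) • a n

open Classical in
/-- `𝒢₀⁻¹(f)`: the element of `ℓ¹₁` whose Chebyshev series is `f` on `[-1, 1]` (there is at most
one; the value is `0` if there is none). -/
def G0inv {𝕜 : Type} [RCLike 𝕜] (f : ℝ → 𝕜) : Ell1 𝕜 :=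
  if h : ∃ a : Ell1 𝕜, ∀ x ∈ segm, G0 a x = f x then h.choose else 0

/-! ### The parabolic problem -/

/-- The data of `∂ₜ v = (-1)^(m+1) ∂ₓ^(2m) v + Q(v, ∂ₓ v, …, ∂ₓ^(2m-1) v) + ψ` on `(-1, 1)` with
`m` boundary conditions at each end point. -/
structure Problem where
  m : ℕ
  m_pos : 0 < m
  /-- coefficients `β j i` of `∂ₓ^j v(-1)` in the `i`-th condition at `-1` -/
  β : Fin (2 * m) → Fin m → ℝ
  /-- coefficients `γ j i` of `∂ₓ^j v(1)` in the `i`-th condition at `1` -/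
  γ : Fin (2 * m) → Fin m → ℝ
  Q : MvPolynomial (Fin (2 * m)) ℝ
  ψ : Polynomial ℝ

variable (p : Problem)

/-- The boundary conditions. -/
def Problem.BC {𝕜 : Type} [RCLike 𝕜] (v : ℝ → 𝕜) : Prop :=
  (∀ i : Fin p.m, ∑ j : Fin (2 * p.m), p.β j i • D (j : ℕ) v (-1) = 0) ∧
  (∀ i : Fin p.m, ∑ j : Fin (2 * p.m), p.γ j i • D (j : ℕ) v 1 = 0)

/-- The matrix of the boundary operator restricted to polynomials of degree `< 2m`, in the basis
`T_0, …, T_(2m-1)`: the rows `n < m` are the conditions at `-1`, the others those at `1`. -/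
def Problem.bcMatrix : Matrix (Fin (2 * p.m)) (Fin (2 * p.m)) ℝ :=
  Matrix.of fun n k =>
    if h : (n : ℕ) < p.m then
      ∑ j : Fin (2 * p.m), p.β j ⟨n, h⟩ *
        (Polynomial.derivative^[(j : ℕ)]
          (Polynomial.Chebyshev.T ℝ ((k : ℕ) : ℤ))).eval (-1)
    else
      ∑ j : Fin (2 * p.m), p.γ j ⟨(n : ℕ) - p.m, by have := n.isLt; omega⟩ *
        (Polynomial.derivative^[(j : ℕ)]
          (Polynomial.Chebyshev.T ℝ ((k : ℕ) : ℤ))).eval 1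

/-- `v` solves `(-1)^(m+1) ∂ₓ^(2m) v = w` with the boundary conditions. -/
def Problem.SolvesLinear {𝕜 : Type} [RCLike 𝕜] (w v : ℝ → 𝕜) : Prop :=
  ContDiffOn ℝ ((2 * p.m : ℕ) : WithTop ℕ∞) v segm ∧
  (∀ x ∈ segm, (-1 : 𝕜) ^ (p.m + 1) * D (2 * p.m) v x = w x) ∧
  p.BC v

open Classical in
/-- The solution operator `ℒ⁻¹` of the linear boundary value problem in coefficient space:
`V = ℒ⁻¹ W` is the sequence such that `𝒢₀(V)` solves the linear problem with right-hand side
`𝒢₀(W)` (unique when `bcMatrix` is invertible). -/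
def Problem.Linv {𝕜 : Type} [RCLike 𝕜] (W : Ell1 𝕜) : Ell1 𝕜 :=
  if h : ∃ V : Ell1 𝕜, p.SolvesLinear (G0 W) (G0 V) then h.choose else 0

/-- `𝒬(v) = Q(v, ∂ₓ v, …, ∂ₓ^(2m-1) v)`. -/
def Problem.nonlin {𝕜 : Type} [RCLike 𝕜] (v : ℝ → 𝕜) (x : ℝ) : 𝕜 :=
  MvPolynomial.aeval (fun i : Fin (2 * p.m) => D (i : ℕ) v x) p.Q

/-- The zero finding map `ℱ(U) = U + 𝒢₀⁻¹ 𝒬(𝒢₀ ℒ⁻¹ U) + 𝒢₀⁻¹ ψ` on `ℓ¹₁`. -/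
def Problem.F (𝕜 : Type) [RCLike 𝕜] (U : Ell1 𝕜) : Ell1 𝕜 :=
  U + G0inv (p.nonlin (G0 (p.Linv U))) + G0inv (fun x => ((p.ψ.eval x : ℝ) : 𝕜))

/-- The Fréchet derivative `Dℱ(U)`. -/
def Problem.DF (𝕜 : Type) [RCLike 𝕜] (U : Ell1 𝕜) : Ell1 𝕜 →L[𝕜] Ell1 𝕜 :=
  fderiv 𝕜 (p.F 𝕜) U

/-- The Newton–Kantorovich conditions in `ℓ¹₁` at the approximate zero `Ubar`, with approximate
inverse `A`, bounds `Y`, `Z₁`, `Z₂` and radius `r`. -/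
structure Problem.NewtonKantorovich (A : Ell1 ℝ →L[ℝ] Ell1 ℝ) (Ubar : Ell1 ℝ)
    (Y Z₁ : ℝ) (Z₂ : ℝ → ℝ) (r : ℝ) : Prop where
  Y_nonneg : 0 ≤ Y
  Z₁_nonneg : 0 ≤ Z₁
  Z₂_nonneg : ∀ s, 0 < s → 0 ≤ Z₂ s
  bound_Y : ‖A (p.F ℝ Ubar)‖ ≤ Y
  bound_Z₁ : ‖ContinuousLinearMap.id ℝ (Ell1 ℝ) - A.comp (p.DF ℝ Ubar)‖ ≤ Z₁
  bound_Z₂ : ∀ s, 0 < s → ∀ h : Ell1 ℝ, ‖h‖ ≤ s →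
    ‖A.comp (p.DF ℝ (Ubar + h) - p.DF ℝ Ubar)‖ ≤ Z₂ s * s
  r_pos : 0 < r
  radius : Z₂ r * r ^ 2 / 2 - (1 - Z₁) * r + Y < 0
  contraction : Z₁ + Z₂ r * r < 1

/-! ### The linearization at a steady state -/

/-- The steady state `𝒢₀(ℒ⁻¹ U)` associated with a zero `U` of `ℱ`. -/
def Problem.steady (U : Ell1 ℝ) : ℝ → ℝ := G0 (p.Linv U)

/-- On `C^(2m)` functions the derivatives of order at most `2m` are additive. -/
theorem Problem.D_add {u v : ℝ → ℂ} (hu : ContDiffOn ℝ ((2 * p.m : ℕ) : WithTop ℕ∞) u segm)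
    (hv : ContDiffOn ℝ ((2 * p.m : ℕ) : WithTop ℕ∞) v segm) {k : ℕ} (hk : k ≤ 2 * p.m)
    {x : ℝ} (hx : x ∈ segm) : D k (u + v) x = D k u x + D k v x := by
  have hk' : ((k : ℕ) : WithTop ℕ∞) ≤ ((2 * p.m : ℕ) : WithTop ℕ∞) := by exact_mod_cast hk
  exact iteratedDerivWithin_add hx (uniqueDiffOn_Icc (by norm_num))
    ((hu x hx).of_le hk') ((hv x hx).of_le hk')

theorem D_smul (c : ℂ) (v : ℝ → ℂ) (k : ℕ) (x : ℝ) : D k (c • v) x = c • D k v x :=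
  iteratedDerivWithin_const_smul_field c v

/-- The domain of the linearized operator: `C^(2m)` functions on `[-1, 1]`, extended by `0` outside,
which satisfy the boundary conditions. -/
def Problem.linDomain : Submodule ℂ (ℝ → ℂ) where
  carrier := {v | (∀ x, x ∉ segm → v x = 0) ∧
    ContDiffOn ℝ ((2 * p.m : ℕ) : WithTop ℕ∞) v segm ∧ p.BC v}
  zero_mem' := by
    have h : ∀ (k : ℕ) (x : ℝ), D k (0 : ℝ → ℂ) x = 0 := fun k x => by
      simpa using D_smul 0 0 k x
    exact ⟨fun _ _ => rfl, contDiffOn_const, by simp [h], by simp [h]⟩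
  add_mem' := by
    rintro u v ⟨hu0, hu, hu1, hu2⟩ ⟨hv0, hv, hv1, hv2⟩
    refine ⟨fun x hx => by simp [hu0 x hx, hv0 x hx], hu.add hv, fun i => ?_, fun i => ?_⟩
    · refine Eq.trans ?_ ((congrArg₂ (· + ·) (hu1 i) (hv1 i)).trans (add_zero 0))
      rw [← Finset.sum_add_distrib]
      refine Finset.sum_congr rfl fun j _ => ?_
      rw [p.D_add hu hv j.isLt.le (by simp), smul_add]
    · refine Eq.trans ?_ ((congrArg₂ (· + ·) (hu2 i) (hv2 i)).trans (add_zero 0))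
      rw [← Finset.sum_add_distrib]
      refine Finset.sum_congr rfl fun j _ => ?_
      rw [p.D_add hu hv j.isLt.le (by simp), smul_add]
  smul_mem' := by
    rintro c v ⟨hv0, hv, hv1, hv2⟩
    refine ⟨fun x hx => by simp [hv0 x hx], contDiffOn_const.smul hv, fun i => ?_, fun i => ?_⟩
    · simp only [D_smul, smul_comm _ c, ← Finset.smul_sum, hv1 i, smul_zero]
    · simp only [D_smul, smul_comm _ c, ← Finset.smul_sum, hv2 i, smul_zero]

/-- The linearized operator `v ↦ (-1)^(m+1) ∂ₓ^(2m) v + D𝒬(w) v` at the real function `w`, as an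
unbounded operator acting on complex functions on `[-1, 1]` (extended by `0`). -/
def Problem.linearization (w : ℝ → ℝ) : (ℝ → ℂ) →ₗ.[ℂ] (ℝ → ℂ) where
  domain := p.linDomain
  toFun :=
    { toFun := fun v => segm.indicator fun x =>
        (-1 : ℂ) ^ (p.m + 1) * D (2 * p.m) (v : ℝ → ℂ) x +
          ∑ i : Fin (2 * p.m),
            MvPolynomial.eval (fun l : Fin (2 * p.m) => D (l : ℕ) w x) (MvPolynomial.pderiv i p.Q) •
              D (i : ℕ) (v : ℝ → ℂ) x
      map_add' := by
        rintro ⟨u, hu0, hu, hu'⟩ ⟨v, hv0, hv, hv'⟩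
        ext x
        by_cases hx : x ∈ segm
        · simp only [Submodule.coe_add, Set.indicator_of_mem hx, Pi.add_apply,
            p.D_add hu hv le_rfl hx]
          have h : ∀ i : Fin (2 * p.m), D (i : ℕ) (u + v) x = D (i : ℕ) u x + D (i : ℕ) v x :=
            fun i => p.D_add hu hv i.isLt.le hx
          simp only [h, smul_add, Finset.sum_add_distrib]
          ring
        · simp [Set.indicator_of_notMem hx]
      map_smul' := by
        rintro c ⟨v, hv⟩
        ext x
        by_cases hx : x ∈ segm
        · simp only [Submodule.coe_smul, Set.indicator_of_mem hx, Pi.smul_apply, D_smul,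
            RingHom.id_apply, smul_comm _ c, ← Finset.smul_sum]
          simp only [smul_eq_mul]
          ring
        · simp [Set.indicator_of_notMem hx] }

section Eigenvalues

variable {E : Type} [AddCommGroup E] [Module ℂ E] (T : E →ₗ.[ℂ] E)

/-- `μ` is an eigenvalue of the unbounded operator `T`. -/
def IsEigenvalue (μ : ℂ) : Prop := ∃ v : T.domain, v ≠ 0 ∧ T v = μ • (v : E)

/-- The vectors `v` for which `(T - μ)^k v` is defined and equal to `0`. -/
def genEigenspace (μ : ℂ) : ℕ → Submodule ℂ E
  | 0 => ⊥
  | k + 1 =>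
    ((genEigenspace μ k).comap (T.toFun - μ • T.domain.subtype)).map T.domain.subtype

/-- The space of all generalized eigenvectors for `μ`; its dimension is the algebraic
multiplicity of `μ`. -/
def maxGenEigenspace (μ : ℂ) : Submodule ℂ E := ⨆ k, genEigenspace T μ k

/-- The eigenvalues with positive real part. -/
def unstableEigenvalues : Set ℂ := {μ | IsEigenvalue T μ ∧ 0 < μ.re}

/-- `T` has exactly `n` eigenvalues with positive real part, counted with algebraic multiplicity. -/
def HasUnstableCount (n : ℕ) : Prop :=
  ∃ hfin : (unstableEigenvalues T).Finite,
    (∀ μ ∈ unstableEigenvalues T, FiniteDimensional ℂ (maxGenEigenspace T μ)) ∧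
    ∑ μ ∈ hfin.toFinset, Module.finrank ℂ (maxGenEigenspace T μ) = n

end Eigenvalues

/-! ### The Gershgorin disks -/

theorem memℓp_one_of_eventually_eq {f g : ℕ → ℂ} {K : ℕ} (hg : Memℓp g 1)
    (h : ∀ k, K ≤ k → f k = g k) : Memℓp f 1 := by
  have hs := (memℓp_gen_iff (p := 1) (by simp)).1 hg
  refine (memℓp_gen_iff (p := 1) (by simp)).2 ?_
  refine (summable_congr_cofinite ?_).2 hs
  refine Filter.eventually_cofinite.2 ((Set.finite_lt_nat K).subset fun k hk => ?_)
  by_contra hlt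
  exact hk (congrArg (fun z : ℂ => ‖z‖ ^ ENNReal.toReal 1) (h k (not_lt.1 hlt)))

/-- The operator `B + π^{>N}` on complex sequences: the matrix `B` acts on the coordinates
`0, …, N`, the identity on the others. -/
def blockOp {N : ℕ} (B : Matrix (Fin (N + 1)) (Fin (N + 1)) ℂ) (a : Ell1 ℂ) : Ell1 ℂ :=
  ⟨fun k => if h : k < N + 1 then B.mulVec (fun n => a (n : ℕ)) ⟨k, h⟩ else a k,
    memℓp_one_of_eventually_eq (K := N + 1) (lp.memℓp a) fun _ hk => dif_neg (not_lt.2 hk)⟩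

/-- `ℳ = 𝒫⁻¹ Dℱ(U)⁻¹ ℒ⁻¹ 𝒫` on the complex space, with `𝒫 = P₀ + π^{>N}`. -/
def Problem.opM {N : ℕ} (P₀ : Matrix (Fin (N + 1)) (Fin (N + 1)) ℂ) (U : Ell1 ℝ)
    (a : Ell1 ℂ) : Ell1 ℂ :=
  blockOp P₀⁻¹ ((p.DF ℂ (toComplex U)).inverse (p.Linv (blockOp P₀ a)))

/-- The infinite matrix of `ℳ`: column `n` consists of the coefficients of the image of the `n`-th
unit sequence. -/
def Problem.matM {N : ℕ} (P₀ : Matrix (Fin (N + 1)) (Fin (N + 1)) ℂ) (U : Ell1 ℝ)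
    (k n : ℕ) : ℂ :=
  coeff (p.opM P₀ U (unitSeq ℂ n)) k

/-- The Gershgorin radius `r_n = (1 / ξ_n) ∑_{k ≠ n} |ℳ_{k,n}| ξ_k`. -/
def Problem.gershRadius {N : ℕ} (P₀ : Matrix (Fin (N + 1)) (Fin (N + 1)) ℂ) (U : Ell1 ℝ)
    (n : ℕ) : ℝ :=
  (xi n)⁻¹ * ∑' k : ℕ, if k = n then 0 else ‖p.matM P₀ U k n‖ * xi k

/-- The `n`-th (closed) Gershgorin disk. -/
def Problem.gershDisk {N : ℕ} (P₀ : Matrix (Fin (N + 1)) (Fin (N + 1)) ℂ) (U : Ell1 ℝ)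
    (n : ℕ) : Set ℂ :=
  Metric.closedBall (p.matM P₀ U n n) (p.gershRadius P₀ U n)

/-- The indices of the Gershgorin disks contained in the open right half-plane. -/
def Problem.unstableDisks {N : ℕ} (P₀ : Matrix (Fin (N + 1)) (Fin (N + 1)) ℂ)
    (U : Ell1 ℝ) : Set ℕ :=
  {n | p.gershDisk P₀ U n ⊆ {z : ℂ | 0 < z.re}}

end GegenbauerStability

end

/-! Write `T` for the linearization and `J = Dℱ(Ũ)`. On functions `v = 𝒢₀(ℒ⁻¹W)` the highest
derivative contributes `W` and the lower order terms contribute the rest of `J W`, so `T 𝒢₀ ℒ⁻¹ = 𝒢₀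
J`. Hence, with `g = 𝒢₀ J 𝒫`, one has `g ℳ = 𝒢₀ ℒ⁻¹ 𝒫` and `T g ℳ = g`: along `g`, the operator `ℳ`
is an inverse of `T`. Therefore `μ ≠ 0` is an eigenvalue of `T` exactly when `1/μ` is one of `ℳ`,
with the same algebraic multiplicity, and inversion preserves the sign of the real part. It remains
to count the eigenvalues of `ℳ` in the right half-plane.

This requires `J` to be invertible. The Newton–Kantorovich bounds give `‖I - 𝒜J‖ ≤ Z₁ + Z₂(r) r < 1`
on the real space, so `J` is injective there; as its coefficients are real, it is injective on the
complex space, and it is the identity plus a compact operator, so the Fredholm alternative applies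
(`Problem.exists_equiv_DF`). It also requires the domain of `T` to lie in the range of `g`, that is,
`C¹` functions must have absolutely convergent Chebyshev series (`exists_G0_eq_of_contDiffOn`).

The columns of `ℳ` tend to `0` because `ℒ⁻¹` integrates. So `ℳ` is compact, its disks accumulate
only at `0`, and the union `U` of the `n_u` unstable disks is separated from the compact set formed
by `0` and the other disks. The Gershgorin theorem with multiplicities (`compact_gershgorin`) then
gives total multiplicity `n_u` in `U`. For matrices this is the usual homotopy to the diagonal. For
`ℳ`, nearby operators `N` are built which keep a chosen finite dimensional invariant subspace and
act as a `K × K` matrix on a larger one. One such `N` bounds the multiplicity from above; if the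
multiplicity were smaller than `n_u`, a family `N → ℳ` would produce approximate eigenvectors, and
by compactness an eigenvector, outside the spectral space.

Finally, an eigenvalue of `ℳ` with positive real part lies in some disk. If that disk were a stable
one, the eigenvalue would have modulus below `1/λ_max`, and its inverse would be an eigenvalue of
`T` violating the a priori bound. -/

open scoped BigOperators

noncomputable section

namespace GegenbauerStability

open Filter Topology

/-! ### Bounded operators on `ℓ¹` -/

section Ell1

variable {𝕜 : Type} [RCLike 𝕜]

/-- The `n`-th normalized basis vector of `ℓ¹`. -/
def basisVec (𝕜 : Type) [RCLike 𝕜] (n : ℕ) : Ell1 𝕜 := lp.single (E := fun _ : ℕ => 𝕜) 1 n 1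

theorem basisVec_apply (n k : ℕ) : basisVec 𝕜 n k = if k = n then 1 else 0 := by
  rw [basisVec, lp.single_apply]
  split_ifs with h
  · subst h; simp
  · rw [Pi.single_eq_of_ne h]

@[simp]
theorem norm_basisVec (n : ℕ) : ‖basisVec 𝕜 n‖ = 1 := by
  rw [basisVec, lp.norm_single (by simp)]; simp

theorem single_eq_smul_basisVec (n : ℕ) (c : 𝕜) :
    lp.single (E := fun _ : ℕ => 𝕜) 1 n c = c • basisVec 𝕜 n := by
  rw [basisVec, ← lp.single_smul]; simp

theorem hasSum_basisVec (a : Ell1 𝕜) : HasSum (fun n => a n • basisVec 𝕜 n) a := by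
  simpa only [single_eq_smul_basisVec] using lp.hasSum_single (by simp) a

theorem summable_norm_apply (a : Ell1 𝕜) : Summable fun n => ‖a n‖ := by
  have h := (memℓp_gen_iff (p := 1) (by simp)).1 (lp.memℓp a)
  simpa using h

theorem norm_eq_tsum (a : Ell1 𝕜) : ‖a‖ = ∑' n, ‖a n‖ := by
  rw [lp.norm_eq_tsum_rpow (by simp)]; simp

theorem norm_apply_le (a : Ell1 𝕜) (n : ℕ) : ‖a n‖ ≤ ‖a‖ := by
  rw [norm_eq_tsum]; exact (summable_norm_apply a).le_tsum n fun _ _ => norm_nonneg _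

/-- The element of `ℓ¹` given by an absolutely summable sequence. -/
def ofSummable (f : ℕ → 𝕜) (hf : Summable fun n => ‖f n‖) : Ell1 𝕜 :=
  ⟨f, (memℓp_gen_iff (p := 1) (by simp)).2 (by simpa using hf)⟩

section Lift

variable {E : Type*} [NormedAddCommGroup E] [NormedSpace 𝕜 E]

theorem clm_apply_hasSum (T : Ell1 𝕜 →L[𝕜] E) (a : Ell1 𝕜) :
    HasSum (fun n => a n • T (basisVec 𝕜 n)) (T a) := by
  simpa using (hasSum_basisVec a).mapL T

theorem clm_ext {T S : Ell1 𝕜 →L[𝕜] E} (h : ∀ n, T (basisVec 𝕜 n) = S (basisVec 𝕜 n)) :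
    T = S := by
  ext a
  have h1 := clm_apply_hasSum T a
  simp only [h] at h1
  exact h1.unique (clm_apply_hasSum S a)

/-- The `ℓ¹` norm is additive over coordinates, so the operator norm is controlled by the columns
alone. All operator estimates, and the choice of column disks, rest on this. -/
theorem norm_clm_le {T : Ell1 𝕜 →L[𝕜] E} {C : ℝ} (hC : 0 ≤ C)
    (h : ∀ n, ‖T (basisVec 𝕜 n)‖ ≤ C) : ‖T‖ ≤ C := by
  refine T.opNorm_le_bound hC fun a => ?_
  rw [← (clm_apply_hasSum T a).tsum_eq, norm_eq_tsum, mul_comm, ← tsum_mul_right]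
  refine tsum_of_norm_bounded ((summable_norm_apply a).mul_right C).hasSum fun n => ?_
  rw [norm_smul]
  exact mul_le_mul_of_nonneg_left (h n) (norm_nonneg _)

variable [CompleteSpace E]

/-- The bounded operator on `ℓ¹` which maps the basis vectors to a given bounded sequence. -/
theorem exists_clm_basisVec (y : ℕ → E) (C : ℝ) (hy : ∀ n, ‖y n‖ ≤ C) :
    ∃ T : Ell1 𝕜 →L[𝕜] E, ∀ n, T (basisVec 𝕜 n) = y n := by
  have hs : ∀ a : Ell1 𝕜, ∀ n, ‖a n • y n‖ ≤ ‖a n‖ * C := fun a n => by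
    rw [norm_smul]; exact mul_le_mul_of_nonneg_left (hy n) (norm_nonneg _)
  have hsum : ∀ a : Ell1 𝕜, Summable fun n => a n • y n := fun a =>
    Summable.of_norm_bounded ((summable_norm_apply a).mul_right C) (hs a)
  let L : Ell1 𝕜 →ₗ[𝕜] E :=
    { toFun := fun a => ∑' n, a n • y n
      map_add' := fun a b => by
        rw [← (hsum a).tsum_add (hsum b)]; simp [add_smul]
      map_smul' := fun c a => by
        rw [RingHom.id_apply, ← (hsum a).tsum_const_smul c]; simp [smul_smul] }
  refine ⟨L.mkContinuous C fun a => ?_, fun n => ?_⟩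
  · rw [norm_eq_tsum, mul_comm, ← tsum_mul_right]
    exact tsum_of_norm_bounded ((summable_norm_apply a).mul_right C).hasSum (hs a)
  · change ∑' k, basisVec 𝕜 n k • y k = y n
    rw [tsum_eq_single n]
    · simp [basisVec_apply]
    · intro k hk; simp [basisVec_apply, hk]

/-- The bounded operator on `ℓ¹` which maps the basis vectors to a given bounded sequence. -/
def liftSeq (y : ℕ → E) (C : ℝ) (hy : ∀ n, ‖y n‖ ≤ C) : Ell1 𝕜 →L[𝕜] E :=
  (exists_clm_basisVec y C hy).choose

@[simp]
theorem liftSeq_basisVec (y : ℕ → E) (C : ℝ) (hy : ∀ n, ‖y n‖ ≤ C) (n : ℕ) :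
    liftSeq y C hy (basisVec 𝕜 n) = y n := (exists_clm_basisVec y C hy).choose_spec n

end Lift

/-- The `n`-th coordinate as a continuous linear form. -/
def coordCLM (𝕜 : Type) [RCLike 𝕜] (n : ℕ) : Ell1 𝕜 →L[𝕜] 𝕜 :=
  lp.evalCLM 𝕜 (fun _ : ℕ => 𝕜) 1 n

@[simp]
theorem coordCLM_apply (n : ℕ) (a : Ell1 𝕜) : coordCLM 𝕜 n a = a n := rfl

theorem norm_ite_basisVec_le (K n : ℕ) : ‖if n < K then basisVec 𝕜 n else 0‖ ≤ 1 := by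
  split_ifs <;> simp

/-- Truncation to the first `K` coordinates. -/
def trunc (𝕜 : Type) [RCLike 𝕜] (K : ℕ) : Ell1 𝕜 →L[𝕜] Ell1 𝕜 :=
  liftSeq (fun n => if n < K then basisVec 𝕜 n else 0) 1 (norm_ite_basisVec_le K)

@[simp]
theorem trunc_basisVec (K n : ℕ) :
    trunc 𝕜 K (basisVec 𝕜 n) = if n < K then basisVec 𝕜 n else 0 := liftSeq_basisVec _ _ _ n

theorem norm_trunc_le (K : ℕ) : ‖trunc 𝕜 K‖ ≤ 1 :=
  norm_clm_le zero_le_one fun n => by rw [trunc_basisVec]; exact norm_ite_basisVec_le K n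

theorem trunc_eq_sum (K : ℕ) (a : Ell1 𝕜) :
    trunc 𝕜 K a = ∑ n ∈ Finset.range K, a n • basisVec 𝕜 n := by
  have h := clm_apply_hasSum (trunc 𝕜 K) a
  refine h.unique ?_
  have : ∀ n ∉ Finset.range K, a n • trunc 𝕜 K (basisVec 𝕜 n) = 0 := fun n hn => by
    rw [trunc_basisVec, if_neg (by simpa using hn), smul_zero]
  have h2 := hasSum_sum_of_ne_finset_zero this (L := SummationFilter.unconditional ℕ)
  convert h2 using 1
  refine Finset.sum_congr rfl fun n hn => ?_
  rw [trunc_basisVec, if_pos (by simpa using hn)]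

theorem trunc_apply (K : ℕ) (a : Ell1 𝕜) (n : ℕ) :
    trunc 𝕜 K a n = if n < K then a n else 0 := by
  rw [trunc_eq_sum, ← coordCLM_apply, map_sum]
  simp [basisVec_apply]

theorem tendsto_trunc (a : Ell1 𝕜) : Tendsto (fun K => trunc 𝕜 K a) atTop (𝓝 a) := by
  simp only [trunc_eq_sum]
  exact (hasSum_basisVec a).tendsto_sum_nat

variable {E : Type*} [NormedAddCommGroup E] [NormedSpace 𝕜 E]

/-- The difference has zero columns below `K` and those of `T` beyond, so its norm is at most the
supremum of a tail. -/
theorem tendsto_comp_trunc {T : Ell1 𝕜 →L[𝕜] E}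
    (hT : Tendsto (fun n => T (basisVec 𝕜 n)) atTop (𝓝 0)) :
    Tendsto (fun K => T ∘L trunc 𝕜 K) atTop (𝓝 T) := by
  rw [Metric.tendsto_atTop]
  intro ε hε
  obtain ⟨K₀, hK₀⟩ := Metric.tendsto_atTop.1 hT (ε / 2) (half_pos hε)
  refine ⟨K₀, fun K hK => ?_⟩
  rw [dist_eq_norm]
  refine (norm_clm_le (half_pos hε).le fun n => ?_).trans_lt (half_lt_self hε)
  by_cases hn : n < K
  · simp [hn, (half_pos hε).le]
  · have := hK₀ n (by omega)
    simpa [hn] using this.le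

theorem isCompactOperator_comp_trunc (T : Ell1 𝕜 →L[𝕜] E) (K : ℕ) :
    IsCompactOperator (T ∘L trunc 𝕜 K) := by
  have : T ∘L trunc 𝕜 K =
      ∑ n ∈ Finset.range K, (coordCLM 𝕜 n).smulRight (T (basisVec 𝕜 n)) := by
    ext a
    simp [trunc_eq_sum]
  rw [this]
  refine Submodule.sum_mem (compactOperator (RingHom.id 𝕜) (Ell1 𝕜) E) fun n _ => ?_
  have h1 : IsCompactOperator (coordCLM 𝕜 n) :=
    isCompactOperator_of_locallyCompactSpace_dom (coordCLM 𝕜 n)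
  exact h1.clm_comp ((ContinuousLinearMap.id 𝕜 𝕜).smulRight (T (basisVec 𝕜 n)))

/-- A norm limit of finite rank operators. It yields the compactness of `ℳ` and of `Dℱ - I`. -/
theorem isCompactOperator_of_tendsto_basisVec [CompleteSpace E] {T : Ell1 𝕜 →L[𝕜] E}
    (hT : Tendsto (fun n => T (basisVec 𝕜 n)) atTop (𝓝 0)) : IsCompactOperator T :=
  isCompactOperator_of_tendsto (tendsto_comp_trunc hT)
    (Eventually.of_forall fun K => isCompactOperator_comp_trunc T K)

/-- Truncation converges uniformly on the image of a compact operator. -/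
theorem tendsto_trunc_comp {E : Type*} [NormedAddCommGroup E] [NormedSpace 𝕜 E]
    {T : E →L[𝕜] Ell1 𝕜} (hT : IsCompactOperator T) :
    Tendsto (fun K => trunc 𝕜 K ∘L T) atTop (𝓝 T) := by
  have hc := hT.isCompact_closure_image_closedBall (f := (T : E →ₗ[𝕜] Ell1 𝕜)) 1
  rw [Metric.tendsto_atTop]
  intro ε hε
  -- A finite `ε/4`-net of the image of the unit ball: truncation is close to the identity on the
  -- net, and contractive truncation carries this to the whole image, with three errors of at most
  -- `ε/4`.
  obtain ⟨t, -, htf, ht⟩ := hc.finite_cover_balls (show 0 < ε / 4 by positivity)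
  have hev : ∀ᶠ K in atTop, ∀ y ∈ t, dist (trunc 𝕜 K y) y < ε / 4 :=
    (Filter.eventually_all_finite htf).2 fun y _ =>
      (Metric.tendsto_nhds.1 (tendsto_trunc y)) _ (by positivity)
  obtain ⟨K₀, hK₀⟩ := eventually_atTop.1 hev
  refine ⟨K₀, fun K hK => ?_⟩
  rw [dist_eq_norm]
  refine (ContinuousLinearMap.opNorm_le_of_unit_norm (C := 3 * (ε / 4)) (by positivity)
    fun x hx => ?_).trans_lt (by linarith)
  have hx' : T x ∈ closure ((T : E →ₗ[𝕜] Ell1 𝕜) '' Metric.closedBall 0 1) :=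
    subset_closure ⟨x, by simp [hx], rfl⟩
  obtain ⟨y, hy, hxy⟩ := Set.mem_iUnion₂.1 (ht hx')
  rw [Metric.mem_ball, dist_eq_norm] at hxy
  have h1 := hK₀ K hK y hy
  rw [dist_eq_norm] at h1
  have h2 : ‖trunc 𝕜 K (T x - y)‖ ≤ ε / 4 :=
    ((trunc 𝕜 K).le_of_opNorm_le (norm_trunc_le K) _).trans (by rw [one_mul]; exact hxy.le)
  have : (trunc 𝕜 K ∘L T - T) x = trunc 𝕜 K (T x - y) + (trunc 𝕜 K y - y) - (T x - y) := by
    simp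
  rw [this]
  refine (norm_sub_le _ _).trans ?_
  have := norm_add_le (trunc 𝕜 K (T x - y)) (trunc 𝕜 K y - y)
  linarith

end Ell1

/-! ### The Gershgorin theorem with multiplicities for matrices -/

section FiniteGershgorin

theorem exists_fin_map_eq {α : Type*} (s : Multiset α) {n : ℕ} (h : s.card = n) :
    ∃ f : Fin n → α, Finset.univ.val.map f = s := by
  obtain ⟨l, rfl⟩ : ∃ l : List α, (l : Multiset α) = s := ⟨s.toList, s.coe_toList⟩
  rw [Multiset.coe_card] at h
  subst h
  exact ⟨l.get, (Fin.univ_val_map l.get).trans (congrArg _ (List.ofFn_get l))⟩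

theorem roots_prod_univ_X_sub_C {n : ℕ} (s : Fin n → ℂ) :
    (∏ i, (Polynomial.X - Polynomial.C (s i))).roots = Finset.univ.val.map s := by
  rw [← Polynomial.roots_multiset_prod_X_sub_C (Finset.univ.val.map s), Multiset.map_map]
  rfl

/-- The sum of the generalized eigenspaces for the eigenvalues in `U`. -/
def spectralSpace {V : Type*} [AddCommGroup V] [Module ℂ V] (f : Module.End ℂ V) (U : Set ℂ) :
    Submodule ℂ V := ⨆ μ ∈ U, f.maxGenEigenspace μ

theorem finrank_biSup_maxGenEigenspace {V : Type*} [AddCommGroup V] [Module ℂ V]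
    (f : Module.End ℂ V) (s : Finset ℂ)
    (hs : ∀ μ ∈ s, FiniteDimensional ℂ (f.maxGenEigenspace μ)) :
    FiniteDimensional ℂ (⨆ μ ∈ s, f.maxGenEigenspace μ : Submodule ℂ V) ∧
    Module.finrank ℂ (⨆ μ ∈ s, f.maxGenEigenspace μ : Submodule ℂ V) =
      ∑ μ ∈ s, Module.finrank ℂ (f.maxGenEigenspace μ) := by
  classical
  induction s using Finset.induction_on with
  | empty =>
    rw [show (⨆ μ ∈ (∅ : Finset ℂ), f.maxGenEigenspace μ) = ⊥ by simp]
    exact ⟨inferInstance, by simp⟩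
  | insert a s ha ih =>
    obtain ⟨h1, h2⟩ := ih fun μ hμ => hs μ (Finset.mem_insert_of_mem hμ)
    have h3 := hs a (Finset.mem_insert_self a s)
    have hd : Disjoint (f.maxGenEigenspace a) (⨆ μ ∈ s, f.maxGenEigenspace μ) :=
      (Module.End.independent_maxGenEigenspace f).disjoint_biSup (y := (s : Set ℂ)) ha
    rw [Finset.iSup_insert, Finset.sum_insert ha]
    refine ⟨inferInstance, ?_⟩
    have h4 := Submodule.finrank_sup_add_finrank_inf_eq (f.maxGenEigenspace a)
      (⨆ μ ∈ s, f.maxGenEigenspace μ)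
    rw [hd.eq_bot, finrank_bot, add_zero] at h4
    rw [h4, h2]

theorem finrank_spectralSpace_eq_sum {V : Type*} [AddCommGroup V] [Module ℂ V]
    (f : Module.End ℂ V) (U : Set ℂ) (s : Finset ℂ) (hsU : ∀ μ ∈ s, μ ∈ U)
    (hUs : ∀ μ ∈ U, μ ∉ s → f.maxGenEigenspace μ = ⊥)
    (hs : ∀ μ ∈ s, FiniteDimensional ℂ (f.maxGenEigenspace μ)) :
    Module.finrank ℂ (spectralSpace f U) =
      ∑ μ ∈ s, Module.finrank ℂ (f.maxGenEigenspace μ) := by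
  rw [← (finrank_biSup_maxGenEigenspace f s hs).2]
  have : spectralSpace f U = ⨆ μ ∈ s, f.maxGenEigenspace μ := by
    refine le_antisymm (iSup₂_le fun μ hμ => ?_)
      (iSup₂_le fun μ hμ => le_iSup₂_of_le μ (hsU μ hμ) le_rfl)
    by_cases h : μ ∈ s
    · exact le_iSup₂_of_le μ h le_rfl
    · simp [hUs μ hμ h]
  rw [this]

open Classical in
theorem finrank_spectralSpace_eq_countP {V : Type*} [AddCommGroup V] [Module ℂ V]
    [FiniteDimensional ℂ V] (f : Module.End ℂ V) (U : Set ℂ) :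
    Module.finrank ℂ (spectralSpace f U) = f.charpoly.roots.countP (· ∈ U) := by
  have h0 : f.charpoly ≠ 0 := f.charpoly_monic.ne_zero
  rw [finrank_spectralSpace_eq_sum f U (f.charpoly.roots.filter (· ∈ U)).toFinset]
  · rw [Multiset.countP_eq_card_filter, ← Multiset.toFinset_sum_count_eq]
    refine Finset.sum_congr rfl fun μ hμ => ?_
    rw [LinearMap.finrank_maxGenEigenspace_eq, Multiset.count_filter_of_pos,
      Polynomial.count_roots]
    simp at hμ; exact hμ.2
  · intro μ hμ; simp at hμ; exact hμ.2
  · intro μ hμ hs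
    have hr : ¬ f.charpoly.IsRoot μ := by
      intro h; apply hs; simp [hμ, h0]; exact h
    rw [← Submodule.finrank_eq_zero (R := ℂ), LinearMap.finrank_maxGenEigenspace_eq]
    exact Polynomial.rootMultiplicity_eq_zero hr
  · intro μ _; infer_instance

open Classical in
/-- If the eigenvalues of a continuous family of matrices stay in the union of two disjoint compact
sets, then the number of eigenvalues in the first one is constant. -/
theorem countP_roots_charpoly_const {K : ℕ} {U V : Set ℂ} (hU : IsCompact U) (hV : IsCompact V)
    (hUV : Disjoint U V) (B : unitInterval → Matrix (Fin K) (Fin K) ℂ) (hB : Continuous B)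
    (hr : ∀ t, ∀ μ ∈ (B t).charpoly.roots, μ ∈ U ∪ V) (t₀ t₁ : unitInterval) :
    (B t₀).charpoly.roots.countP (· ∈ U) = (B t₁).charpoly.roots.countP (· ∈ U) := by
  set k : unitInterval → ℕ := fun t => (B t).charpoly.roots.countP (· ∈ U) with hk
  have hcard : ∀ t, (B t).charpoly.roots.card = K := fun t => by
    rw [← (IsAlgClosed.splits (B t).charpoly).natDegree_eq_card_roots,
      Matrix.charpoly_natDegree_eq_dim, Fintype.card_fin]
  -- Being an ordered list of the roots is expressed by equations which are continuous in `(t, s)`,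
  -- hence is a closed condition.
  have hprod : ∀ t (s : Fin K → ℂ), Finset.univ.val.map s = (B t).charpoly.roots ↔
      ∀ z, (Matrix.scalar (Fin K) z - B t).det = ∏ i, (z - s i) := by
    intro t s
    have h1 : ∀ z, (Matrix.scalar (Fin K) z - B t).det = (B t).charpoly.eval z := fun z => by
      rw [Matrix.eval_charpoly]
    have h2 : (B t).charpoly = ((B t).charpoly.roots.map (Polynomial.X - Polynomial.C ·)).prod :=
      (IsAlgClosed.splits (B t).charpoly).eq_prod_roots_of_monic (B t).charpoly_monic
    constructor
    · intro h z
      rw [h1, h2, ← h, Multiset.map_map, Polynomial.eval_multiset_prod, Multiset.map_map,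
        Finset.prod]
      congr 1
      exact Multiset.map_congr rfl fun i _ => by simp
    · intro h
      have : (B t).charpoly = ∏ i, (Polynomial.X - Polynomial.C (s i)) := by
        refine Polynomial.funext fun z => ?_
        rw [← h1, h, Polynomial.eval_prod]; simp
      rw [this, roots_prod_univ_X_sub_C]
  -- The parameters with `j` roots in `U` are the projection of a compact set of pairs (parameter,
  -- ordered roots), where a set `s` of `j` indices marks the roots in `U` and the others lie in
  -- `V`. This replaces the continuity of the roots.
  have hclosed : ∀ j, IsClosed (k ⁻¹' {j}) := by
    intro j
    have : k ⁻¹' {j} = ⋃ s ∈ {s : Finset (Fin K) | s.card = j}, Prod.fst ''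
        {q : unitInterval × (Fin K → ℂ) |
          q ∈ (Set.univ ×ˢ (Set.univ.pi fun i => if i ∈ s then U else V)) ∩
            ⋂ z : ℂ, {q | (Matrix.scalar (Fin K) z - B q.1).det = ∏ i, (z - q.2 i)}} := by
      ext t
      simp only [Set.mem_preimage, Set.mem_singleton_iff, Set.mem_iUnion, Set.mem_ofPred_eq,
        Set.mem_image, Set.mem_inter_iff, Set.mem_prod, Set.mem_univ, true_and, Set.mem_iInter,
        Prod.exists, exists_and_right, exists_eq_right, Set.mem_pi, forall_true_left]
      constructor
      · intro ht
        obtain ⟨l, hl⟩ := exists_fin_map_eq (B t).charpoly.roots (hcard t)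
        have hmem : ∀ i, l i ∈ U ∪ V := fun i => hr t _ (by
          rw [← hl]; exact Multiset.mem_map_of_mem l (Finset.mem_univ_val i))
        refine ⟨Finset.univ.filter (fun i => l i ∈ U), ?_, l, fun i => ?_, (hprod t l).1 hl⟩
        · rw [← ht, hk]
          simp only
          rw [← hl, Multiset.countP_map]
          rfl
        · by_cases hi : l i ∈ U
          · simp [hi]
          · simpa [hi] using hmem i
      · rintro ⟨s, hs, l, hl, hdet⟩
        rw [hk]
        simp only
        rw [← (hprod t l).2 hdet, Multiset.countP_map, ← hs]
        change (Finset.univ.filter (fun i => l i ∈ U)).card = s.card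
        congr 1
        ext i
        have := hl i
        by_cases hi : i ∈ s
        · simpa [hi] using this
        · simp only [hi, if_false] at this
          simp only [Finset.mem_filter, Finset.mem_univ, true_and, hi, iff_false]
          exact fun h => Set.disjoint_left.1 hUV h this
    rw [this]
    refine (Set.toFinite _).isClosed_biUnion fun s _ => ?_
    refine IsCompact.isClosed (IsCompact.image ?_ continuous_fst)
    refine (isCompact_univ.prod (isCompact_univ_pi fun i => ?_)).inter_right
      (isClosed_iInter fun z => isClosed_eq ?_ ?_)
    · split_ifs; exacts [hU, hV]
    · exact (continuous_const.sub (hB.comp continuous_fst)).matrix_det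
    · fun_prop
  -- Only values up to `K` occur, so closed fibres make `k` continuous into discrete `ℕ`, hence
  -- constant on the connected interval.
  have hcont : Continuous k := by
    refine continuous_iff_isClosed.2 fun s _ => ?_
    have : k ⁻¹' s = ⋃ j ∈ s ∩ Set.Iic K, k ⁻¹' {j} := by
      ext t
      simp only [Set.mem_preimage, Set.mem_iUnion, Set.mem_singleton_iff, exists_prop,
        exists_eq_right', Set.mem_inter_iff, Set.mem_Iic]
      exact ⟨fun h => ⟨h, (Multiset.countP_le_card _ _).trans (hcard t).le⟩, fun h => h.1⟩
    rw [this]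
    exact ((Set.finite_Iic K).inter_of_right s).isClosed_biUnion fun j _ => hclosed j
  exact PreconnectedSpace.constant inferInstance hcont

/-- The Gershgorin theorem for columns, with multiplicities: the disks with indices in `S` lie in
`U`, the others in the set `V`, which is disjoint from `U`. -/
theorem finrank_spectralSpace_toLin' {K : ℕ} {U V : Set ℂ} (hU : IsCompact U) (hV : IsCompact V)
    (hUV : Disjoint U V) (A : Matrix (Fin K) (Fin K) ℂ) (S : Finset (Fin K))
    (hS : ∀ n ∈ S, Metric.closedBall (A n n) (∑ k ∈ Finset.univ.erase n, ‖A k n‖) ⊆ U)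
    (hS' : ∀ n ∉ S, Metric.closedBall (A n n) (∑ k ∈ Finset.univ.erase n, ‖A k n‖) ⊆ V) :
    Module.finrank ℂ (spectralSpace (Matrix.toLin' A) U) = S.card := by
  classical
  set d : Matrix (Fin K) (Fin K) ℂ := Matrix.diagonal fun n => A n n with hd
  -- The homotopy keeps the diagonal and shrinks the other entries, so every disk along it is
  -- contained in the corresponding disk of `A`.
  set B : unitInterval → Matrix (Fin K) (Fin K) ℂ := fun t => d + ((t : ℝ) : ℂ) • (A - d) with hBdef
  have hB : Continuous B := by fun_prop
  have hBd : ∀ t n, B t n n = A n n := fun t n => by simp [hBdef, hd]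
  have hBo : ∀ t k n, k ≠ n → ‖B t k n‖ ≤ ‖A k n‖ := fun t k n h => by
    simp only [hBdef, hd, Matrix.add_apply, Matrix.smul_apply, Matrix.sub_apply,
      Matrix.diagonal_apply_ne _ h, zero_add, sub_zero, smul_eq_mul, norm_mul]
    refine mul_le_of_le_one_left (norm_nonneg _) ?_
    rw [Complex.norm_real, Real.norm_eq_abs, abs_of_nonneg t.2.1]
    exact t.2.2
  have hr : ∀ t, ∀ μ ∈ (B t).charpoly.roots, μ ∈ U ∪ V := by
    intro t μ hμ
    -- `eigenvalue_mem_ball` uses row sums; the transpose has the same roots and turns columns into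
    -- rows.
    rw [← Matrix.charpoly_transpose] at hμ
    have hroot := (Polynomial.mem_roots'.1 hμ).2
    have hev : Module.End.HasEigenvalue (Matrix.toLin' (B t).transpose) μ := by
      rw [Module.End.hasEigenvalue_iff_isRoot_charpoly, Matrix.charpoly_toLin']
      exact hroot
    obtain ⟨n, hn⟩ := eigenvalue_mem_ball hev
    simp only [Matrix.transpose_apply, hBd] at hn
    have hle : ∑ j ∈ Finset.univ.erase n, ‖B t j n‖ ≤ ∑ k ∈ Finset.univ.erase n, ‖A k n‖ :=
      Finset.sum_le_sum fun k hk => hBo t k n (Finset.ne_of_mem_erase hk)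
    have hn' := Metric.closedBall_subset_closedBall hle hn
    by_cases h : n ∈ S
    · exact Or.inl (hS n h hn')
    · exact Or.inr (hS' n h hn')
  have hconst := countP_roots_charpoly_const hU hV hUV B hB hr 1 0
  have h1 : B 1 = A := by simp [hBdef]
  have h0 : B 0 = d := by simp [hBdef]
  rw [h1, h0] at hconst
  rw [finrank_spectralSpace_eq_countP, Matrix.charpoly_toLin', hconst, hd,
    Matrix.charpoly_diagonal, roots_prod_univ_X_sub_C (fun n => A n n), Multiset.countP_map]
  change (Finset.univ.filter (fun i => A i i ∈ U)).card = S.card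
  congr 1
  ext i
  have hi : A i i ∈ Metric.closedBall (A i i) (∑ k ∈ Finset.univ.erase i, ‖A k i‖) :=
    Metric.mem_closedBall_self (Finset.sum_nonneg fun _ _ => norm_nonneg _)
  simp only [Finset.mem_filter, Finset.mem_univ, true_and]
  by_cases h : i ∈ S
  · simp [h, hS i h hi]
  · simp only [h, iff_false]
    exact fun hU' => Set.disjoint_left.1 hUV hU' (hS' i h hi)

end FiniteGershgorin

/-! ### Generalized eigenspaces -/

section Spectral

variable {V : Type*} [AddCommGroup V] [Module ℂ V] (f : Module.End ℂ V) (U : Set ℂ)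

/-- Finite dimensional invariant subspaces spanned by generalized eigenvectors for eigenvalues in
`U`. -/
structure IsSpectralSub (F : Submodule ℂ V) : Prop where
  finite : FiniteDimensional ℂ F
  invariant : ∀ x ∈ F, f x ∈ F
  le : F ≤ ⨆ μ ∈ U, F ⊓ f.maxGenEigenspace μ

variable {f U}

theorem IsSpectralSub.bot : IsSpectralSub f U ⊥ :=
  ⟨inferInstance, fun x hx => by simp [(Submodule.mem_bot ℂ).1 hx], bot_le⟩

theorem IsSpectralSub.sup {F G : Submodule ℂ V} (hF : IsSpectralSub f U F)
    (hG : IsSpectralSub f U G) : IsSpectralSub f U (F ⊔ G) := by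
  have := hF.finite
  have := hG.finite
  refine ⟨inferInstance, fun x hx => ?_, sup_le (hF.le.trans ?_) (hG.le.trans ?_)⟩
  · obtain ⟨y, hy, z, hz, rfl⟩ := Submodule.mem_sup.1 hx
    rw [map_add]
    exact Submodule.add_mem_sup (hF.invariant y hy) (hG.invariant z hz)
  · exact iSup₂_mono fun μ _ => inf_le_inf_right _ le_sup_left
  · exact iSup₂_mono fun μ _ => inf_le_inf_right _ le_sup_right

theorem IsSpectralSub.le_spectralSpace {F : Submodule ℂ V} (hF : IsSpectralSub f U F) :
    F ≤ spectralSpace f U :=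
  hF.le.trans (iSup₂_mono fun _ _ => inf_le_right)

theorem mem_maxGenEigenspace_of_sub_mem {μ : ℂ} {x : V}
    (h : (f - μ • 1) x ∈ f.maxGenEigenspace μ) : x ∈ f.maxGenEigenspace μ := by
  rw [Module.End.mem_maxGenEigenspace] at h ⊢
  obtain ⟨k, hk⟩ := h
  exact ⟨k + 1, by rw [pow_succ]; exact hk⟩

/-- The chain `x, (f - μ)x, (f - μ)²x, …` stops after `k` terms and spans an invariant space of
generalized eigenvectors. -/
theorem exists_isSpectralSub_mem {μ : ℂ} (hμ : μ ∈ U) (k : ℕ) {x : V}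
    (hx : ((f - μ • 1) ^ k) x = 0) : ∃ F, IsSpectralSub f U F ∧ x ∈ F := by
  induction k generalizing x with
  | zero => exact ⟨⊥, .bot, by simpa using hx⟩
  | succ k ih =>
    rw [pow_succ] at hx
    obtain ⟨G, hG, hxG⟩ := ih hx
    have := hG.finite
    have hxm : x ∈ f.maxGenEigenspace μ :=
      mem_maxGenEigenspace_of_sub_mem ((Module.End.mem_maxGenEigenspace f μ _).2 ⟨k, hx⟩)
    have hxs : x ∈ G ⊔ ℂ ∙ x := Submodule.mem_sup_right (Submodule.mem_span_singleton_self x)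
    refine ⟨G ⊔ ℂ ∙ x, ⟨inferInstance, fun y hy => ?_, sup_le (hG.le.trans ?_) ?_⟩, hxs⟩
    · obtain ⟨z, hz, w, hw, rfl⟩ := Submodule.mem_sup.1 hy
      obtain ⟨c, rfl⟩ := Submodule.mem_span_singleton.1 hw
      have hfx : f x = (f - μ • 1) x + μ • x := by simp
      rw [map_add, map_smul, hfx]
      exact add_mem (Submodule.mem_sup_left (hG.invariant z hz))
        (Submodule.smul_mem _ _ (add_mem (Submodule.mem_sup_left hxG)
          (Submodule.smul_mem _ _ hxs)))
    · exact iSup₂_mono fun μ _ => inf_le_inf_right _ le_sup_left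
    · rw [Submodule.span_singleton_le_iff_mem]
      exact Submodule.mem_iSup_of_mem μ (Submodule.mem_iSup_of_mem hμ ⟨hxs, hxm⟩)

/-- If the dimensions of the spectral subspaces are bounded, then the sum of the generalized
eigenspaces is a spectral subspace. -/
theorem isSpectralSub_spectralSpace {n : ℕ}
    (h : ∀ F, IsSpectralSub f U F → Module.finrank ℂ F ≤ n) :
    IsSpectralSub f U (spectralSpace f U) := by
  -- A spectral subspace of maximal dimension contains every other one, since the sum of two
  -- spectral subspaces is spectral; it thus contains all generalized eigenvectors.
  set s : Set ℕ := {d | ∃ F, IsSpectralSub f U F ∧ Module.finrank ℂ F = d}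
  have hs : s.Nonempty := ⟨_, ⊥, .bot, rfl⟩
  have hb : BddAbove s := ⟨n, by rintro _ ⟨F, hF, rfl⟩; exact h F hF⟩
  obtain ⟨W, hW, hWd⟩ := Nat.sSup_mem hs hb
  have hmax : ∀ G, IsSpectralSub f U G → G ≤ W := fun G hG => by
    have h1 := hW.sup hG
    have := h1.finite
    have h2 : Module.finrank ℂ (W ⊔ G : Submodule ℂ V) ≤ Module.finrank ℂ W :=
      hWd ▸ le_csSup hb ⟨_, h1, rfl⟩
    have h3 := Submodule.eq_of_le_of_finrank_le (le_sup_left : W ≤ W ⊔ G) h2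
    rw [h3]; exact le_sup_right
  have : spectralSpace f U = W := by
    refine le_antisymm (iSup₂_le fun μ hμ x hx => ?_) hW.le_spectralSpace
    obtain ⟨k, hk⟩ := (Module.End.mem_maxGenEigenspace f μ x).1 hx
    obtain ⟨F, hF, hxF⟩ := exists_isSpectralSub_mem hμ k hk
    exact hmax F hF hxF
  rwa [this]

/-- On a generalized eigenspace for `ν ≠ μ`, `f - μ` is the nonzero scalar `ν - μ` plus a nilpotent
operator, hence surjective. -/
theorem pow_ker_le_map_sub {μ ν : ℂ} (h : ν ≠ μ) (k : ℕ) {y : V}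
    (hy : ((f - ν • 1) ^ k) y = 0) :
    ∃ z, ((f - ν • 1) ^ k) z = 0 ∧ (f - μ • 1) z = y := by
  induction k generalizing y with
  | zero => exact ⟨0, by simp, by simpa using Eq.symm hy⟩
  | succ k ih =>
    obtain ⟨z, hz, hzy⟩ := ih (y := (f - ν • 1) y) (by rw [pow_succ] at hy; exact hy)
    have hne : ν - μ ≠ 0 := sub_ne_zero.2 h
    refine ⟨(ν - μ)⁻¹ • (y - z), ?_, ?_⟩
    · rw [map_smul, map_sub, hy, pow_succ', Module.End.mul_apply, hz]; simp
    · rw [map_smul, map_sub, hzy, inv_smul_eq_iff₀ hne]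
      simp [sub_smul]

/-- The vector `(f - μ)x` splits into a generalized eigenvector for `μ` and some `(f - μ)u` with `u`
in the spectral space, because `f - μ` is onto the other generalized eigenspaces. Then `x - u` is a
generalized eigenvector for `μ`. -/
theorem mem_spectralSpace_of_sub_mem {μ : ℂ} (hμ : μ ∈ U) {x : V}
    (hx : (f - μ • 1) x ∈ spectralSpace f U) : x ∈ spectralSpace f U := by
  have hμle : f.maxGenEigenspace μ ≤ spectralSpace f U :=
    le_iSup₂_of_le (f := fun ν (_ : ν ∈ U) => f.maxGenEigenspace ν) μ hμ le_rfl
  have hle : spectralSpace f U ≤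
      f.maxGenEigenspace μ ⊔ (spectralSpace f U).map (f - μ • 1) := by
    refine iSup₂_le fun ν hν y hy => ?_
    by_cases h : ν = μ
    · subst h; exact Submodule.mem_sup_left hy
    · obtain ⟨k, hk⟩ := (Module.End.mem_maxGenEigenspace f ν y).1 hy
      obtain ⟨z, hz, rfl⟩ := pow_ker_le_map_sub h k hk
      refine Submodule.mem_sup_right ⟨z, ?_, rfl⟩
      exact (le_iSup₂_of_le (f := fun ν (_ : ν ∈ U) => f.maxGenEigenspace ν) ν hν le_rfl)
        ((Module.End.mem_maxGenEigenspace f ν z).2 ⟨k, hz⟩)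
  obtain ⟨w, hw, _, ⟨u, hu, rfl⟩, hwu⟩ := Submodule.mem_sup.1 (hle hx)
  have h1 : (f - μ • 1) (x - u) = w := by rw [map_sub, ← hwu]; simp
  have h2 : x - u ∈ f.maxGenEigenspace μ := mem_maxGenEigenspace_of_sub_mem (h1 ▸ hw)
  simpa using add_mem (hμle h2) hu

/-- A subspace which does not contain the spectral space for `U` can be extended by a generalized
eigenvector. -/
theorem exists_sub_mem_of_not_le {W : Submodule ℂ V} (h : ¬ spectralSpace f U ≤ W) :
    ∃ μ ∈ U, ∃ x ∉ W, (f - μ • 1) x ∈ W := by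
  by_contra! hcon
  refine h (iSup₂_le fun μ hμ x hx => ?_)
  obtain ⟨k, hk⟩ := (Module.End.mem_maxGenEigenspace f μ x).1 hx
  clear hx
  induction k generalizing x with
  | zero =>
    have : x = 0 := by simpa using hk
    rw [this]; exact zero_mem _
  | succ k ih =>
    by_contra hxW
    rw [pow_succ] at hk
    exact hcon μ hμ x hxW (ih _ hk)

end Spectral

/-! ### Gershgorin disks of operators on `ℓ¹` -/

section Gershgorin

/-- Removal of the `n`-th coordinate. -/
def offDiag (n : ℕ) : Ell1 ℂ →L[ℂ] Ell1 ℂ :=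
  ContinuousLinearMap.id ℂ (Ell1 ℂ) - (coordCLM ℂ n).smulRight (basisVec ℂ n)

theorem offDiag_apply (n k : ℕ) (x : Ell1 ℂ) : offDiag n x k = if k = n then 0 else x k := by
  have : offDiag n x = x - x n • basisVec ℂ n := rfl
  rw [this, lp.coeFn_sub, Pi.sub_apply, lp.coeFn_smul, Pi.smul_apply, basisVec_apply]
  split_ifs with h
  · subst h; simp
  · simp

theorem norm_offDiag_le (n : ℕ) : ‖offDiag n‖ ≤ 1 := by
  refine norm_clm_le zero_le_one fun k => ?_
  have : offDiag n (basisVec ℂ k) = if k = n then 0 else basisVec ℂ k := by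
    ext j
    rw [offDiag_apply]
    split_ifs with h1 h2 h2
    · rfl
    · subst h1; rw [basisVec_apply, if_neg (Ne.symm h2)]
    · rw [basisVec_apply, if_neg (by rwa [h2])]; rfl
    · rfl
  rw [this]
  split_ifs <;> simp

theorem norm_offDiag_apply_le (n : ℕ) (x : Ell1 ℂ) : ‖offDiag n x‖ ≤ ‖x‖ := by
  simpa using (offDiag n).le_of_opNorm_le (norm_offDiag_le n) x

/-- The center of the `n`-th Gershgorin disk of an operator on `ℓ¹`. -/
def diskCenter (M : Ell1 ℂ →L[ℂ] Ell1 ℂ) (n : ℕ) : ℂ := M (basisVec ℂ n) n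

/-- The radius of the `n`-th Gershgorin disk of an operator on `ℓ¹`. -/
def diskRadius (M : Ell1 ℂ →L[ℂ] Ell1 ℂ) (n : ℕ) : ℝ := ‖offDiag n (M (basisVec ℂ n))‖

/-- The `n`-th Gershgorin disk of an operator on `ℓ¹`. -/
def disk (M : Ell1 ℂ →L[ℂ] Ell1 ℂ) (n : ℕ) : Set ℂ :=
  Metric.closedBall (diskCenter M n) (diskRadius M n)

theorem diskRadius_nonneg (M : Ell1 ℂ →L[ℂ] Ell1 ℂ) (n : ℕ) : 0 ≤ diskRadius M n := norm_nonneg _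

theorem norm_center_add_radius_le (M : Ell1 ℂ →L[ℂ] Ell1 ℂ) (n : ℕ) :
    ‖diskCenter M n‖ + diskRadius M n ≤ 2 * ‖M (basisVec ℂ n)‖ := by
  have h1 := norm_apply_le (M (basisVec ℂ n)) n
  have h2 := norm_offDiag_apply_le n (M (basisVec ℂ n))
  unfold diskCenter diskRadius
  linarith

theorem disk_subset_closedBall (M : Ell1 ℂ →L[ℂ] Ell1 ℂ) (n : ℕ) :
    disk M n ⊆ Metric.closedBall 0 (2 * ‖M (basisVec ℂ n)‖) := by
  refine Metric.closedBall_subset_closedBall' ?_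
  rw [dist_zero_right, add_comm]
  exact norm_center_add_radius_le M n

/-- One half of `η` pays for the displacement of the center, the other half for the growth of the
radius. -/
theorem disk_subset_cthickening {M M' : Ell1 ℂ →L[ℂ] Ell1 ℂ} {η : ℝ} (hη : 0 ≤ η)
    (h : ‖M' - M‖ ≤ η / 2) (n : ℕ) : disk M' n ⊆ Metric.cthickening η (disk M n) := by
  unfold disk
  rw [cthickening_closedBall hη (diskRadius_nonneg M n)]
  have hn : ‖M' (basisVec ℂ n) - M (basisVec ℂ n)‖ ≤ η / 2 := by
    have := (M' - M).le_of_opNorm_le h (basisVec ℂ n)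
    simpa using this
  have h1 : dist (diskCenter M' n) (diskCenter M n) ≤ η / 2 := by
    rw [dist_eq_norm]
    exact (norm_apply_le (M' (basisVec ℂ n) - M (basisVec ℂ n)) n).trans hn
  have h2 : diskRadius M' n ≤ diskRadius M n + η / 2 := by
    have h3 : offDiag n (M' (basisVec ℂ n)) = offDiag n (M (basisVec ℂ n)) +
        offDiag n (M' (basisVec ℂ n) - M (basisVec ℂ n)) := by rw [map_sub]; abel
    unfold diskRadius
    rw [h3]
    exact (norm_add_le _ _).trans (add_le_add le_rfl ((norm_offDiag_apply_le _ _).trans hn))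
  exact Metric.closedBall_subset_closedBall' (by linarith)

/-- Every eigenvalue belongs to a Gershgorin disk. -/
theorem exists_mem_disk {M : Ell1 ℂ →L[ℂ] Ell1 ℂ} {lam : ℂ} {x : Ell1 ℂ} (hx : x ≠ 0)
    (h : M x = lam • x) : ∃ n, lam ∈ disk M n := by
  by_contra! hcon
  have hlt : ∀ n, diskRadius M n < ‖lam - diskCenter M n‖ := fun n => by
    have := hcon n
    rwa [disk, Metric.mem_closedBall, dist_eq_norm, not_le] at this
  have hd : ∀ n, ‖diskCenter M n • basisVec ℂ n‖ ≤ ‖M‖ := fun n => by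
    rw [norm_smul, norm_basisVec, mul_one]
    exact (norm_apply_le _ n).trans (by simpa using M.le_opNorm (basisVec ℂ n))
  -- With the diagonal part `Dg`, the eigenvalue equation reads `(M - Dg)x = (lam - Dg)x`. The left
  -- side has norm at most `∑ |x_n| r_n`; outside all disks the right side has strictly larger norm.
  set Dg : Ell1 ℂ →L[ℂ] Ell1 ℂ := liftSeq (fun n => diskCenter M n • basisVec ℂ n) ‖M‖ hd with hDg
  have h1 : ∀ n, (Dg x) n = diskCenter M n * x n := fun n => by
    have := clm_apply_hasSum (coordCLM ℂ n ∘L Dg) x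
    refine this.unique ?_
    convert hasSum_single n ?_ using 1
    · simp [hDg, basisVec_apply, mul_comm]
    · intro k hk
      simp [hDg, basisVec_apply, Ne.symm hk]
  have h2 : ∀ n, (M - Dg) (basisVec ℂ n) = offDiag n (M (basisVec ℂ n)) := fun n => by
    simp [hDg, offDiag, diskCenter]
  have h3 := clm_apply_hasSum (M - Dg) x
  have hsum : Summable fun n => ‖x n‖ * diskRadius M n := by
    refine Summable.of_nonneg_of_le (fun n => by positivity [diskRadius_nonneg M n]) (fun n => ?_)
      ((summable_norm_apply x).mul_right ‖M‖)
    refine mul_le_mul_of_nonneg_left ?_ (norm_nonneg _)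
    exact (norm_offDiag_apply_le _ _).trans (by simpa using M.le_opNorm (basisVec ℂ n))
  have h4 : ‖(M - Dg) x‖ ≤ ∑' n, ‖x n‖ * diskRadius M n := by
    rw [← h3.tsum_eq]
    refine tsum_of_norm_bounded hsum.hasSum fun n => ?_
    rw [h2, norm_smul]; rfl
  have h5 : ∀ n, ‖((M - Dg) x) n‖ = ‖x n‖ * ‖lam - diskCenter M n‖ := fun n => by
    rw [sub_apply, h, lp.coeFn_sub, Pi.sub_apply, h1, lp.coeFn_smul,
      Pi.smul_apply, smul_eq_mul, ← sub_mul, norm_mul, mul_comm]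
  rw [norm_eq_tsum] at h4
  have hsum' := summable_norm_apply ((M - Dg) x)
  simp only [h5] at h4 hsum'
  obtain ⟨n, hn⟩ : ∃ n, x n ≠ 0 := by
    by_contra! h0
    exact hx (by ext n; simp [h0 n])
  refine absurd h4 (not_le.2 (hsum.tsum_lt_tsum (i := n) (fun k => ?_) ?_ hsum'))
  · exact mul_le_mul_of_nonneg_left (hlt k).le (norm_nonneg _)
  · exact mul_lt_mul_of_pos_left (hlt n) (norm_pos_iff.2 hn)

end Gershgorin

/-! ### Finite dimensional models of compact operators on `ℓ¹` -/

section Model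

/-- The inclusion of `ℂ^K` in `ℓ¹`. -/
def finIncl (K : ℕ) : (Fin K → ℂ) →ₗ[ℂ] Ell1 ℂ :=
  ∑ n : Fin K, (LinearMap.proj n).smulRight (basisVec ℂ (n : ℕ))

/-- The first `K` coordinates of an element of `ℓ¹`. -/
def finCoord (K : ℕ) : Ell1 ℂ →ₗ[ℂ] (Fin K → ℂ) :=
  LinearMap.pi fun n => (coordCLM ℂ (n : ℕ) : Ell1 ℂ →ₗ[ℂ] ℂ)

@[simp]
theorem finCoord_apply (K : ℕ) (x : Ell1 ℂ) (n : Fin K) : finCoord K x n = x n := rfl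

theorem finIncl_eq_sum (K : ℕ) (y : Fin K → ℂ) :
    finIncl K y = ∑ n : Fin K, y n • basisVec ℂ (n : ℕ) := by
  simp [finIncl]

theorem finIncl_finCoord (K : ℕ) (x : Ell1 ℂ) : finIncl K (finCoord K x) = trunc ℂ K x := by
  rw [finIncl_eq_sum, trunc_eq_sum, Finset.sum_range]; rfl

theorem finCoord_finIncl (K : ℕ) (y : Fin K → ℂ) : finCoord K (finIncl K y) = y := by
  ext k
  rw [finIncl_eq_sum, map_sum, Finset.sum_apply, Finset.sum_eq_single k]
  · rw [map_smul]; simp [basisVec_apply]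
  · intro n _ hn
    rw [map_smul]; simp [basisVec_apply, Fin.val_inj, Ne.symm hn]
  · simp

theorem sum_erase_norm_le (x : Ell1 ℂ) {K : ℕ} (n : Fin K) :
    ∑ k ∈ Finset.univ.erase n, ‖x (k : Fin K)‖ ≤ ‖offDiag n x‖ := by
  rw [norm_eq_tsum]
  have h1 : ∑ k ∈ Finset.univ.erase n, ‖x (k : Fin K)‖ =
      ∑ k ∈ (Finset.univ.erase n).map Fin.valEmbedding, ‖offDiag n x k‖ := by
    rw [Finset.sum_map]
    refine Finset.sum_congr rfl fun k hk => ?_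
    rw [offDiag_apply, if_neg]
    · rfl
    · simpa [Fin.val_inj] using hk
  rw [h1]
  exact (summable_norm_apply _).sum_le_tsum _ fun _ _ => norm_nonneg _

/-- The matrix of the compression of an operator to the first `K` coordinates. -/
def compression (T : Ell1 ℂ →L[ℂ] Ell1 ℂ) (K : ℕ) : Matrix (Fin K) (Fin K) ℂ :=
  Matrix.of fun k n => T (basisVec ℂ (n : ℕ)) (k : ℕ)

theorem toLin'_compression (T : Ell1 ℂ →L[ℂ] Ell1 ℂ) (K : ℕ) (y : Fin K → ℂ) :
    Matrix.toLin' (compression T K) y = finCoord K (T (finIncl K y)) := by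
  ext k
  rw [finIncl_eq_sum, map_sum, map_sum, Finset.sum_apply, Matrix.toLin'_apply, Matrix.mulVec,
    dotProduct]
  refine Finset.sum_congr rfl fun n _ => ?_
  rw [map_smul, map_smul, compression, Matrix.of_apply, Pi.smul_apply, smul_eq_mul,
    finCoord_apply, mul_comm]

theorem closedBall_compression_subset (T : Ell1 ℂ →L[ℂ] Ell1 ℂ) {K : ℕ} (n : Fin K) :
    Metric.closedBall (compression T K n n)
      (∑ k ∈ Finset.univ.erase n, ‖compression T K k n‖) ⊆ disk T n :=
  Metric.closedBall_subset_closedBall (sum_erase_norm_le (T (basisVec ℂ (n : ℕ))) n)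

theorem exists_projection (W : Submodule ℂ (Ell1 ℂ)) [FiniteDimensional ℂ W] :
    ∃ P : Ell1 ℂ →L[ℂ] Ell1 ℂ, IsCompactOperator P ∧ (∀ x, P x ∈ W) ∧ ∀ x ∈ W, P x = x := by
  obtain ⟨q, hq⟩ := Submodule.ClosedComplemented.of_finiteDimensional W
  refine ⟨W.subtypeL ∘L q, ?_, fun x => (q x).2, fun x hx => ?_⟩
  · have : IsCompactOperator q := isCompactOperator_of_locallyCompactSpace_dom q
    exact this.clm_comp W.subtypeL
  · simpa using congrArg Subtype.val (hq ⟨x, hx⟩)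

/-- Plain truncation of `M` would not preserve `W`. Conjugation by an operator `σ` close to the
identity which moves `W` into the first `K` coordinates repairs this: `N = σ⁻¹ trunc σ M` agrees
with `M` on `W` and acts on the range of `i = σ⁻¹ finIncl` as the compression of `σ M σ⁻¹`, whose
disks are near those of `M`. -/
theorem exists_finite_model {M : Ell1 ℂ →L[ℂ] Ell1 ℂ} (hM : IsCompactOperator M)
    (S : Finset ℕ) {U V : Set ℂ} (hU : IsCompact U) (hV : IsCompact V) (hUV : Disjoint U V)
    {η : ℝ} (hη : 0 < η) (hS : ∀ n ∈ S, Metric.cthickening η (disk M n) ⊆ U)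
    (hS' : ∀ n ∉ S, Metric.cthickening η (disk M n) ⊆ V)
    (W : Submodule ℂ (Ell1 ℂ)) [FiniteDimensional ℂ W] (hW : ∀ x ∈ W, M x ∈ W) :
    ∃ (K : ℕ) (N : Ell1 ℂ →L[ℂ] Ell1 ℂ) (i : (Fin K → ℂ) →ₗ[ℂ] Ell1 ℂ)
      (A : Module.End ℂ (Fin K → ℂ)), Function.Injective i ∧ ‖N - M‖ < η ∧
      (∀ x ∈ W, N x = M x) ∧ (∀ y, N (i y) = i (A y)) ∧ W ≤ LinearMap.range i ∧
      Module.finrank ℂ (spectralSpace A U) = S.card := by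
  obtain ⟨P, hPc, hPW, hP⟩ := exists_projection W
  -- On `W` this is truncation. It tends to `1` in norm because `P` is compact, so it is eventually
  -- invertible.
  set σ : ℕ → (Ell1 ℂ →L[ℂ] Ell1 ℂ) := fun K => 1 - P + trunc ℂ K ∘L P with hσ
  have hσ1 : Tendsto σ atTop (𝓝 1) := by
    have := (tendsto_const_nhds (x := 1 - P)).add (tendsto_trunc_comp hPc)
    simpa using this
  set τ : ℕ → (Ell1 ℂ →L[ℂ] Ell1 ℂ) := fun K => Ring.inverse (σ K) with hτ
  have hτ1 : Tendsto τ atTop (𝓝 1) := by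
    have h := NormedRing.inverse_continuousAt (1 : (Ell1 ℂ →L[ℂ] Ell1 ℂ)ˣ)
    rw [ContinuousAt, Units.val_one, Ring.inverse_one] at h
    exact h.comp hσ1
  have hunit : ∀ᶠ K in atTop, IsUnit (σ K) :=
    hσ1 (Units.nhds (1 : (Ell1 ℂ →L[ℂ] Ell1 ℂ)ˣ))
  have hconj : Tendsto (fun K => σ K * M * τ K) atTop (𝓝 M) := by
    simpa using (hσ1.mul (tendsto_const_nhds (x := M))).mul hτ1
  -- Truncations do not tend to `1` in norm; they do after composition with the compact `M`, and the
  -- remainder contains the small factor `σ K - 1`.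
  have hN : Tendsto (fun K => τ K * (trunc ℂ K * (σ K * M))) atTop (𝓝 M) := by
    have h1 : Tendsto (fun K => trunc ℂ K * ((σ K - 1) * M)) atTop (𝓝 0) := by
      have h2 : Tendsto (fun K => (σ K - 1) * M) atTop (𝓝 0) := by
        simpa using (hσ1.sub_const 1).mul_const M
      refine squeeze_zero_norm (fun K => ?_) (tendsto_zero_iff_norm_tendsto_zero.1 h2)
      refine (norm_mul_le _ _).trans (mul_le_of_le_one_left (norm_nonneg _) (norm_trunc_le K))
    have h3 := (h1.add (tendsto_trunc_comp hM))
    have h4 : Tendsto (fun K => trunc ℂ K * (σ K * M)) atTop (𝓝 M) := by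
      simp only [zero_add] at h3
      refine h3.congr fun K => ?_
      rw [sub_mul, one_mul, mul_sub]
      exact sub_add_cancel _ _
    simpa using hτ1.mul h4
  have e1 : ∀ᶠ K in atTop, ‖σ K * M * τ K - M‖ < η / 2 := by
    simpa [dist_eq_norm] using Metric.tendsto_nhds.1 hconj (η / 2) (half_pos hη)
  have e2 : ∀ᶠ K in atTop, ‖τ K * (trunc ℂ K * (σ K * M)) - M‖ < η := by
    simpa [dist_eq_norm] using Metric.tendsto_nhds.1 hN η hη
  have e3 : ∀ᶠ K in atTop, ∀ n ∈ S, n < K :=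
    (Filter.eventually_all_finset S).2 fun n _ => eventually_gt_atTop n
  obtain ⟨K, hu, h1, h2, h3⟩ := (hunit.and (e1.and (e2.and e3))).exists
  have hτσ : ∀ x, τ K (σ K x) = x := fun x => by
    have := Ring.inverse_mul_cancel _ hu
    exact congrArg (fun T : Ell1 ℂ →L[ℂ] Ell1 ℂ => T x) this
  have hστ : ∀ x, σ K (τ K x) = x := fun x => by
    have := Ring.mul_inverse_cancel _ hu
    exact congrArg (fun T : Ell1 ℂ →L[ℂ] Ell1 ℂ => T x) this
  have hσW : ∀ x ∈ W, σ K x = trunc ℂ K x := fun x hx => by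
    simp [hσ, hP x hx]
  have htt : ∀ x, trunc ℂ K (trunc ℂ K x) = trunc ℂ K x := fun x => by
    ext n; simp only [trunc_apply]; split_ifs <;> rfl
  set M' : Ell1 ℂ →L[ℂ] Ell1 ℂ := σ K * M * τ K with hM'
  set A : Matrix (Fin K) (Fin K) ℂ := compression M' K with hA
  have hdisk : ∀ n : Fin K, Metric.closedBall (A n n) (∑ k ∈ Finset.univ.erase n, ‖A k n‖) ⊆
      Metric.cthickening η (disk M n) := fun n => by
    exact (closedBall_compression_subset M' n).trans (disk_subset_cthickening hη.le h1.le n)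
  refine ⟨K, τ K * (trunc ℂ K * (σ K * M)), (τ K : Ell1 ℂ →ₗ[ℂ] Ell1 ℂ) ∘ₗ finIncl K,
    Matrix.toLin' A, ?_, h2, fun x hx => ?_, fun y => ?_, fun x hx => ?_, ?_⟩
  · intro y z hyz
    have hyz' : τ K (finIncl K y) = τ K (finIncl K z) := hyz
    rw [← finCoord_finIncl K y, ← finCoord_finIncl K z, ← hστ (finIncl K y), hyz', hστ]
  · change τ K (trunc ℂ K (σ K (M x))) = M x
    rw [hσW _ (hW x hx), htt, ← hσW _ (hW x hx), hτσ]
  · change τ K (trunc ℂ K (σ K (M (τ K (finIncl K y))))) = τ K (finIncl K (Matrix.toLin' A y))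
    rw [toLin'_compression, finIncl_finCoord]
    rfl
  · refine ⟨finCoord K x, ?_⟩
    change τ K (finIncl K (finCoord K x)) = x
    rw [finIncl_finCoord, ← hσW x hx, hτσ]
  · have hcard : (Finset.univ.filter fun n : Fin K => (n : ℕ) ∈ S).card = S.card := by
      rw [← Finset.card_map Fin.valEmbedding]
      congr 1
      ext n
      simp only [Finset.mem_map, Finset.mem_filter, Finset.mem_univ, true_and,
        Fin.valEmbedding_apply]
      exact ⟨by rintro ⟨k, hk, rfl⟩; exact hk, fun hn => ⟨⟨n, h3 n hn⟩, hn, rfl⟩⟩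
    rw [← hcard]
    refine finrank_spectralSpace_toLin' hU hV hUV A _ (fun n hn => ?_) fun n hn => ?_
    · exact (hdisk n).trans (hS n (Finset.mem_filter.1 hn).2)
    · exact (hdisk n).trans (hS' n fun h => hn (Finset.mem_filter.2 ⟨Finset.mem_univ n, h⟩))

/-- Upper bound for the dimension of spectral subspaces from a finite dimensional model. -/
theorem finrank_le_of_model {V Y : Type*} [AddCommGroup V] [Module ℂ V] [AddCommGroup Y]
    [Module ℂ Y] [FiniteDimensional ℂ Y] {f : Module.End ℂ V} {U U' : Set ℂ} (hUU : U ⊆ U')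
    {F : Submodule ℂ V} (hF : IsSpectralSub f U F) {i : Y →ₗ[ℂ] V} (hi : Function.Injective i)
    {A : Module.End ℂ Y} (hA : ∀ y, i y ∈ F → f (i y) = i (A y)) (hFi : F ≤ LinearMap.range i) :
    Module.finrank ℂ F ≤ Module.finrank ℂ (spectralSpace A U') := by
  have h1 : F ≤ (spectralSpace A U').map i := by
    refine hF.le.trans (iSup₂_le fun μ hμ => ?_)
    rintro x ⟨hxF, hx⟩
    obtain ⟨y, rfl⟩ := hFi hxF
    obtain ⟨k, hk⟩ := (Module.End.mem_maxGenEigenspace f μ _).1 hx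
    -- The operators are intertwined only over `F`, so the induction must also record that the chain
    -- stays in `F`.
    have h2 : ∀ j : ℕ, i (((A - μ • 1) ^ j) y) ∈ F ∧
        i (((A - μ • 1) ^ j) y) = ((f - μ • 1) ^ j) (i y) := by
      intro j
      induction j with
      | zero => exact ⟨by simpa using hxF, by simp⟩
      | succ j ih =>
        have h3 : i (((A - μ • 1) ^ (j + 1)) y) = (f - μ • 1) (i (((A - μ • 1) ^ j) y)) := by
          rw [pow_succ', Module.End.mul_apply]
          simp [hA _ ih.1]
        refine ⟨?_, ?_⟩
        · rw [h3]
          simpa using sub_mem (hF.invariant _ ih.1) (F.smul_mem μ ih.1)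
        · rw [h3, ih.2, pow_succ', Module.End.mul_apply]
    refine ⟨y, ?_, rfl⟩
    refine (le_iSup₂_of_le (f := fun ν (_ : ν ∈ U') => A.maxGenEigenspace ν) μ (hUU hμ) le_rfl)
      ((Module.End.mem_maxGenEigenspace A μ y).2 ⟨k, hi ?_⟩)
    rw [(h2 k).2, hk, map_zero]
  refine (Submodule.finrank_mono h1).trans ?_
  rw [← (Submodule.equivMapOfInjective i hi _).finrank_eq]

end Model

/-! ### The Gershgorin theorem with multiplicities for compact operators on `ℓ¹` -/

section CompactGershgorin

/-- A compact operator which has approximate eigenvectors for values approaching a compact set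
`U` away from `0` has an eigenvalue in `U`. -/
theorem exists_hasEigenvalue_of_approx {X : Type*} [NormedAddCommGroup X] [NormedSpace ℂ X]
    {T : X →L[ℂ] X} (hT : IsCompactOperator T) {U : Set ℂ} (hU : IsCompact U) (h0 : (0 : ℂ) ∉ U)
    {δ C : ℝ} (hδ : 0 < δ)
    (h : ∀ η, 0 < η → η ≤ δ → ∃ μ ∈ Metric.cthickening η U, ∃ x : X, x ≠ 0 ∧
      ‖T x - μ • x‖ ≤ C * η * ‖x‖) :
    ∃ μ ∈ U, Module.End.HasEigenvalue (T : Module.End ℂ X) μ := by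
  set η : ℕ → ℝ := fun j => δ / (j + 1) with hη
  have hη0 : ∀ j, 0 < η j := fun j => by positivity
  have hηδ : ∀ j, η j ≤ δ := fun j => div_le_self hδ.le (by linarith [Nat.cast_nonneg (α := ℝ) j])
  have hηlim : Tendsto η atTop (𝓝 0) := by
    have := tendsto_one_div_add_atTop_nhds_zero_nat (𝕜 := ℝ) |>.const_mul δ
    simpa [hη, div_eq_mul_inv] using this
  choose μ hμ x hx hxμ using fun j => h (η j) (hη0 j) (hηδ j)
  have hc : IsCompact (Metric.cthickening δ U) := hU.cthickening
  obtain ⟨μ', -, φ, hφ, hlim⟩ := hc.tendsto_subseq fun j =>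
    Metric.cthickening_mono (hηδ j) U (hμ j)
  have hφη : Tendsto (fun j => η (φ j)) atTop (𝓝 0) := hηlim.comp hφ.tendsto_atTop
  have hUne : U.Nonempty := by
    rw [Set.nonempty_iff_ne_empty]
    rintro rfl
    simpa using hμ 0
  have hμU : μ' ∈ U := by
    rw [← hU.isClosed.closure_eq, Metric.mem_closure_iff_infDist_zero hUne]
    have h1 : Tendsto (fun j => Metric.infDist (μ (φ j)) U) atTop (𝓝 (Metric.infDist μ' U)) :=
      ((Metric.continuous_infDist_pt U).tendsto μ').comp hlim
    refine le_antisymm (le_of_tendsto_of_tendsto' h1 hφη fun j => ?_) Metric.infDist_nonneg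
    have := hμ (φ j)
    rw [Metric.mem_cthickening_iff] at this
    exact ENNReal.toReal_le_of_le_ofReal (hη0 _).le this
  refine ⟨μ', hμU, ?_⟩
  by_contra hne
  -- By Riesz theory a nonzero limit value which is not an eigenvalue makes `T - μ'` bounded below,
  -- against the approximate eigenvectors `x (φ j)`.
  obtain ⟨K, hK⟩ := hT.antilipschitz_of_not_hasEigenvalue
    (show μ' ≠ 0 from fun h => h0 (h ▸ hμU)) hne
  have hle : ∀ j, 1 ≤ (K : ℝ) * (C * η (φ j) + ‖μ (φ j) - μ'‖) := fun j => by
    have h1 := hK.le_mul_dist (x (φ j)) 0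
    simp only [dist_zero_right, map_zero] at h1
    have h2 : (T - μ' • (1 : X →L[ℂ] X)) (x (φ j)) =
        (T (x (φ j)) - μ (φ j) • x (φ j)) + (μ (φ j) - μ') • x (φ j) := by
      simp [sub_smul]
    have h3 : ‖(T - μ' • (1 : X →L[ℂ] X)) (x (φ j))‖ ≤
        (C * η (φ j) + ‖μ (φ j) - μ'‖) * ‖x (φ j)‖ := by
      rw [h2, add_mul, ← norm_smul]
      exact (norm_add_le _ _).trans (add_le_add (hxμ _) le_rfl)
    have h4 : 0 < ‖x (φ j)‖ := norm_pos_iff.2 (hx _)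
    have h5 := h1.trans (mul_le_mul_of_nonneg_left h3 K.2)
    rw [← mul_assoc] at h5
    exact le_of_mul_le_mul_right (by rw [one_mul]; exact h5) h4
  have hlim0 : Tendsto (fun j => (K : ℝ) * (C * η (φ j) + ‖μ (φ j) - μ'‖)) atTop (𝓝 0) := by
    have h1 : Tendsto (fun j => ‖μ (φ j) - μ'‖) atTop (𝓝 0) :=
      tendsto_iff_norm_sub_tendsto_zero.1 hlim
    simpa using ((hφη.const_mul C).add h1).const_mul (K : ℝ)
  exact absurd (ge_of_tendsto' hlim0 hle) (by norm_num)

variable {M : Ell1 ℂ →L[ℂ] Ell1 ℂ}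

/-- The `n`-th disk lies in the ball of radius `2‖M e_n‖` about `0`, so away from `0` only finitely
many disks matter, and `0` is the only limit point to be added. -/
theorem isCompact_insert_zero_disks (hcol : Tendsto (fun n => M (basisVec ℂ n)) atTop (𝓝 0))
    (I : Set ℕ) : IsCompact (insert 0 (⋃ n ∈ I, disk M n)) := by
  refine Metric.isCompact_of_isClosed_isBounded ?_ ?_
  · refine isClosed_of_closure_subset fun z hz => ?_
    by_contra hzV
    have hz0 : z ≠ 0 := fun h => hzV (h ▸ Set.mem_insert _ _)
    have hpos : 0 < ‖z‖ := norm_pos_iff.2 hz0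
    obtain ⟨n₀, hn₀⟩ := eventually_atTop.1 (Metric.tendsto_nhds.1 hcol (‖z‖ / 4) (by positivity))
    have hsub : insert 0 (⋃ n ∈ I, disk M n) ⊆
        Metric.closedBall 0 (‖z‖ / 2) ∪ ⋃ n ∈ I ∩ Set.Iio n₀, disk M n := by
      rintro w (rfl | hw)
      · exact Or.inl (Metric.mem_closedBall_self (by positivity))
      · obtain ⟨n, hn, hwn⟩ := Set.mem_iUnion₂.1 hw
        by_cases h : n < n₀
        · exact Or.inr (Set.mem_iUnion₂.2 ⟨n, ⟨hn, h⟩, hwn⟩)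
        · refine Or.inl (Metric.closedBall_subset_closedBall ?_ (disk_subset_closedBall M n hwn))
          have := hn₀ n (not_lt.1 h)
          rw [dist_zero_right] at this
          linarith
    have hcl : IsClosed (Metric.closedBall (0 : ℂ) (‖z‖ / 2) ∪ ⋃ n ∈ I ∩ Set.Iio n₀, disk M n) :=
      Metric.isClosed_closedBall.union
        (((Set.finite_Iio n₀).inter_of_right I).isClosed_biUnion fun n _ =>
          Metric.isClosed_closedBall)
    rcases closure_minimal hsub hcl hz with h | h
    · rw [Metric.mem_closedBall, dist_zero_right] at h
      linarith
    · obtain ⟨n, hn, hwn⟩ := Set.mem_iUnion₂.1 h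
      exact hzV (Or.inr (Set.mem_iUnion₂.2 ⟨n, hn.1, hwn⟩))
  · refine (Metric.isBounded_closedBall (x := (0 : ℂ)) (r := 2 * ‖M‖)).subset ?_
    rintro w (rfl | hw)
    · exact Metric.mem_closedBall_self (by positivity)
    · obtain ⟨n, hn, hwn⟩ := Set.mem_iUnion₂.1 hw
      refine Metric.closedBall_subset_closedBall ?_ (disk_subset_closedBall M n hwn)
      have := M.le_opNorm (basisVec ℂ n)
      rw [norm_basisVec] at this
      linarith

/-- **Gershgorin theorem for compact operators on `ℓ¹`.** The algebraic multiplicity of the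
eigenvalues in the union of finitely many disks, disjoint from `0` and from the other disks, is the
number of these disks. -/
theorem compact_gershgorin (hcol : Tendsto (fun n => M (basisVec ℂ n)) atTop (𝓝 0))
    (S : Finset ℕ) (hdisj : ∀ n ∉ S, ∀ k ∈ S, Disjoint (disk M n) (disk M k))
    (h0 : ∀ k ∈ S, (0 : ℂ) ∉ disk M k) :
    IsSpectralSub (M : Module.End ℂ (Ell1 ℂ)) (⋃ k ∈ S, disk M k)
      (spectralSpace (M : Module.End ℂ (Ell1 ℂ)) (⋃ k ∈ S, disk M k)) ∧
    Module.finrank ℂ (spectralSpace (M : Module.End ℂ (Ell1 ℂ)) (⋃ k ∈ S, disk M k)) =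
      S.card := by
  have hMc : IsCompactOperator M := isCompactOperator_of_tendsto_basisVec hcol
  set U : Set ℂ := ⋃ k ∈ S, disk M k with hU
  set V : Set ℂ := insert 0 (⋃ n ∈ (Sᶜ : Set ℕ), disk M n) with hV
  have hUc : IsCompact U := S.isCompact_biUnion fun n _ => isCompact_closedBall _ _
  have hVc : IsCompact V := isCompact_insert_zero_disks hcol _
  have h0U : (0 : ℂ) ∉ U := fun h => by
    obtain ⟨n, hn, hwn⟩ := Set.mem_iUnion₂.1 h
    exact h0 n hn hwn
  have hUV : Disjoint U V := by
    rw [Set.disjoint_right]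
    rintro z (rfl | hz) hzU
    · exact h0U hzU
    · obtain ⟨n, hn, hzn⟩ := Set.mem_iUnion₂.1 hz
      obtain ⟨k, hk, hzk⟩ := Set.mem_iUnion₂.1 hzU
      exact Set.disjoint_left.1 (hdisj n hn k hk) hzn hzk
  -- Every `η ≤ δ` gives a model. The single value `δ` suffices for the upper bound; the lower bound
  -- lets `η` tend to `0`.
  obtain ⟨δ, hδ, hδUV⟩ := hUV.exists_cthickenings hUc hVc.isClosed
  have model := fun (η : ℝ) (hη : 0 < η) (hηδ : η ≤ δ) (W : Submodule ℂ (Ell1 ℂ))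
      (_ : FiniteDimensional ℂ W) (hW : ∀ x ∈ W, M x ∈ W) =>
    exists_finite_model hMc S (U := Metric.cthickening η U) (V := Metric.cthickening η V)
      hUc.cthickening hVc.cthickening
      (hδUV.mono (Metric.cthickening_mono hηδ U) (Metric.cthickening_mono hηδ V)) hη
      (fun n hn => Metric.cthickening_subset_of_subset η
        (Set.subset_biUnion_of_mem (u := fun n => disk M n) hn))
      (fun n hn => Metric.cthickening_subset_of_subset η
        ((Set.subset_biUnion_of_mem (u := fun n => disk M n)
          (show n ∈ (Sᶜ : Set ℕ) from hn)).trans (Set.subset_insert _ _))) W hW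
  have hupper : ∀ F, IsSpectralSub (M : Module.End ℂ (Ell1 ℂ)) U F →
      Module.finrank ℂ F ≤ S.card := fun F hF => by
    obtain ⟨K, N, i, A, hi, -, hNF, hNi, hFi, hfin⟩ := model δ hδ le_rfl F hF.finite hF.invariant
    rw [← hfin]
    exact finrank_le_of_model (Metric.self_subset_cthickening U) hF hi
      (fun y hy => (hNF _ hy).symm.trans (hNi y)) hFi
  have hspec := isSpectralSub_spectralSpace hupper
  refine ⟨hspec, le_antisymm (hupper _ hspec) ?_⟩
  by_contra! hlt
  set W := spectralSpace (M : Module.End ℂ (Ell1 ℂ)) U with hW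
  have hWfin := hspec.finite
  obtain ⟨P, hPc, hPW, hP⟩ := exists_projection W
  -- The model has a spectral space of dimension `S.card`, too large to fit in `W`; so `N` has an
  -- eigenvector modulo `W`, and its part in the kernel of `P` is nearly an eigenvector of `(1 -
  -- P)M`.
  have happrox : ∀ η, 0 < η → η ≤ δ → ∃ μ ∈ Metric.cthickening η U, ∃ x : Ell1 ℂ, x ≠ 0 ∧
      ‖((1 - P) ∘L M) x - μ • x‖ ≤ ‖1 - P‖ * η * ‖x‖ := fun η hη hηδ => by
    obtain ⟨K, N, i, A, hi, hNM, hNW, hNi, hWi, hfin⟩ :=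
      model η hη hηδ W hWfin hspec.invariant
    have hnle : ¬ spectralSpace A (Metric.cthickening η U) ≤ W.comap i := fun hle => by
      have h1 := Submodule.finrank_mono hle
      have h2 : Module.finrank ℂ (W.comap i) ≤ Module.finrank ℂ W := by
        rw [(Submodule.equivMapOfInjective i hi _).finrank_eq]
        exact Submodule.finrank_mono (Submodule.map_comap_le i W)
      omega
    obtain ⟨μ, hμ, y, hyW, hy⟩ := exists_sub_mem_of_not_le hnle
    have hz : N (i y) - μ • i y ∈ W := by
      rw [Submodule.mem_comap] at hy
      simpa [hNi] using hy
    refine ⟨μ, hμ, i y - P (i y), ?_, ?_⟩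
    · intro h
      exact hyW (by rw [Submodule.mem_comap, sub_eq_zero.1 h]; exact hPW _)
    · set x := i y - P (i y) with hx
      have hNx : N x - μ • x ∈ W := by
        have h1 : N x - μ • x = (N (i y) - μ • i y) - (M (P (i y)) - μ • P (i y)) := by
          rw [hx, map_sub, hNW _ (hPW _), smul_sub]; abel
        rw [h1]
        exact sub_mem hz (sub_mem (hspec.invariant _ (hPW _)) (W.smul_mem _ (hPW _)))
      have hPx : P x = 0 := by rw [hx, map_sub, hP _ (hPW _), sub_self]
      have h2 : ((1 - P) ∘L M) x - μ • x = (1 - P) ((M - N) x) := by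
        -- Since `N x - μ x` lies in `W`, it is killed by `1 - P`, so only the difference `M - N`,
        -- of norm below `η`, remains.
        have h3 := hP _ hNx
        rw [map_sub, map_smul, hPx, smul_zero, sub_zero] at h3
        have h4 : ((1 - P) ∘L M) x = M x - P (M x) := rfl
        have h5 : (1 - P) ((M - N) x) = (M x - N x) - P (M x - N x) := rfl
        rw [h4, h5, map_sub P (M x) (N x), h3]
        abel
      rw [h2, mul_assoc]
      refine ((1 - P).le_opNorm _).trans (mul_le_mul_of_nonneg_left ?_ (norm_nonneg _))
      refine (M - N).le_of_opNorm_le ?_ x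
      rw [norm_sub_rev]; exact hNM.le
  have hTc : IsCompactOperator ((1 - P) ∘L M) := by
    rw [ContinuousLinearMap.coe_comp]
    exact hMc.clm_comp (1 - P)
  obtain ⟨μ, hμ, hev⟩ := exists_hasEigenvalue_of_approx hTc hUc h0U hδ happrox
  obtain ⟨x, hx⟩ := hev.exists_hasEigenvector
  have hTx : M x - P (M x) = μ • x := hx.apply_eq_smul
  have hμ0 : μ ≠ 0 := fun h => h0U (h ▸ hμ)
  -- An eigenvector of `(1 - P)M` for `μ ≠ 0` lies in the kernel of `P`, while `(M - μ)x = P(M x)`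
  -- is in `W`. The latter forces `x ∈ W`, so `x = P x = 0`.
  have hPx : P x = 0 := by
    have h1 : P (μ • x) = 0 := by rw [← hTx, map_sub, hP _ (hPW _), sub_self]
    rw [map_smul] at h1
    exact (smul_eq_zero.1 h1).resolve_left hμ0
  have hxW : x ∈ W := by
    refine mem_spectralSpace_of_sub_mem hμ ?_
    have : ((M : Module.End ℂ (Ell1 ℂ)) - μ • 1) x = P (M x) := by
      change M x - μ • x = P (M x)
      rw [← hTx]; abel
    rw [this]; exact hPW _
  exact hx.2 (by rw [← hP x hxW, hPx])

end CompactGershgorin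

end GegenbauerStability

namespace GegenbauerStability

open Filter Topology Polynomial

/-! ### Chebyshev series -/

section ChebyshevSeries

variable {𝕜 : Type} [RCLike 𝕜]

/-- The value at `x` of the `n`-th Chebyshev polynomial of the first kind. -/
def chebT (n : ℕ) (x : ℝ) : ℝ := (Chebyshev.T ℝ (n : ℤ)).eval x

theorem abs_chebT_le (n : ℕ) {x : ℝ} (hx : x ∈ segm) : |chebT n x| ≤ 1 :=
  Chebyshev.abs_eval_T_real_le_one n (abs_le.2 hx)

theorem continuous_chebT (n : ℕ) : Continuous (chebT n) := Polynomial.continuous _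

theorem norm_chebT_smul_le (n : ℕ) {x : ℝ} (hx : x ∈ segm) (c : 𝕜) : ‖chebT n x • c‖ ≤ ‖c‖ := by
  rw [norm_smul]
  exact mul_le_of_le_one_left (norm_nonneg _) (abs_chebT_le n hx)

theorem hasSum_G0 (a : Ell1 𝕜) {x : ℝ} (hx : x ∈ segm) :
    HasSum (fun n => chebT n x • a n) (G0 a x) :=
  (Summable.of_norm_bounded (summable_norm_apply a) fun n => norm_chebT_smul_le n hx _).hasSum

/-- Evaluation of Chebyshev series at a point of `[-1, 1]` as a continuous linear form. -/
def evalCLM (𝕜 : Type) [RCLike 𝕜] (x : segm) : Ell1 𝕜 →L[𝕜] 𝕜 :=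
  liftSeq (fun n => ((chebT n x : ℝ) : 𝕜)) 1 fun n => by
    rw [RCLike.norm_ofReal]; exact abs_chebT_le n x.2

theorem evalCLM_basisVec (n : ℕ) (x : segm) :
    evalCLM 𝕜 x (basisVec 𝕜 n) = ((chebT n x : ℝ) : 𝕜) := liftSeq_basisVec _ _ _ n

theorem evalCLM_apply (a : Ell1 𝕜) (x : segm) : evalCLM 𝕜 x a = G0 a x := by
  have h := clm_apply_hasSum (evalCLM 𝕜 x) a
  simp only [evalCLM_basisVec, smul_eq_mul] at h
  refine h.unique ((hasSum_G0 a x.2).congr_fun fun n => ?_)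
  rw [mul_comm, RCLike.real_smul_eq_coe_mul]

theorem G0_basisVec (n : ℕ) (x : ℝ) : G0 (basisVec 𝕜 n) x = ((chebT n x : ℝ) : 𝕜) := by
  unfold G0
  rw [tsum_eq_single n]
  · rw [basisVec_apply, if_pos rfl, RCLike.real_smul_eq_coe_mul, mul_one]; rfl
  · intro k hk
    rw [basisVec_apply, if_neg hk, smul_zero]

theorem G0_smul (c : 𝕜) (a : Ell1 𝕜) (x : ℝ) : G0 (c • a) x = c * G0 a x := by
  unfold G0
  rw [← smul_eq_mul, ← tsum_const_smul'' c]
  refine tsum_congr fun n => ?_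
  rw [lp.coeFn_smul, Pi.smul_apply, smul_comm]

theorem G0_add (a b : Ell1 𝕜) {x : ℝ} (hx : x ∈ segm) : G0 (a + b) x = G0 a x + G0 b x := by
  have := map_add (evalCLM 𝕜 ⟨x, hx⟩) a b
  simpa only [evalCLM_apply] using this

theorem G0_sub (a b : Ell1 𝕜) {x : ℝ} (hx : x ∈ segm) : G0 (a - b) x = G0 a x - G0 b x := by
  have := map_sub (evalCLM 𝕜 ⟨x, hx⟩) a b
  simpa only [evalCLM_apply] using this

theorem G0_zero (x : ℝ) : G0 (0 : Ell1 𝕜) x = 0 := by simp [G0]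

theorem G0_sum {ι : Type*} (s : Finset ι) (a : ι → Ell1 𝕜) {x : ℝ} (hx : x ∈ segm) :
    G0 (∑ i ∈ s, a i) x = ∑ i ∈ s, G0 (a i) x := by
  have := map_sum (evalCLM 𝕜 ⟨x, hx⟩) a s
  simpa only [evalCLM_apply] using this

theorem continuousOn_G0 (a : Ell1 𝕜) : ContinuousOn (G0 a) segm := by
  refine continuousOn_tsum (fun n => ?_) (summable_norm_apply a)
    fun n x hx => norm_chebT_smul_le n hx _
  exact ((continuous_chebT n).smul continuous_const).continuousOn

/-- Termwise integration along a path `γ` in the segment: `γ = cos` serves orthogonality, `γ = id`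
antiderivatives. -/
theorem hasSum_integral_G0 (a : Ell1 𝕜) {α β : ℝ} {φ γ : ℝ → ℝ} (hφ : Continuous φ)
    (hγ : Continuous γ) (hγs : ∀ t ∈ Set.uIoc α β, γ t ∈ segm) :
    HasSum (fun n => (∫ t in α..β, φ t * chebT n (γ t)) • a n)
      (∫ t in α..β, φ t • G0 a (γ t)) := by
  have h := intervalIntegral.hasSum_integral_of_dominated_convergence (a := α) (b := β)
    (μ := MeasureTheory.volume)
    (F := fun n t => (φ t * chebT n (γ t)) • a n) (f := fun t => φ t • G0 a (γ t))
    (fun n t => |φ t| * ‖a n‖) (fun n => ?_) (fun n => ?_) ?_ ?_ ?_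
  · simpa only [intervalIntegral.integral_smul_const] using h
  · exact (((hφ.mul ((continuous_chebT n).comp hγ)).smul
      continuous_const).stronglyMeasurable).aestronglyMeasurable
  · refine Eventually.of_forall fun t ht => ?_
    rw [mul_smul, norm_smul]
    exact mul_le_mul_of_nonneg_left (norm_chebT_smul_le n (hγs t ht) _) (norm_nonneg _)
  · exact Eventually.of_forall fun t _ => (summable_norm_apply a).mul_left _
  · simp only [tsum_mul_left]
    exact (hφ.abs.mul continuous_const).intervalIntegrable _ _
  · refine Eventually.of_forall fun t ht => ?_
    simpa only [mul_smul] using (hasSum_G0 a (hγs t ht)).const_smul (φ t)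

theorem integral_chebT_mul_chebT {n k : ℕ} (h : n ≠ k) :
    ∫ t in (0 : ℝ)..Real.pi, chebT n (Real.cos t) * chebT k (Real.cos t) = 0 := by
  have h1 := Chebyshev.integral_eval_T_real_mul_eval_T_real_measureT_of_ne h
  rwa [Chebyshev.integral_measureT_eq_integral_cos] at h1

theorem integral_chebT_mul_self_ne_zero (n : ℕ) :
    ∫ t in (0 : ℝ)..Real.pi, chebT n (Real.cos t) * chebT n (Real.cos t) ≠ 0 := by
  have h : ∫ t in (0 : ℝ)..Real.pi, chebT n (Real.cos t) * chebT n (Real.cos t) =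
      ∫ x, (Chebyshev.T ℝ (n : ℤ)).eval x * (Chebyshev.T ℝ (n : ℤ)).eval x
        ∂Chebyshev.measureT := by
    rw [Chebyshev.integral_measureT_eq_integral_cos]; rfl
  rw [h]
  rcases eq_or_ne n 0 with rfl | hn
  · rw [Nat.cast_zero, Chebyshev.integral_eval_T_real_mul_self_measureT_zero]
    exact Real.pi_ne_zero
  · rw [Chebyshev.integral_T_real_mul_self_measureT_of_ne_zero hn]
    exact div_ne_zero Real.pi_ne_zero two_ne_zero

/-- Orthogonality of the polynomials `T_n(cos t)` on `[0, π]` isolates each coefficient. Uniqueness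
makes the chosen values of `G0inv` and `Linv` computable. -/
theorem eq_zero_of_G0_eq_zero {a : Ell1 𝕜} (h : ∀ x ∈ segm, G0 a x = 0) : a = 0 := by
  ext n
  have hcos : ∀ t ∈ Set.uIoc (0 : ℝ) Real.pi, Real.cos t ∈ segm :=
    fun t _ => ⟨Real.neg_one_le_cos t, Real.cos_le_one t⟩
  have h1 := hasSum_integral_G0 a ((continuous_chebT n).comp Real.continuous_cos)
    Real.continuous_cos hcos
  have h2 : ∀ t, G0 a (Real.cos t) = 0 :=
    fun t => h _ ⟨Real.neg_one_le_cos t, Real.cos_le_one t⟩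
  simp only [h2, smul_zero, intervalIntegral.integral_zero, Function.comp_apply] at h1
  have h3 := h1.unique (hasSum_single n fun k hk => by
    rw [integral_chebT_mul_chebT (Ne.symm hk), zero_smul])
  exact (smul_eq_zero.1 h3.symm).resolve_left (integral_chebT_mul_self_ne_zero n)

theorem G0_injective {a b : Ell1 𝕜} (h : ∀ x ∈ segm, G0 a x = G0 b x) : a = b :=
  sub_eq_zero.1 (eq_zero_of_G0_eq_zero fun x hx => by rw [G0_sub a b hx, h x hx, sub_self])

theorem G0inv_eq {f : ℝ → 𝕜} {a : Ell1 𝕜} (h : ∀ x ∈ segm, G0 a x = f x) : G0inv f = a := by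
  have hex : ∃ a : Ell1 𝕜, ∀ x ∈ segm, G0 a x = f x := ⟨a, h⟩
  rw [G0inv, dif_pos hex]
  exact G0_injective fun x hx => (hex.choose_spec x hx).trans (h x hx).symm

/-! ### Products of Chebyshev series -/

/-- The product of two basis vectors for the multiplication of Chebyshev series. -/
def basisMul (𝕜 : Type) [RCLike 𝕜] (m n : ℕ) : Ell1 𝕜 :=
  (2 : 𝕜)⁻¹ • (basisVec 𝕜 (m + n) + basisVec 𝕜 ((m : ℤ) - n).natAbs)

theorem norm_basisMul_le (m n : ℕ) : ‖basisMul 𝕜 m n‖ ≤ 1 := by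
  rw [basisMul, norm_smul, norm_inv, RCLike.norm_ofNat]
  have := norm_add_le (basisVec 𝕜 (m + n)) (basisVec 𝕜 ((m : ℤ) - n).natAbs)
  simp only [norm_basisVec] at this
  linarith

theorem chebT_mul_chebT (m n : ℕ) (x : ℝ) :
    chebT m x * chebT n x = 2⁻¹ * (chebT (m + n) x + chebT ((m : ℤ) - n).natAbs x) := by
  have h := congrArg (Polynomial.eval x) (Chebyshev.T_mul_T ℝ (m : ℤ) (n : ℤ))
  simp only [Polynomial.eval_mul, Polynomial.eval_add, Polynomial.eval_ofNat] at h
  unfold chebT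
  rw [Chebyshev.T_natAbs, Nat.cast_add, ← h]
  ring

/-- The multiplication of Chebyshev series. -/
def chebMul (𝕜 : Type) [RCLike 𝕜] : Ell1 𝕜 →L[𝕜] Ell1 𝕜 →L[𝕜] Ell1 𝕜 :=
  liftSeq (fun m => liftSeq (basisMul 𝕜 m) 1 (norm_basisMul_le m)) 1 fun m =>
    norm_clm_le zero_le_one fun n => by rw [liftSeq_basisVec]; exact norm_basisMul_le m n

theorem G0_chebMul (a b : Ell1 𝕜) {x : ℝ} (hx : x ∈ segm) :
    G0 (chebMul 𝕜 a b) x = G0 a x * G0 b x := by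
  set ev := evalCLM 𝕜 ⟨x, hx⟩ with hev
  have hev' : ∀ c, ev c = G0 c x := fun c => evalCLM_apply c ⟨x, hx⟩
  -- Both sides are bounded bilinear maps, so comparison on pairs of basis vectors suffices.
  have h : (ContinuousLinearMap.compL 𝕜 (Ell1 𝕜) (Ell1 𝕜) 𝕜 ev) ∘L chebMul 𝕜 =
      ev.smulRight ev := by
    refine clm_ext fun m => clm_ext fun n => ?_
    have h1 : chebMul 𝕜 (basisVec 𝕜 m) (basisVec 𝕜 n) = basisMul 𝕜 m n := by
      rw [chebMul, liftSeq_basisVec, liftSeq_basisVec]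
    change ev (chebMul 𝕜 (basisVec 𝕜 m) (basisVec 𝕜 n)) =
      ev (basisVec 𝕜 m) • ev (basisVec 𝕜 n)
    rw [h1, basisMul, map_smul, map_add]
    simp only [hev', G0_basisVec, smul_eq_mul]
    rw [← RCLike.ofReal_mul, chebT_mul_chebT]
    push_cast
    ring
  have h2 := congrArg (fun T : Ell1 𝕜 →L[𝕜] Ell1 𝕜 →L[𝕜] 𝕜 => T a b) h
  change ev (chebMul 𝕜 a b) = ev a • ev b at h2
  simpa only [hev', smul_eq_mul] using h2

/-! ### Antiderivatives of Chebyshev series -/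

/-- A Chebyshev antiderivative of the `n`-th basis vector. -/
def basisAnti (𝕜 : Type) [RCLike 𝕜] : ℕ → Ell1 𝕜
  | 0 => basisVec 𝕜 1
  | 1 => (4 : 𝕜)⁻¹ • basisVec 𝕜 2
  | n + 2 => (2 * (n + 3) : 𝕜)⁻¹ • basisVec 𝕜 (n + 3) - (2 * (n + 1) : 𝕜)⁻¹ • basisVec 𝕜 (n + 1)

/-- The antiderivative of the `n`-th Chebyshev polynomial represented by `basisAnti`. -/
def chebAnti : ℕ → ℝ[X]
  | 0 => Chebyshev.T ℝ 1
  | 1 => C (4 : ℝ)⁻¹ * Chebyshev.T ℝ 2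
  | n + 2 => C (2 * (n + 3) : ℝ)⁻¹ * Chebyshev.T ℝ ((n : ℤ) + 3) -
      C (2 * (n + 1) : ℝ)⁻¹ * Chebyshev.T ℝ ((n : ℤ) + 1)

/-- From `T_n' = n U_{n-1}` and `2 T_{n+2} = U_{n+2} - U_n`. The index `1` is separate since the
general formula would divide by zero. -/
theorem derivative_chebAnti (n : ℕ) : derivative (chebAnti n) = Chebyshev.T ℝ (n : ℤ) := by
  match n with
  | 0 => simp [chebAnti]
  | 1 =>
    simp only [chebAnti, derivative_C_mul, Chebyshev.T_derivative_eq_U]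
    norm_num
    rw [show (2 : ℝ[X]) = C 2 by rfl, ← mul_assoc, ← mul_assoc, ← C_mul, ← C_mul]
    norm_num
  | n + 2 =>
    have h := Chebyshev.two_mul_T_eq_U_sub_U ℝ (n : ℤ)
    have h3 : (n + 3 : ℝ) ≠ 0 := by positivity
    have h1 : (n + 1 : ℝ) ≠ 0 := by positivity
    simp only [chebAnti, derivative_sub, derivative_C_mul, Chebyshev.T_derivative_eq_U]
    have e3 : (((n : ℤ) + 3 : ℤ) : ℝ[X]) = C (n + 3 : ℝ) := by
      push_cast; rw [C_add, map_natCast, map_ofNat]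
    have e1 : (((n : ℤ) + 1 : ℤ) : ℝ[X]) = C (n + 1 : ℝ) := by push_cast; simp
    rw [e3, e1, ← mul_assoc, ← mul_assoc, ← C_mul, ← C_mul,
      show (2 * (n + 3) : ℝ)⁻¹ * (n + 3) = 2⁻¹ by field_simp,
      show (2 * (n + 1) : ℝ)⁻¹ * (n + 1) = 2⁻¹ by field_simp,
      show (n : ℤ) + 3 - 1 = n + 2 by ring, show (n : ℤ) + 1 - 1 = n by ring, ← mul_sub, ← h,
      show (2 : ℝ[X]) = C 2 by rfl, ← mul_assoc, ← C_mul]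
    norm_num

theorem G0_basisAnti (n : ℕ) {x : ℝ} (hx : x ∈ segm) :
    G0 (basisAnti 𝕜 n) x = (((chebAnti n).eval x : ℝ) : 𝕜) := by
  match n with
  | 0 => rw [basisAnti, G0_basisVec]; rfl
  | 1 =>
    rw [basisAnti, G0_smul, G0_basisVec]
    simp only [chebAnti, chebT, eval_mul, eval_C]
    push_cast
    rfl
  | n + 2 =>
    rw [basisAnti, G0_sub _ _ hx, G0_smul, G0_smul, G0_basisVec, G0_basisVec]
    simp only [chebAnti, chebT, eval_sub, eval_mul, eval_C]
    push_cast
    rfl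

theorem norm_basisAnti_add_two_le (n : ℕ) : ‖basisAnti 𝕜 (n + 2)‖ ≤ 1 / ((n : ℝ) + 1) := by
  have hn : (0 : ℝ) < n + 1 := by positivity
  have h : ∀ k : ℕ, ‖(2 * (k : 𝕜))⁻¹‖ = (2 * (k : ℝ))⁻¹ := fun k => by
    rw [norm_inv, norm_mul, RCLike.norm_ofNat, RCLike.norm_natCast]
  rw [basisAnti]
  refine (norm_sub_le _ _).trans ?_
  have h3 := h (n + 3)
  have h1 := h (n + 1)
  push_cast at h3 h1
  rw [norm_smul, norm_smul, norm_basisVec, norm_basisVec, mul_one, mul_one, h3, h1]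
  have h4 : (2 * ((n : ℝ) + 3))⁻¹ ≤ (2 * ((n : ℝ) + 1))⁻¹ := by
    apply inv_anti₀ <;> linarith
  have h5 : (2 * ((n : ℝ) + 1))⁻¹ + (2 * ((n : ℝ) + 1))⁻¹ = 1 / ((n : ℝ) + 1) := by
    field_simp; norm_num
  linarith

theorem norm_basisAnti_le (n : ℕ) : ‖basisAnti 𝕜 n‖ ≤ 1 := by
  match n with
  | 0 => simp [basisAnti]
  | 1 =>
    rw [basisAnti, norm_smul, norm_basisVec, norm_inv, RCLike.norm_ofNat]; norm_num
  | n + 2 =>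
    refine (norm_basisAnti_add_two_le n).trans ?_
    rw [div_le_one (by positivity)]
    linarith [Nat.cast_nonneg (α := ℝ) n]

/-- The antiderivative operator on Chebyshev series. -/
def antiCLM (𝕜 : Type) [RCLike 𝕜] : Ell1 𝕜 →L[𝕜] Ell1 𝕜 :=
  liftSeq (basisAnti 𝕜) 1 norm_basisAnti_le

@[simp]
theorem antiCLM_basisVec (n : ℕ) : antiCLM 𝕜 (basisVec 𝕜 n) = basisAnti 𝕜 n :=
  liftSeq_basisVec _ _ _ n

theorem tendsto_antiCLM_basisVec :
    Tendsto (fun n => antiCLM 𝕜 (basisVec 𝕜 n)) atTop (𝓝 0) := by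
  rw [← tendsto_add_atTop_iff_nat 2]
  simp only [antiCLM_basisVec]
  exact squeeze_zero_norm norm_basisAnti_add_two_le tendsto_one_div_add_atTop_nhds_zero_nat

theorem integral_chebT (n : ℕ) (x : ℝ) :
    ∫ t in (-1 : ℝ)..x, chebT n t = (chebAnti n).eval x - (chebAnti n).eval (-1) := by
  refine intervalIntegral.integral_eq_sub_of_hasDerivAt
    (f := fun t => (chebAnti n).eval t) (fun t _ => ?_)
    ((continuous_chebT n).intervalIntegrable _ _)
  have := (chebAnti n).hasDerivAt t
  rwa [derivative_chebAnti] at this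

theorem G0_antiCLM (a : Ell1 𝕜) {x : ℝ} (hx : x ∈ segm) :
    G0 (antiCLM 𝕜 a) x = G0 (antiCLM 𝕜 a) (-1) + ∫ t in (-1 : ℝ)..x, G0 a t := by
  have hm : (-1 : ℝ) ∈ segm := by simp
  have h1 := hasSum_integral_G0 a (α := -1) (β := x) (φ := fun _ => 1) (γ := id)
    continuous_const continuous_id (fun t ht => by
      rw [Set.uIoc_of_le hx.1] at ht
      exact ⟨ht.1.le, ht.2.trans hx.2⟩)
  simp only [id, one_mul, one_smul, integral_chebT] at h1
  have h2 := clm_apply_hasSum ((evalCLM 𝕜 ⟨x, hx⟩ - evalCLM 𝕜 ⟨-1, hm⟩) ∘L antiCLM 𝕜) a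
  have h3 : (((evalCLM 𝕜 ⟨x, hx⟩ - evalCLM 𝕜 ⟨-1, hm⟩) ∘L antiCLM 𝕜) a) =
      G0 (antiCLM 𝕜 a) x - G0 (antiCLM 𝕜 a) (-1) := by
    simp [evalCLM_apply]
  rw [h3] at h2
  have h4 : ∀ n, a n • ((evalCLM 𝕜 ⟨x, hx⟩ - evalCLM 𝕜 ⟨-1, hm⟩) ∘L antiCLM 𝕜) (basisVec 𝕜 n) =
      ((chebAnti n).eval x - (chebAnti n).eval (-1)) • a n := fun n => by
    simp only [ContinuousLinearMap.comp_apply, sub_apply, antiCLM_basisVec, evalCLM_apply,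
      G0_basisAnti n hx, G0_basisAnti n hm]
    rw [smul_eq_mul, mul_comm, RCLike.real_smul_eq_coe_mul, RCLike.ofReal_sub]
  simp only [h4] at h2
  rw [← h2.unique h1]; ring

theorem hasDerivWithinAt_G0_antiCLM (a : Ell1 𝕜) {x : ℝ} (hx : x ∈ segm) :
    HasDerivWithinAt (G0 (antiCLM 𝕜 a)) (G0 a x) segm x := by
  have : Fact (x ∈ Set.Icc (-1 : ℝ) 1) := ⟨hx⟩
  have hint : IntervalIntegrable (G0 a) MeasureTheory.volume (-1) x := by
    refine ContinuousOn.intervalIntegrable ((continuousOn_G0 a).mono ?_)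
    rw [Set.uIcc_of_le hx.1]
    exact Set.Icc_subset_Icc_right hx.2
  have h1 := intervalIntegral.integral_hasDerivWithinAt_right hint (s := segm) (t := segm)
    ((continuousOn_G0 a).stronglyMeasurableAtFilter_nhdsWithin measurableSet_Icc x)
    (continuousOn_G0 a x hx)
  exact (h1.const_add (G0 (antiCLM 𝕜 a) (-1))).congr (fun y hy => G0_antiCLM a hy)
    (G0_antiCLM a hx)

end ChebyshevSeries

/-! ### Derivatives of Chebyshev series -/

section Derivatives

variable {𝕜 : Type} [RCLike 𝕜]

theorem uniqueDiffOn_segm : UniqueDiffOn ℝ segm := uniqueDiffOn_Icc (by norm_num)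

theorem D_congr {u v : ℝ → 𝕜} (h : ∀ x ∈ segm, u x = v x) (k : ℕ) {x : ℝ} (hx : x ∈ segm) :
    D k u x = D k v x :=
  iteratedDerivWithin_congr (fun _ hy => h _ hy) hx

theorem D_zero (v : ℝ → 𝕜) (x : ℝ) : D 0 v x = v x := by simp [D]

/-- Higher one-sided derivatives are read off from coefficient sequences that are successive
derivatives of each other. -/
theorem D_chain (V : ℕ → Ell1 𝕜) (n : ℕ)
    (h : ∀ j < n, ∀ x ∈ segm, HasDerivWithinAt (G0 (V j)) (G0 (V (j + 1)) x) segm x) :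
    (∀ j ≤ n, ∀ x ∈ segm, D j (G0 (V 0)) x = G0 (V j) x) ∧
      ContDiffOn ℝ (n : WithTop ℕ∞) (G0 (V 0)) segm := by
  have h1 : ∀ j ≤ n, ∀ x ∈ segm, D j (G0 (V 0)) x = G0 (V j) x := by
    intro j
    induction j with
    | zero => intro _ x _; exact D_zero _ x
    | succ j ih =>
      intro hj x hx
      rw [D, iteratedDerivWithin_succ]
      have h2 := (h j hj x hx).congr (fun y hy => ih (by omega) y hy) (ih (by omega) x hx)
      exact h2.derivWithin (uniqueDiffOn_segm x hx)
  refine ⟨h1, ?_⟩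
  have := contDiffOn_of_continuousOn_differentiableOn_deriv (n := (n : ℕ∞)) (f := G0 (V 0))
    (s := segm) (fun m hm => ?_) (fun m hm => ?_)
  · exact_mod_cast this
  · have hm' : m ≤ n := by exact_mod_cast hm
    exact (continuousOn_G0 (V m)).congr fun x hx => h1 m hm' x hx
  · have hm' : m < n := by exact_mod_cast hm
    intro x hx
    exact ((h m hm' x hx).congr (fun y hy => h1 m hm'.le y hy)
      (h1 m hm'.le x hx)).differentiableWithinAt

theorem exists_G0_eq_eval (q : ℝ[X]) :
    ∃ a : Ell1 𝕜, ∀ x ∈ segm, G0 a x = ((q.eval x : ℝ) : 𝕜) := by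
  induction q using Polynomial.induction_on' with
  | add q r hq hr =>
    obtain ⟨a, ha⟩ := hq
    obtain ⟨b, hb⟩ := hr
    exact ⟨a + b, fun x hx => by rw [G0_add a b hx, ha x hx, hb x hx, eval_add]; push_cast; rfl⟩
  | monomial n c =>
    induction n with
    | zero =>
      refine ⟨(c : 𝕜) • basisVec 𝕜 0, fun x _ => ?_⟩
      rw [G0_smul, G0_basisVec]; simp [chebT]
    | succ n ih =>
      obtain ⟨a, ha⟩ := ih
      refine ⟨chebMul 𝕜 a (basisVec 𝕜 1), fun x hx => ?_⟩
      rw [G0_chebMul _ _ hx, ha x hx, G0_basisVec, ← RCLike.ofReal_mul]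
      congr 1
      simp [chebT, pow_succ, mul_assoc]

/-- The sequence of Chebyshev coefficients of a real polynomial. -/
def polySeq (𝕜 : Type) [RCLike 𝕜] (q : ℝ[X]) : Ell1 𝕜 := (exists_G0_eq_eval q).choose

theorem G0_polySeq (q : ℝ[X]) {x : ℝ} (hx : x ∈ segm) :
    G0 (polySeq 𝕜 q) x = ((q.eval x : ℝ) : 𝕜) := (exists_G0_eq_eval q).choose_spec x hx

theorem hasDerivWithinAt_G0_polySeq (q : ℝ[X]) {x : ℝ} (hx : x ∈ segm) :
    HasDerivWithinAt (G0 (polySeq 𝕜 q)) (G0 (polySeq 𝕜 (derivative q)) x) segm x := by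
  have h := ((q.hasDerivAt x).smul_const (1 : 𝕜)).hasDerivWithinAt (s := segm)
  have e : ∀ r : ℝ[X], ∀ y ∈ segm, G0 (polySeq 𝕜 r) y = r.eval y • (1 : 𝕜) := fun r y hy => by
    rw [G0_polySeq r hy, RCLike.real_smul_eq_coe_mul, mul_one]
  rw [e _ x hx]
  exact h.congr (fun y hy => e q y hy) (e q x hx)

theorem HasDerivWithinAt.G0_add {a a' b b' : Ell1 𝕜} {x : ℝ} (hx : x ∈ segm)
    (ha : HasDerivWithinAt (G0 a) (G0 a' x) segm x)
    (hb : HasDerivWithinAt (G0 b) (G0 b' x) segm x) :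
    HasDerivWithinAt (G0 (a + b)) (G0 (a' + b') x) segm x := by
  rw [GegenbauerStability.G0_add a' b' hx]
  exact (ha.add hb).congr (fun y hy => GegenbauerStability.G0_add a b hy)
    (GegenbauerStability.G0_add a b hx)

theorem HasDerivWithinAt.G0_smul {a a' : Ell1 𝕜} {x : ℝ} (c : 𝕜)
    (ha : HasDerivWithinAt (G0 a) (G0 a' x) segm x) :
    HasDerivWithinAt (G0 (c • a)) (G0 (c • a') x) segm x := by
  rw [GegenbauerStability.G0_smul]
  exact (ha.const_mul c).congr (fun y _ => GegenbauerStability.G0_smul c a y)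
    (GegenbauerStability.G0_smul c a x)

theorem HasDerivWithinAt.G0_sum {ι : Type*} (s : Finset ι) {a a' : ι → Ell1 𝕜} {x : ℝ}
    (hx : x ∈ segm) (h : ∀ i ∈ s, HasDerivWithinAt (G0 (a i)) (G0 (a' i) x) segm x) :
    HasDerivWithinAt (G0 (∑ i ∈ s, a i)) (G0 (∑ i ∈ s, a' i) x) segm x := by
  rw [GegenbauerStability.G0_sum s a' hx]
  exact (HasDerivWithinAt.fun_sum h).congr (fun y hy => GegenbauerStability.G0_sum s a hy)
    (GegenbauerStability.G0_sum s a hx)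

/-- The span of the first `n` basis vectors. -/
def initialSpan (𝕜 : Type) [RCLike 𝕜] (n : ℕ) : Submodule 𝕜 (Ell1 𝕜) :=
  Submodule.span 𝕜 (Set.range fun i : Fin n => basisVec 𝕜 (i : ℕ))

theorem basisVec_mem_initialSpan {k n : ℕ} (h : k < n) : basisVec 𝕜 k ∈ initialSpan 𝕜 n :=
  Submodule.subset_span ⟨⟨k, h⟩, rfl⟩

theorem antiCLM_mem_initialSpan {n : ℕ} {b : Ell1 𝕜} (hb : b ∈ initialSpan 𝕜 n) :
    antiCLM 𝕜 b ∈ initialSpan 𝕜 (n + 1) := by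
  have : initialSpan 𝕜 n ≤ (initialSpan 𝕜 (n + 1)).comap (antiCLM 𝕜 : Ell1 𝕜 →ₗ[𝕜] Ell1 𝕜) := by
    refine Submodule.span_le.2 ?_
    rintro _ ⟨⟨i, hi⟩, rfl⟩
    change antiCLM 𝕜 (basisVec 𝕜 i) ∈ initialSpan 𝕜 (n + 1)
    rw [antiCLM_basisVec]
    match i, hi with
    | 0, hi => exact basisVec_mem_initialSpan (by omega)
    | 1, hi => exact Submodule.smul_mem _ _ (basisVec_mem_initialSpan (by omega))
    | i + 2, hi =>
      exact sub_mem (Submodule.smul_mem _ _ (basisVec_mem_initialSpan (by omega)))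
        (Submodule.smul_mem _ _ (basisVec_mem_initialSpan (by omega)))
  exact this hb

theorem eqOn_add_const_of_derivWithin_eq {v : ℝ → 𝕜} (hv : DifferentiableOn ℝ v segm)
    {a : Ell1 𝕜} (h : ∀ x ∈ segm, derivWithin v segm x = G0 a x) :
    ∃ c : 𝕜, ∀ x ∈ segm, v x = G0 (antiCLM 𝕜 a + c • basisVec 𝕜 0) x := by
  refine ⟨v (-1) - G0 (antiCLM 𝕜 a) (-1), fun x hx => ?_⟩
  have h0 : ∀ y ∈ Set.Ico (-1 : ℝ) 1,
      HasDerivWithinAt (fun y => v y - G0 (antiCLM 𝕜 a) y) 0 (Set.Ici y) y := fun y hy => by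
    have hy' : y ∈ segm := ⟨hy.1, hy.2.le⟩
    have h1 := (hv y hy').hasDerivWithinAt
    rw [h y hy'] at h1
    have h2 := h1.sub (hasDerivWithinAt_G0_antiCLM a hy')
    rw [sub_self] at h2
    exact h2.mono_of_mem_nhdsWithin (Icc_mem_nhdsGE_of_mem hy)
  have hcont : ContinuousOn (fun y => v y - G0 (antiCLM 𝕜 a) y) (Set.Icc (-1) 1) :=
    hv.continuousOn.sub (continuousOn_G0 _)
  have h3 := constant_of_has_deriv_right_zero hcont h0 x hx
  rw [GegenbauerStability.G0_add _ _ hx, GegenbauerStability.G0_smul, G0_basisVec,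
    ← h3]
  simp [chebT]

/-- Integration `n` times; the constants of integration assemble into a polynomial of degree below
`n`. -/
theorem exists_eq_anti_pow {n : ℕ} {v : ℝ → 𝕜} {W : Ell1 𝕜}
    (hv : ContDiffOn ℝ (n : WithTop ℕ∞) v segm) (h : ∀ x ∈ segm, D n v x = G0 W x) :
    ∃ b ∈ initialSpan 𝕜 n, ∀ x ∈ segm, v x = G0 ((antiCLM 𝕜 ^ n) W + b) x := by
  induction n generalizing v with
  | zero =>
    refine ⟨0, zero_mem _, fun x hx => ?_⟩
    rw [← D_zero v x, h x hx]; simp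
  | succ n ih =>
    have hv' : ContDiffOn ℝ (n : WithTop ℕ∞) (derivWithin v segm) segm :=
      hv.derivWithin uniqueDiffOn_segm (by norm_cast)
    obtain ⟨b, hb, hvb⟩ := ih hv' fun x hx => by
      rw [← h x hx, D, D, iteratedDerivWithin_succ']
    obtain ⟨c, hc⟩ := eqOn_add_const_of_derivWithin_eq
      (hv.differentiableOn (by norm_cast)) hvb
    refine ⟨antiCLM 𝕜 b + c • basisVec 𝕜 0, add_mem (antiCLM_mem_initialSpan hb)
      (Submodule.smul_mem _ _ (basisVec_mem_initialSpan (Nat.succ_pos n))), fun x hx => ?_⟩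
    rw [hc x hx, map_add, pow_succ', add_assoc]
    rfl

end Derivatives

/-! ### The linear boundary value problem -/

section LinearProblem

variable {𝕜 : Type} [RCLike 𝕜] (p : Problem)

/-- The coefficient of the `j`-th derivative in the `k`-th boundary condition. -/
def Problem.bcCoef (k j : Fin (2 * p.m)) : ℝ :=
  if h : (k : ℕ) < p.m then p.β j ⟨k, h⟩
  else p.γ j ⟨(k : ℕ) - p.m, by have := k.isLt; omega⟩

/-- The end point at which the `k`-th boundary condition is imposed. -/
def Problem.bcPoint (k : Fin (2 * p.m)) : segm :=
  if (k : ℕ) < p.m then ⟨-1, by simp⟩ else ⟨1, by simp⟩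

theorem Problem.bcMatrix_apply (k i : Fin (2 * p.m)) :
    p.bcMatrix k i = ∑ j : Fin (2 * p.m), p.bcCoef k j *
      (derivative^[(j : ℕ)] (Chebyshev.T ℝ ((i : ℕ) : ℤ))).eval (p.bcPoint k : ℝ) := by
  unfold Problem.bcMatrix Problem.bcCoef Problem.bcPoint
  rw [Matrix.of_apply]
  by_cases h : (k : ℕ) < p.m <;> simp [h]

theorem Problem.BC_iff (v : ℝ → 𝕜) :
    p.BC v ↔ ∀ k : Fin (2 * p.m), ∑ j : Fin (2 * p.m),
      p.bcCoef k j • D (j : ℕ) v (p.bcPoint k : ℝ) = 0 := by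
  constructor
  · rintro ⟨h1, h2⟩ k
    unfold Problem.bcCoef Problem.bcPoint
    by_cases h : (k : ℕ) < p.m
    · simpa [h] using h1 ⟨k, h⟩
    · simpa [h] using h2 ⟨(k : ℕ) - p.m, by have := k.isLt; omega⟩
  · intro hk
    refine ⟨fun i => ?_, fun i => ?_⟩
    · have := hk ⟨i, by have := i.isLt; omega⟩
      simpa [Problem.bcCoef, Problem.bcPoint] using this
    · have := hk ⟨i + p.m, by have := i.isLt; omega⟩
      simpa [Problem.bcCoef, Problem.bcPoint] using this

/-- The derivative of order `j` of the solution of the differential equation with right-hand side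
`W` and polynomial part `∑ c_i T_i`. -/
def Problem.solSeq (W : Ell1 𝕜) (c : Fin (2 * p.m) → 𝕜) (j : ℕ) : Ell1 𝕜 :=
  (-1 : 𝕜) ^ (p.m + 1) • (antiCLM 𝕜 ^ (2 * p.m - j)) W +
    ∑ i : Fin (2 * p.m), c i • polySeq 𝕜 (derivative^[j] (Chebyshev.T ℝ ((i : ℕ) : ℤ)))

theorem Problem.D_solSeq (W : Ell1 𝕜) (c : Fin (2 * p.m) → 𝕜) :
    (∀ j ≤ 2 * p.m, ∀ x ∈ segm, D j (G0 (p.solSeq W c 0)) x = G0 (p.solSeq W c j) x) ∧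
      ContDiffOn ℝ ((2 * p.m : ℕ) : WithTop ℕ∞) (G0 (p.solSeq W c 0)) segm := by
  refine D_chain (p.solSeq W c) (2 * p.m) fun j hj x hx => ?_
  refine HasDerivWithinAt.G0_add hx (HasDerivWithinAt.G0_smul _ ?_)
    (HasDerivWithinAt.G0_sum _ hx fun i _ => HasDerivWithinAt.G0_smul _ ?_)
  · rw [show 2 * p.m - j = (2 * p.m - (j + 1)) + 1 by omega, pow_succ']
    exact hasDerivWithinAt_G0_antiCLM _ hx
  · rw [Function.iterate_succ_apply']
    exact hasDerivWithinAt_G0_polySeq _ hx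

theorem Problem.G0_solSeq_top (W : Ell1 𝕜) (c : Fin (2 * p.m) → 𝕜) {x : ℝ} (hx : x ∈ segm) :
    G0 (p.solSeq W c (2 * p.m)) x = (-1 : 𝕜) ^ (p.m + 1) * G0 W x := by
  have h : ∀ i : Fin (2 * p.m), G0 (polySeq 𝕜 (derivative^[2 * p.m]
      (Chebyshev.T ℝ ((i : ℕ) : ℤ)))) x = 0 := fun i => by
    rw [G0_polySeq _ hx, iterate_derivative_eq_zero]
    · simp
    · rw [Chebyshev.natDegree_T]; simp
  rw [Problem.solSeq, GegenbauerStability.G0_add _ _ hx, GegenbauerStability.G0_sum _ _ hx,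
    GegenbauerStability.G0_smul]
  simp [GegenbauerStability.G0_smul, h]

/-- The `k`-th boundary form of the solution with vanishing polynomial part. -/
def Problem.bcCLM (𝕜 : Type) [RCLike 𝕜] (k : Fin (2 * p.m)) : Ell1 𝕜 →L[𝕜] 𝕜 :=
  ∑ j : Fin (2 * p.m), ((p.bcCoef k j : ℝ) : 𝕜) • (evalCLM 𝕜 (p.bcPoint k) ∘L
    ((-1 : 𝕜) ^ (p.m + 1) • antiCLM 𝕜 ^ (2 * p.m - (j : ℕ))))

theorem Problem.bc_solSeq (W : Ell1 𝕜) (c : Fin (2 * p.m) → 𝕜) (k : Fin (2 * p.m)) :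
    ∑ j : Fin (2 * p.m), p.bcCoef k j • G0 (p.solSeq W c j) (p.bcPoint k : ℝ) =
      p.bcCLM 𝕜 k W + ∑ i, ((p.bcMatrix k i : ℝ) : 𝕜) * c i := by
  have hx := (p.bcPoint k).2
  simp only [Problem.solSeq, GegenbauerStability.G0_add _ _ hx, GegenbauerStability.G0_sum _ _ hx,
    GegenbauerStability.G0_smul, smul_add, Finset.sum_add_distrib, G0_polySeq _ hx,
    Problem.bcMatrix_apply]
  congr 1
  · rw [Problem.bcCLM, sum_apply]
    refine Finset.sum_congr rfl fun j _ => ?_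
    simp [evalCLM_apply, RCLike.real_smul_eq_coe_mul]
  · push_cast
    simp only [Finset.sum_mul, Finset.smul_sum]
    rw [Finset.sum_comm]
    refine Finset.sum_congr rfl fun i _ => Finset.sum_congr rfl fun j _ => ?_
    rw [RCLike.real_smul_eq_coe_mul]
    ring

/-- The coefficients of the polynomial part of the solution of the linear problem. -/
def Problem.polyCoefCLM (𝕜 : Type) [RCLike 𝕜] (i : Fin (2 * p.m)) : Ell1 𝕜 →L[𝕜] 𝕜 :=
  -∑ k : Fin (2 * p.m), ((p.bcMatrix⁻¹ i k : ℝ) : 𝕜) • p.bcCLM 𝕜 k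

/-- The polynomial part must cancel the boundary values of the iterated antiderivative, a linear
system with matrix `bcMatrix`. -/
theorem Problem.bc_iff_eq_polyCoef (hB : IsUnit p.bcMatrix) (W : Ell1 𝕜)
    (c : Fin (2 * p.m) → 𝕜) :
    (∀ k, p.bcCLM 𝕜 k W + ∑ i, ((p.bcMatrix k i : ℝ) : 𝕜) * c i = 0) ↔
      ∀ i, c i = p.polyCoefCLM 𝕜 i W := by
  set B : Matrix (Fin (2 * p.m)) (Fin (2 * p.m)) 𝕜 := p.bcMatrix.map (algebraMap ℝ 𝕜) with hBd
  set B' : Matrix (Fin (2 * p.m)) (Fin (2 * p.m)) 𝕜 := p.bcMatrix⁻¹.map (algebraMap ℝ 𝕜) with hBd'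
  have hdet := (Matrix.isUnit_iff_isUnit_det _).1 hB
  have h1 : B * B' = 1 := by
    rw [hBd, hBd', ← Matrix.map_mul, Matrix.mul_nonsing_inv _ hdet]
    exact Matrix.map_one _ (map_zero _) (map_one _)
  have h2 : B' * B = 1 := by
    rw [hBd, hBd', ← Matrix.map_mul, Matrix.nonsing_inv_mul _ hdet]
    exact Matrix.map_one _ (map_zero _) (map_one _)
  set w : Fin (2 * p.m) → 𝕜 := fun k => p.bcCLM 𝕜 k W with hw
  have e1 : (∀ k, p.bcCLM 𝕜 k W + ∑ i, ((p.bcMatrix k i : ℝ) : 𝕜) * c i = 0) ↔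
      w + B.mulVec c = 0 := by
    rw [funext_iff]; rfl
  have e2 : (∀ i, c i = p.polyCoefCLM 𝕜 i W) ↔ c = -B'.mulVec w := by
    rw [funext_iff]
    refine forall_congr' fun i => ?_
    rw [Problem.polyCoefCLM, neg_apply, sum_apply]
    rfl
  rw [e1, e2]
  constructor
  · intro h
    have h3 := congrArg B'.mulVec h
    rw [Matrix.mulVec_add, Matrix.mulVec_mulVec, h2, Matrix.one_mulVec, Matrix.mulVec_zero] at h3
    exact (neg_eq_of_add_eq_zero_right h3).symm
  · rintro rfl
    rw [Matrix.mulVec_neg, Matrix.mulVec_mulVec, h1, Matrix.one_mulVec, add_neg_cancel]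

/-- The derivative of order `j` of the solution of the linear problem, in coefficient space. -/
def Problem.solCLM (𝕜 : Type) [RCLike 𝕜] (j : ℕ) : Ell1 𝕜 →L[𝕜] Ell1 𝕜 :=
  (-1 : 𝕜) ^ (p.m + 1) • antiCLM 𝕜 ^ (2 * p.m - j) + ∑ i : Fin (2 * p.m),
    (p.polyCoefCLM 𝕜 i).smulRight (polySeq 𝕜 (derivative^[j] (Chebyshev.T ℝ ((i : ℕ) : ℤ))))

theorem Problem.solCLM_apply (j : ℕ) (W : Ell1 𝕜) :
    p.solCLM 𝕜 j W = p.solSeq W (fun i => p.polyCoefCLM 𝕜 i W) j := by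
  rw [Problem.solCLM, Problem.solSeq, add_apply, sum_apply]
  rfl

/-- Uniqueness for arbitrary `C^(2m)` solutions `v`, not only for those given as Chebyshev series.
This generality is needed for the elements of the domain of the linearization. -/
theorem Problem.D_of_solvesLinear (hB : IsUnit p.bcMatrix) {W : Ell1 𝕜} {v : ℝ → 𝕜}
    (h : p.SolvesLinear (G0 W) v) {j : ℕ} (hj : j ≤ 2 * p.m) {x : ℝ} (hx : x ∈ segm) :
    D j v x = G0 (p.solCLM 𝕜 j W) x := by
  obtain ⟨hv, hD, hbc⟩ := h
  have hs : (-1 : 𝕜) ^ (p.m + 1) * (-1 : 𝕜) ^ (p.m + 1) = 1 := by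
    rw [← mul_pow]; simp
  obtain ⟨b, hb, hvb⟩ := exists_eq_anti_pow (W := (-1 : 𝕜) ^ (p.m + 1) • W) hv fun y hy => by
    rw [GegenbauerStability.G0_smul, ← hD y hy, ← mul_assoc, hs, one_mul]
  obtain ⟨c, rfl⟩ := (Submodule.mem_span_range_iff_exists_fun 𝕜).1 hb
  have hv0 : ∀ y ∈ segm, v y = G0 (p.solSeq W c 0) y := fun y hy => by
    rw [hvb y hy, Problem.solSeq, GegenbauerStability.G0_add _ _ hy,
      GegenbauerStability.G0_add _ _ hy, GegenbauerStability.G0_sum _ _ hy,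
      GegenbauerStability.G0_sum _ _ hy, map_smul]
    refine congrArg₂ (· + ·) rfl (Finset.sum_congr rfl fun i _ => ?_)
    rw [GegenbauerStability.G0_smul, GegenbauerStability.G0_smul, G0_basisVec, G0_polySeq _ hy]
    rfl
  have hDv : ∀ j ≤ 2 * p.m, ∀ y ∈ segm, D j v y = G0 (p.solSeq W c j) y := fun j hj y hy => by
    rw [D_congr hv0 j hy, (p.D_solSeq W c).1 j hj y hy]
  have hc := (p.bc_iff_eq_polyCoef hB W c).1 fun k => by
    rw [← p.bc_solSeq, ← (p.BC_iff v).1 hbc k]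
    exact Finset.sum_congr rfl fun i _ => by rw [hDv i i.isLt.le _ (p.bcPoint k).2]
  rw [hDv j hj x hx, Problem.solCLM_apply, show c = _ from funext hc]

theorem Problem.solvesLinear_solCLM (hB : IsUnit p.bcMatrix) (W : Ell1 𝕜) :
    p.SolvesLinear (G0 W) (G0 (p.solCLM 𝕜 0 W)) := by
  rw [Problem.solCLM_apply]
  obtain ⟨h1, h2⟩ := p.D_solSeq W (fun i => p.polyCoefCLM 𝕜 i W)
  refine ⟨h2, fun x hx => ?_, (p.BC_iff _).2 fun k => ?_⟩
  · rw [h1 _ le_rfl x hx, p.G0_solSeq_top W _ hx, ← mul_assoc, ← mul_pow]; simp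
  · rw [← (p.bc_iff_eq_polyCoef hB W _).2 (fun i => rfl) k, ← p.bc_solSeq]
    exact Finset.sum_congr rfl fun i _ => by rw [h1 i i.isLt.le _ (p.bcPoint k).2]

theorem Problem.eq_Linv_of_solvesLinear (hB : IsUnit p.bcMatrix) {W V : Ell1 𝕜}
    (h : p.SolvesLinear (G0 W) (G0 V)) : V = p.solCLM 𝕜 0 W :=
  G0_injective fun x hx => by
    rw [← p.D_of_solvesLinear hB h (Nat.zero_le _) hx, D_zero]

theorem Problem.Linv_eq (hB : IsUnit p.bcMatrix) (W : Ell1 𝕜) : p.Linv W = p.solCLM 𝕜 0 W := by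
  have hex : ∃ V : Ell1 𝕜, p.SolvesLinear (G0 W) (G0 V) := ⟨_, p.solvesLinear_solCLM hB W⟩
  rw [Problem.Linv, dif_pos hex]
  exact p.eq_Linv_of_solvesLinear hB hex.choose_spec

theorem Problem.D_G0_Linv (hB : IsUnit p.bcMatrix) (W : Ell1 𝕜) {j : ℕ} (hj : j ≤ 2 * p.m)
    {x : ℝ} (hx : x ∈ segm) : D j (G0 (p.Linv W)) x = G0 (p.solCLM 𝕜 j W) x := by
  rw [p.Linv_eq hB]
  exact p.D_of_solvesLinear hB (p.solvesLinear_solCLM hB W) hj hx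

theorem tendsto_antiCLM_pow_basisVec {k : ℕ} (hk : 0 < k) :
    Tendsto (fun n => (antiCLM 𝕜 ^ k) (basisVec 𝕜 n)) atTop (𝓝 0) := by
  obtain ⟨k, rfl⟩ := Nat.exists_eq_succ_of_ne_zero hk.ne'
  have := ((antiCLM 𝕜 ^ k).continuous.tendsto 0).comp (tendsto_antiCLM_basisVec (𝕜 := 𝕜))
  rw [map_zero] at this
  refine this.congr fun n => ?_
  rw [pow_succ]; rfl

theorem Problem.tendsto_bcCLM_basisVec (k : Fin (2 * p.m)) :
    Tendsto (fun n => p.bcCLM 𝕜 k (basisVec 𝕜 n)) atTop (𝓝 0) := by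
  simp only [Problem.bcCLM, sum_apply]
  rw [← Finset.sum_const_zero (s := Finset.univ) (ι := Fin (2 * p.m))]
  refine tendsto_finsetSum _ fun j _ => ?_
  have h := tendsto_antiCLM_pow_basisVec (𝕜 := 𝕜) (k := 2 * p.m - (j : ℕ)) (by
    have := j.isLt; omega)
  have h2 := ((((p.bcCoef k j : ℝ) : 𝕜) • (evalCLM 𝕜 (p.bcPoint k) ∘L
    ((-1 : 𝕜) ^ (p.m + 1) • ContinuousLinearMap.id 𝕜 (Ell1 𝕜)))).continuous.tendsto 0).comp h
  rw [map_zero] at h2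
  exact h2

/-- For `j < 2m` at least one antiderivative is left in each term, also in the boundary forms, and
an antiderivative gains a factor of order `1/n`. -/
theorem Problem.tendsto_solCLM_basisVec {j : ℕ} (hj : j < 2 * p.m) :
    Tendsto (fun n => p.solCLM 𝕜 j (basisVec 𝕜 n)) atTop (𝓝 0) := by
  have h1 := (tendsto_antiCLM_pow_basisVec (𝕜 := 𝕜) (k := 2 * p.m - j) (by omega)).const_smul
    ((-1 : 𝕜) ^ (p.m + 1))
  have h2 : ∀ i, Tendsto (fun n => p.polyCoefCLM 𝕜 i (basisVec 𝕜 n)) atTop (𝓝 0) := fun i => by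
    have := tendsto_finsetSum (Finset.univ : Finset (Fin (2 * p.m))) fun k _ =>
      (p.tendsto_bcCLM_basisVec (𝕜 := 𝕜) k).const_smul ((p.bcMatrix⁻¹ i k : ℝ) : 𝕜)
    simp only [smul_zero, Finset.sum_const_zero] at this
    have h3 := this.neg
    rw [neg_zero] at h3
    refine h3.congr fun n => ?_
    rw [Problem.polyCoefCLM, neg_apply, sum_apply]
    rfl
  have h3 := tendsto_finsetSum (Finset.univ : Finset (Fin (2 * p.m))) fun i _ =>
    (h2 i).smul_const (polySeq 𝕜 (derivative^[j] (Chebyshev.T ℝ ((i : ℕ) : ℤ))))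
  simp only [zero_smul, Finset.sum_const_zero] at h3
  have h4 := h1.add h3
  simp only [smul_zero, add_zero] at h4
  refine h4.congr fun n => ?_
  rw [Problem.solCLM, add_apply, sum_apply]
  rfl

end LinearProblem

end GegenbauerStability

namespace GegenbauerStability

open Filter Topology

/-! ### The derivative of the zero finding map -/

section Superposition

variable {𝕜 : Type} [RCLike 𝕜]

/-- Chebyshev series multiply boundedly in `ℓ¹`, so polynomial substitution is built from sums and
products, and the Leibniz rule gives its derivative. -/
theorem exists_superposition {n : ℕ} (Q : MvPolynomial (Fin n) ℝ) :
    ∃ Ψ : (Fin n → Ell1 𝕜) → Ell1 𝕜,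
      (∀ V, ∀ x ∈ segm, G0 (Ψ V) x = MvPolynomial.aeval (fun i => G0 (V i) x) Q) ∧
      ∀ V, ∃ L : (Fin n → Ell1 𝕜) →L[𝕜] Ell1 𝕜, HasFDerivAt Ψ L V ∧
        ∀ h, ∀ x ∈ segm, G0 (L h) x = ∑ i : Fin n,
          MvPolynomial.aeval (fun l => G0 (V l) x) (MvPolynomial.pderiv i Q) * G0 (h i) x := by
  induction Q using MvPolynomial.induction_on with
  | C a =>
    refine ⟨fun _ => (a : 𝕜) • basisVec 𝕜 0, fun V x _ => ?_, fun V => ⟨0, ?_, fun h x _ => ?_⟩⟩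
    · rw [G0_smul, G0_basisVec, MvPolynomial.aeval_C]; simp [chebT]
    · exact hasFDerivAt_const _ _
    · simp [G0_zero]
  | add q r hq hr =>
    obtain ⟨Ψ, hΨ, hΨ'⟩ := hq
    obtain ⟨Ξ, hΞ, hΞ'⟩ := hr
    refine ⟨fun V => Ψ V + Ξ V, fun V x hx => ?_, fun V => ?_⟩
    · rw [G0_add _ _ hx, hΨ V x hx, hΞ V x hx, map_add]
    · obtain ⟨L, hL, hL'⟩ := hΨ' V
      obtain ⟨M, hM, hM'⟩ := hΞ' V
      refine ⟨L + M, hL.add hM, fun h x hx => ?_⟩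
      rw [add_apply, G0_add _ _ hx, hL' h x hx, hM' h x hx, ← Finset.sum_add_distrib]
      exact Finset.sum_congr rfl fun i _ => by rw [map_add, map_add, add_mul]
  | mul_X q i hq =>
    obtain ⟨Ψ, hΨ, hΨ'⟩ := hq
    refine ⟨fun V => chebMul 𝕜 (Ψ V) (V i), fun V x hx => ?_, fun V => ?_⟩
    · rw [G0_chebMul _ _ hx, hΨ V x hx, map_mul, MvPolynomial.aeval_X]
    · obtain ⟨L, hL, hL'⟩ := hΨ' V
      have hi : HasFDerivAt (fun V : Fin n → Ell1 𝕜 => V i)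
          (ContinuousLinearMap.proj (R := 𝕜) (φ := fun _ : Fin n => Ell1 𝕜) i) V :=
        (ContinuousLinearMap.proj (R := 𝕜) (φ := fun _ : Fin n => Ell1 𝕜) i).hasFDerivAt
      refine ⟨_, (chebMul 𝕜).hasFDerivAt_of_bilinear hL hi, fun h x hx => ?_⟩
      have e : ((chebMul 𝕜).precompR (Fin n → Ell1 𝕜) (Ψ V)
          (ContinuousLinearMap.proj (R := 𝕜) (φ := fun _ : Fin n => Ell1 𝕜) i) +
          (chebMul 𝕜).precompL (Fin n → Ell1 𝕜) L (V i)) h =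
          chebMul 𝕜 (Ψ V) (h i) + chebMul 𝕜 (L h) (V i) := rfl
      rw [e, G0_add _ _ hx, G0_chebMul _ _ hx, G0_chebMul _ _ hx, hL' h x hx, hΨ V x hx,
        Finset.sum_mul]
      have e2 : ∀ j, MvPolynomial.aeval (fun l => G0 (V l) x)
          (MvPolynomial.pderiv j (q * MvPolynomial.X i)) * G0 (h j) x =
          (if j = i then MvPolynomial.aeval (fun l => G0 (V l) x) q * G0 (h i) x else 0) +
          MvPolynomial.aeval (fun l => G0 (V l) x) (MvPolynomial.pderiv j q) * G0 (h j) x *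
            G0 (V i) x := fun j => by
        rw [MvPolynomial.pderiv_mul, map_add, map_mul, map_mul, MvPolynomial.aeval_X]
        by_cases hj : j = i
        · subst hj
          rw [MvPolynomial.pderiv_X_self, if_pos rfl, map_one]; ring
        · rw [MvPolynomial.pderiv_X_of_ne (Ne.symm hj), if_neg hj, map_zero]; ring
      simp only [e2, Finset.sum_add_distrib, Finset.sum_ite_eq', Finset.mem_univ, if_true]

variable (p : Problem)

/-- The map is `U ↦ U + Ψ(S U)` plus a constant, where `S` collects the derivatives of order below
`2m` of the solution. The columns of `S` tend to `0`, whence the compactness. -/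
theorem Problem.DF_spec (hB : IsUnit p.bcMatrix) (U : Ell1 𝕜) :
    (∀ h, ∀ x ∈ segm, G0 (p.DF 𝕜 U h) x = G0 h x + ∑ i : Fin (2 * p.m),
      MvPolynomial.aeval (fun l : Fin (2 * p.m) => G0 (p.solCLM 𝕜 (l : ℕ) U) x)
        (MvPolynomial.pderiv i p.Q) * G0 (p.solCLM 𝕜 (i : ℕ) h) x) ∧
    IsCompactOperator (p.DF 𝕜 U - ContinuousLinearMap.id 𝕜 (Ell1 𝕜)) := by
  obtain ⟨Ψ, hΨ, hΨ'⟩ := exists_superposition (𝕜 := 𝕜) p.Q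
  set S : Ell1 𝕜 →L[𝕜] (Fin (2 * p.m) → Ell1 𝕜) :=
    ContinuousLinearMap.pi fun i => p.solCLM 𝕜 (i : ℕ) with hS
  have hF : p.F 𝕜 = fun U => U + Ψ (S U) + G0inv (fun x => ((p.ψ.eval x : ℝ) : 𝕜)) := by
    funext U
    unfold Problem.F
    congr 2
    refine G0inv_eq fun x hx => ?_
    rw [hΨ (S U) x hx, Problem.nonlin]
    congr 2
    funext i
    rw [p.D_G0_Linv hB U i.isLt.le hx]
    rfl
  obtain ⟨L, hL, hL'⟩ := hΨ' (S U)
  have hder : HasFDerivAt (p.F 𝕜) (ContinuousLinearMap.id 𝕜 (Ell1 𝕜) + L ∘L S) U := by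
    rw [hF]
    exact ((hasFDerivAt_id U).add (hL.comp U S.hasFDerivAt)).add_const _
  have hDF : p.DF 𝕜 U = ContinuousLinearMap.id 𝕜 (Ell1 𝕜) + L ∘L S := hder.fderiv
  refine ⟨fun h x hx => ?_, ?_⟩
  · rw [hDF]
    change G0 (h + L (S h)) x = _
    rw [G0_add _ _ hx, hL' _ x hx]
    rfl
  · rw [hDF, add_sub_cancel_left]
    refine isCompactOperator_of_tendsto_basisVec ?_
    have h1 : Tendsto (fun n => S (basisVec 𝕜 n)) atTop (𝓝 0) :=
      tendsto_pi_nhds.2 fun i => p.tendsto_solCLM_basisVec i.isLt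
    have h2 := (L.continuous.tendsto 0).comp h1
    rw [map_zero] at h2
    exact h2

end Superposition

/-! ### Real and complex sequences -/

section RealComplex

variable {𝕜 𝕜' : Type} [RCLike 𝕜] [RCLike 𝕜']

/-- The image of a sequence under a real linear map of the coefficients. -/
def mapSeq (T : 𝕜 →L[ℝ] 𝕜') (a : Ell1 𝕜) : Ell1 𝕜' :=
  ofSummable (fun n => T (a n)) (Summable.of_nonneg_of_le (fun _ => norm_nonneg _)
    (fun n => T.le_opNorm (a n)) ((summable_norm_apply a).mul_left ‖T‖))

theorem mapSeq_apply (T : 𝕜 →L[ℝ] 𝕜') (a : Ell1 𝕜) (n : ℕ) : mapSeq T a n = T (a n) := rfl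

theorem G0_mapSeq (T : 𝕜 →L[ℝ] 𝕜') (a : Ell1 𝕜) {x : ℝ} (hx : x ∈ segm) :
    G0 (mapSeq T a) x = T (G0 a x) := by
  refine (hasSum_G0 (mapSeq T a) hx).unique ?_
  simpa only [mapSeq_apply, map_smul] using (hasSum_G0 a hx).mapL T

theorem D_clm_comp (T : 𝕜 →L[ℝ] 𝕜') {v : ℝ → 𝕜} {k n : ℕ} (hk : k ≤ n)
    (hv : ContDiffOn ℝ (n : WithTop ℕ∞) v segm) {x : ℝ} (hx : x ∈ segm) :
    D k (fun y => T (v y)) x = T (D k v x) := by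
  have hv' : ContDiffWithinAt ℝ (k : WithTop ℕ∞) v segm x :=
    (hv x hx).of_le (by exact_mod_cast hk)
  have h := T.iteratedFDerivWithin_comp_left hv' uniqueDiffOn_segm hx (i := k) le_rfl
  unfold D
  rw [iteratedDerivWithin_eq_iteratedFDerivWithin, iteratedDerivWithin_eq_iteratedFDerivWithin]
  exact congrArg (fun f => f fun _ => 1) h

variable (p : Problem)

theorem Problem.solvesLinear_mapSeq (T : 𝕜 →L[ℝ] 𝕜') {W : Ell1 𝕜} {v : ℝ → 𝕜}
    (h : p.SolvesLinear (G0 W) v) : p.SolvesLinear (G0 (mapSeq T W)) (fun y => T (v y)) := by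
  obtain ⟨h1, h2, h3⟩ := h
  refine ⟨T.contDiff.comp_contDiffOn h1, fun x hx => ?_, (p.BC_iff _).2 fun k => ?_⟩
  · rw [D_clm_comp T le_rfl h1 hx, G0_mapSeq T W hx, ← h2 x hx]
    have e : ∀ (𝕂 : Type) [RCLike 𝕂] (z : 𝕂), (-1 : 𝕂) ^ (p.m + 1) * z =
        ((-1 : ℝ) ^ (p.m + 1)) • z := fun 𝕂 _ z => by
      rw [RCLike.real_smul_eq_coe_mul]; push_cast; rfl
    rw [e, e, map_smul]
  · have := congrArg T ((p.BC_iff v).1 h3 k)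
    rw [map_zero, map_sum] at this
    rw [← this]
    exact Finset.sum_congr rfl fun j _ => by
      rw [map_smul, D_clm_comp T j.isLt.le h1 (p.bcPoint k).2]

theorem Problem.G0_solCLM_mapSeq (hB : IsUnit p.bcMatrix) (T : 𝕜 →L[ℝ] 𝕜') (W : Ell1 𝕜) {j : ℕ}
    (hj : j ≤ 2 * p.m) {x : ℝ} (hx : x ∈ segm) :
    G0 (p.solCLM 𝕜' j (mapSeq T W)) x = T (G0 (p.solCLM 𝕜 j W) x) := by
  have h1 := p.solvesLinear_solCLM hB W
  rw [← p.D_of_solvesLinear hB (p.solvesLinear_mapSeq T h1) hj hx,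
    ← p.D_of_solvesLinear hB h1 hj hx]
  exact D_clm_comp T hj h1.1 hx

theorem toComplex_eq_mapSeq (a : Ell1 ℝ) : toComplex a = mapSeq Complex.ofRealCLM a := rfl

theorem aeval_ofReal {n : ℕ} (q : MvPolynomial (Fin n) ℝ) (g : Fin n → ℝ) :
    MvPolynomial.aeval (fun l => ((g l : ℝ) : ℂ)) q = ((MvPolynomial.aeval g q : ℝ) : ℂ) := by
  have := MvPolynomial.aeval_algebraMap_apply ℂ g q
  exact this

theorem Problem.G0_DF_toComplex (hB : IsUnit p.bcMatrix) (U : Ell1 ℝ) (h : Ell1 ℂ) {x : ℝ}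
    (hx : x ∈ segm) :
    G0 (p.DF ℂ (toComplex U) h) x = G0 h x + ∑ i : Fin (2 * p.m),
      ((MvPolynomial.aeval (fun l : Fin (2 * p.m) => G0 (p.solCLM ℝ (l : ℕ) U) x)
        (MvPolynomial.pderiv i p.Q) : ℝ) : ℂ) * G0 (p.solCLM ℂ (i : ℕ) h) x := by
  rw [(p.DF_spec hB _).1 h x hx]
  refine congrArg₂ (· + ·) rfl (Finset.sum_congr rfl fun i _ => ?_)
  rw [← aeval_ofReal]
  congr 3
  funext l
  rw [toComplex_eq_mapSeq, p.G0_solCLM_mapSeq hB _ _ l.isLt.le hx]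
  rfl

/-- At a real sequence the coefficients of the linearized operator are real, so it commutes with
taking real and imaginary parts. -/
theorem Problem.mapSeq_DF_toComplex (hB : IsUnit p.bcMatrix) (U : Ell1 ℝ) (h : Ell1 ℂ)
    (T : ℂ →L[ℝ] ℝ) : p.DF ℝ U (mapSeq T h) = mapSeq T (p.DF ℂ (toComplex U) h) := by
  refine G0_injective fun x hx => ?_
  rw [G0_mapSeq T _ hx, p.G0_DF_toComplex hB U h hx, (p.DF_spec hB U).1 _ x hx, map_add, map_sum,
    G0_mapSeq T _ hx]
  refine congrArg₂ (· + ·) rfl (Finset.sum_congr rfl fun i _ => ?_)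
  rw [p.G0_solCLM_mapSeq hB _ _ i.isLt.le hx, ← Complex.real_smul, map_smul, smul_eq_mul]

/-- If `h` is in the kernel then `h = (I - A Dℱ(Utilde)) h`, and this operator has norm at most `Z₁
+ Z₂(r) r < 1`. -/
theorem Problem.DF_real_injective {A : Ell1 ℝ →L[ℝ] Ell1 ℝ} {Ubar Utilde : Ell1 ℝ} {Y Z₁ : ℝ}
    {Z₂ : ℝ → ℝ} {r : ℝ} (hNK : p.NewtonKantorovich A Ubar Y Z₁ Z₂ r)
    (hU : Utilde ∈ Metric.closedBall Ubar r) {h : Ell1 ℝ} (hh : p.DF ℝ Utilde h = 0) : h = 0 := by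
  have h2 := hNK.bound_Z₂ r hNK.r_pos (Utilde - Ubar) (by
    rwa [Metric.mem_closedBall, dist_eq_norm] at hU)
  rw [add_sub_cancel] at h2
  have e : h = (ContinuousLinearMap.id ℝ (Ell1 ℝ) - A.comp (p.DF ℝ Ubar)) h -
      (A.comp (p.DF ℝ Utilde - p.DF ℝ Ubar)) h := by
    simp [hh]
  have h3 := ContinuousLinearMap.le_of_opNorm_le _ hNK.bound_Z₁ h
  have h4 := ContinuousLinearMap.le_of_opNorm_le _ h2 h
  have h5 : ‖h‖ ≤ (Z₁ + Z₂ r * r) * ‖h‖ := by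
    conv_lhs => rw [e]
    refine (norm_sub_le _ _).trans ?_
    rw [add_mul]
    exact add_le_add h3 h4
  by_contra hne
  have h6 : 0 < ‖h‖ := norm_pos_iff.2 hne
  have := hNK.contraction
  nlinarith

/-- Fredholm alternative: injectivity means that `-1` is not an eigenvalue of the compact operator
`Dℱ - I`, so it is in the resolvent set. -/
theorem Problem.exists_equiv_DF (hB : IsUnit p.bcMatrix) {U : Ell1 ℝ}
    (hinj : ∀ h, p.DF ℝ U h = 0 → h = 0) :
    ∃ e : Ell1 ℂ ≃L[ℂ] Ell1 ℂ, (e : Ell1 ℂ →L[ℂ] Ell1 ℂ) = p.DF ℂ (toComplex U) := by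
  have hinjC : ∀ h, p.DF ℂ (toComplex U) h = 0 → h = 0 := fun h hh => by
    have h1 : ∀ T : ℂ →L[ℝ] ℝ, mapSeq T h = 0 := fun T => by
      refine hinj _ ?_
      rw [p.mapSeq_DF_toComplex hB, hh]
      ext n
      rw [mapSeq_apply]; simp
    ext n
    refine Complex.ext ?_ ?_
    · exact congrArg (fun a : Ell1 ℝ => a n) (h1 Complex.reCLM)
    · exact congrArg (fun a : Ell1 ℝ => a n) (h1 Complex.imCLM)
  have hK := (p.DF_spec hB (toComplex U)).2
  set K := p.DF ℂ (toComplex U) - ContinuousLinearMap.id ℂ (Ell1 ℂ) with hKd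
  have hres : (-1 : ℂ) ∈ resolventSet ℂ K := by
    refine (hK.hasEigenvalue_or_mem_resolventSet (by simp)).resolve_left fun hev => ?_
    obtain ⟨x, hx⟩ := hev.exists_hasEigenvector
    have h1 : p.DF ℂ (toComplex U) x - x = (-1 : ℂ) • x := hx.apply_eq_smul
    exact hx.2 (hinjC x (by rw [neg_one_smul] at h1; simpa using h1))
  rw [spectrum.mem_resolventSet_iff] at hres
  have hunit : IsUnit (p.DF ℂ (toComplex U)) := by
    have h1 : algebraMap ℂ (Ell1 ℂ →L[ℂ] Ell1 ℂ) (-1) - K = -p.DF ℂ (toComplex U) := by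
      rw [hKd, map_neg, map_one]
      change -(1 : Ell1 ℂ →L[ℂ] Ell1 ℂ) - (p.DF ℂ (toComplex U) - 1) = _
      abel
    rw [h1] at hres
    exact (IsUnit.neg_iff _).1 hres
  obtain ⟨u, hu⟩ := hunit
  exact ⟨ContinuousLinearEquiv.unitsEquiv ℂ (Ell1 ℂ) u, by rw [← hu]; rfl⟩

end RealComplex

/-! ### Chebyshev series of continuously differentiable functions -/

section Smooth

theorem hasDerivAt_comp_cos {f : ℝ → ℂ} (hf : DifferentiableOn ℝ f segm) (t : ℝ) :
    HasDerivAt (fun t => f (Real.cos t)) ((-Real.sin t) • derivWithin f segm (Real.cos t)) t := by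
  have hc : ∀ t, Real.cos t ∈ segm := fun t => ⟨Real.neg_one_le_cos t, Real.cos_le_one t⟩
  have h1 := (hf _ (hc t)).hasDerivWithinAt
  have h2 := (Real.hasDerivAt_cos t).hasDerivWithinAt (s := Set.univ)
  exact hasDerivWithinAt_univ.1 (h1.scomp t h2 fun t _ => hc t)

/-- Up to a constant the coefficients are `d_n / n`, with `d` square summable by Parseval; then `2ab
≤ a² + b²`. -/
theorem summable_fourierCoeffOn_of_hasDerivAt {g g' : ℝ → ℂ} {T : ℝ} (hT : 0 < T)
    (hg : ∀ t, HasDerivAt g (g' t) t) (hg' : Continuous g') (hper : g (0 + T) = g 0) :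
    Summable (fourierCoeffOn (lt_add_of_pos_right (0 : ℝ) hT) g) := by
  have hmem : MeasureTheory.MemLp g' 2
      (MeasureTheory.volume.restrict (Set.Ioc (0 : ℝ) (0 + T))) := by
    obtain ⟨C, hC⟩ := (isCompact_Icc (a := (0 : ℝ)) (b := 0 + T)).exists_bound_of_continuousOn
      hg'.continuousOn
    refine MeasureTheory.MemLp.of_bound hg'.aestronglyMeasurable C ?_
    refine (MeasureTheory.ae_restrict_iff' measurableSet_Ioc).2 (Eventually.of_forall fun t ht => ?_)
    exact hC t (Set.Ioc_subset_Icc_self ht)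
  have hsq := (hasSum_sq_fourierCoeffOn (lt_add_of_pos_right (0 : ℝ) hT) hmem).summable
  have hinv : Summable fun n : ℤ => (1 : ℝ) / (n : ℝ) ^ 2 :=
    Real.summable_one_div_int_pow.2 one_lt_two
  have hbd := (hsq.mul_left ((T / (2 * Real.pi)) ^ 2)).add hinv
  refine Summable.of_norm_bounded_eventually hbd ?_
  filter_upwards [(Set.finite_singleton (0 : ℤ)).compl_mem_cofinite] with n hn
  have hn0 : n ≠ 0 := hn
  rw [fourierCoeffOn_of_hasDerivAt (lt_add_of_pos_right (0 : ℝ) hT) hn0 (fun x _ => hg x)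
    (hg'.intervalIntegrable _ _), hper, sub_self, mul_zero, zero_sub]
  set d := fourierCoeffOn (lt_add_of_pos_right (0 : ℝ) hT) g' n with hd
  have h1 : ‖1 / (-2 * (Real.pi : ℂ) * Complex.I * n) * -((((0 + T : ℝ) : ℂ) - ((0 : ℝ) : ℂ)) * d)‖
      = (T / (2 * Real.pi) * ‖d‖) * (1 / |(n : ℝ)|) := by
    simp only [norm_mul, norm_div, norm_neg, norm_one, Complex.norm_I, Complex.norm_real,
      Complex.norm_intCast, zero_add, Complex.ofReal_zero, sub_zero, Real.norm_eq_abs,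
      abs_of_pos hT, abs_of_pos Real.pi_pos, Complex.norm_ofNat]
    field_simp
  rw [h1]
  have h2 := two_mul_le_add_sq (T / (2 * Real.pi) * ‖d‖) (1 / |(n : ℝ)|)
  rw [mul_pow, div_pow 1 |(n : ℝ)|, sq_abs, one_pow] at h2
  have h3 : 0 ≤ (T / (2 * Real.pi) * ‖d‖) * (1 / |(n : ℝ)|) := by positivity
  linarith

theorem fourier_add_fourier_neg (n : ℤ) (t : ℝ) :
    fourier n (t : AddCircle (2 * Real.pi)) + fourier n ((-t : ℝ) : AddCircle (2 * Real.pi)) =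
      2 * ((chebT n.natAbs (Real.cos t) : ℝ) : ℂ) := by
  have hpi : (Real.pi : ℂ) ≠ 0 := by exact_mod_cast Real.pi_ne_zero
  have h1 : chebT n.natAbs (Real.cos t) = Real.cos (n * t) := by
    unfold chebT
    rw [Polynomial.Chebyshev.T_natAbs, Polynomial.Chebyshev.T_real_cos]
  rw [h1, fourier_coe_apply, fourier_coe_apply]
  push_cast
  rw [Complex.cos, mul_div_cancel₀ _ (two_ne_zero)]
  congr 2
  · field_simp
  · field_simp

/-- Continuously differentiable functions have absolutely convergent Chebyshev series. -/
theorem exists_G0_eq_of_contDiffOn {f : ℝ → ℂ} (hf : ContDiffOn ℝ 1 f segm) :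
    ∃ a : Ell1 ℂ, ∀ x ∈ segm, G0 a x = f x := by
  have hc : ∀ t, Real.cos t ∈ segm := fun t => ⟨Real.neg_one_le_cos t, Real.cos_le_one t⟩
  have hT : 0 < 2 * Real.pi := Real.two_pi_pos
  have : Fact (0 < 2 * Real.pi) := ⟨hT⟩
  set g : ℝ → ℂ := fun t => f (Real.cos t) with hg
  have hgc : Continuous g := hf.continuousOn.comp_continuous Real.continuous_cos hc
  have hg'c : Continuous fun t => (-Real.sin t) • derivWithin f segm (Real.cos t) :=
    Real.continuous_sin.neg.smul
      ((hf.continuousOn_derivWithin uniqueDiffOn_segm le_rfl).comp_continuous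
        Real.continuous_cos hc)
  have hper : g (0 + 2 * Real.pi) = g 0 := by simp [hg]
  have hs := summable_fourierCoeffOn_of_hasDerivAt hT
    (hasDerivAt_comp_cos (hf.differentiableOn one_ne_zero)) hg'c hper
  set F : C(AddCircle (2 * Real.pi), ℂ) := ⟨AddCircle.liftIco (2 * Real.pi) 0 g,
    AddCircle.liftIco_continuous hper.symm hgc.continuousOn⟩ with hF
  have hco : fourierCoeff F = fourierCoeffOn (lt_add_of_pos_right (0 : ℝ) hT) g :=
    funext fun n => fourierCoeff_liftIco_eq g n
  rw [← hco] at hs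
  have hF0 : ∀ t ∈ Set.Ico 0 (2 * Real.pi), F (t : AddCircle (2 * Real.pi)) = g t := fun t ht =>
    AddCircle.liftIco_coe_apply (p := 2 * Real.pi) (a := 0) (f := g)
      (by rw [zero_add]; exact ht)
  have hsn : Summable fun n : ℤ => fourierCoeff F n • basisVec ℂ n.natAbs := by
    refine Summable.of_norm ?_
    simpa only [norm_smul, norm_basisVec, mul_one] using hs.norm
  refine ⟨∑' n : ℤ, fourierCoeff F n • basisVec ℂ n.natAbs, fun x hx => ?_⟩
  have h1 := hsn.hasSum.mapL (evalCLM ℂ ⟨x, hx⟩)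
  simp only [map_smul, evalCLM_apply, G0_basisVec, smul_eq_mul] at h1
  set t := Real.arccos x with ht
  have hxt : Real.cos t = x := Real.cos_arccos hx.1 hx.2
  have ht0 : 0 ≤ t := Real.arccos_nonneg x
  have htpi : t ≤ Real.pi := Real.arccos_le_pi x
  have hpos := Real.pi_pos
  have e1 : F (t : AddCircle (2 * Real.pi)) = f x := by
    rw [hF0 t ⟨ht0, by linarith⟩, ← hxt]
  have e2 : F ((-t : ℝ) : AddCircle (2 * Real.pi)) = f x := by
    rcases ht0.eq_or_lt with h0 | h0
    · rw [← h0, neg_zero, h0, e1]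
    · have h2 : ((-t : ℝ) : AddCircle (2 * Real.pi)) =
          ((2 * Real.pi - t : ℝ) : AddCircle (2 * Real.pi)) := by
        rw [sub_eq_add_neg, AddCircle.coe_add, AddCircle.coe_period, zero_add]
      rw [h2, hF0 _ ⟨by linarith, by linarith⟩, hg]
      simp only
      rw [Real.cos_two_pi_sub, hxt]
  -- Adding the expansions of the even function `f(cos t)` at `t` and `-t` turns each exponential
  -- into `2 T_|n|(cos t)`, with no need for the symmetry of the coefficients.
  have h2 := (has_pointwise_sum_fourier_series_of_summable hs (t : AddCircle (2 * Real.pi))).add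
    (has_pointwise_sum_fourier_series_of_summable hs ((-t : ℝ) : AddCircle (2 * Real.pi)))
  simp only [smul_eq_mul, ← mul_add, fourier_add_fourier_neg, hxt, e1, e2] at h2
  have h3 := h1.mul_left 2
  have h4 : ∀ n : ℤ, fourierCoeff F n * (2 * ((chebT n.natAbs x : ℝ) : ℂ)) =
      2 * (fourierCoeff F n * ((chebT n.natAbs x : ℝ) : ℂ)) := fun n => by ring
  simp only [h4] at h2
  have h5 := h3.unique h2
  have h6 : (2 : ℂ) * G0 (∑' n : ℤ, fourierCoeff F n • basisVec ℂ n.natAbs) x = 2 * f x := by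
    rw [two_mul (f x)]; exact h5
  exact mul_left_cancel₀ two_ne_zero h6

end Smooth

/-! ### Unbounded operators with an injective inverse -/

section Inverse

variable {E : Type} [AddCommGroup E] [Module ℂ E] {T : E →ₗ.[ℂ] E}
  {V : Type*} [AddCommGroup V] [Module ℂ V] {f : Module.End ℂ V} {g : V →ₗ[ℂ] E}

/-- `f` is an inverse of `T` on the range of the embedding `g`, which contains the domain. -/
structure IsInverseOn (T : E →ₗ.[ℂ] E) (f : Module.End ℂ V) (g : V →ₗ[ℂ] E) : Prop where
  injective : Function.Injective g
  exists_apply : ∀ w, ∃ h : g (f w) ∈ T.domain, T ⟨g (f w), h⟩ = g w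
  exists_eq : ∀ v : T.domain, ∃ a, (v : E) = g a
  eq_of_apply : ∀ (v : T.domain) (w : V), T v = g w → (v : E) = g (f w)

/-- If `f d' = (f - lam)c` then `f(c - d') = lam c`; so `f` is onto each generalized eigenspace for
a nonzero eigenvalue, at every level. -/
theorem exists_mem_genEigenspace_apply_eq {lam : ℂ} (hlam : lam ≠ 0) :
    ∀ (k : ℕ) (c : V), c ∈ f.genEigenspace lam k → ∃ d ∈ f.genEigenspace lam k, f d = c
  | 0, c, hc => ⟨c, hc, by
      have : c = 0 := by simpa using hc
      rw [this, map_zero]⟩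
  | k + 1, c, hc => by
    have h1 : (f - lam • 1) c ∈ f.genEigenspace lam (k : ℕ) := by
      rw [Module.End.mem_genEigenspace_nat, LinearMap.mem_ker] at hc ⊢
      rwa [pow_succ] at hc
    obtain ⟨d', hd', h2⟩ := exists_mem_genEigenspace_apply_eq hlam k _ h1
    have hmono : f.genEigenspace lam (k : ℕ) ≤ f.genEigenspace lam ((k + 1 : ℕ) : ℕ∞) :=
      (f.genEigenspace lam).monotone (by exact_mod_cast Nat.le_succ k)
    refine ⟨lam⁻¹ • (c - d'), Submodule.smul_mem _ _ (Submodule.sub_mem _ hc (hmono hd')), ?_⟩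
    rw [map_smul, map_sub, h2]
    simp [smul_smul, inv_mul_cancel₀ hlam]

/-- If `w = g a` and `T w - μ w = g b`, then `a = f(b + μ a)`, that is, `(f - μ⁻¹)a = -μ⁻¹ f b`.
Since `f` maps each level onto itself, both filtrations grow in step. -/
theorem IsInverseOn.genEigenspace_eq (H : IsInverseOn T f g) {μ : ℂ} (hμ : μ ≠ 0) (k : ℕ) :
    genEigenspace T μ k = (f.genEigenspace μ⁻¹ k).map g := by
  induction k with
  | zero => simp [genEigenspace]
  | succ k ih =>
    ext v
    rw [genEigenspace, ih]
    constructor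
    · rintro ⟨w, hw, rfl⟩
      obtain ⟨b, hb, hbw⟩ := hw
      obtain ⟨a, ha⟩ := H.exists_eq w
      have h1 : T w = g (b + μ • a) := by
        rw [map_add, map_smul, hbw, ← ha]
        change T w = T w - μ • (w : E) + μ • (w : E)
        rw [sub_add_cancel]
      have h2 := H.eq_of_apply w _ h1
      have h3 : a = f (b + μ • a) := H.injective (ha.symm.trans h2)
      refine ⟨a, ?_, ha.symm⟩
      have h4 : (f - μ⁻¹ • (1 : Module.End ℂ V)) a = -(μ⁻¹ • f b) := by
        have h5 : f a = μ⁻¹ • (a - f b) := by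
          rw [eq_inv_smul_iff₀ hμ, ← map_smul, eq_sub_iff_add_eq', ← map_add]
          exact h3.symm
        change f a - μ⁻¹ • a = _
        rw [h5, smul_sub]; abel
      change a ∈ f.genEigenspace μ⁻¹ ((k + 1 : ℕ) : ℕ∞)
      rw [Module.End.mem_genEigenspace_nat, LinearMap.mem_ker, pow_succ]
      change ((f - μ⁻¹ • (1 : Module.End ℂ V)) ^ k) ((f - μ⁻¹ • (1 : Module.End ℂ V)) a) = 0
      have h6 : f b ∈ f.genEigenspace μ⁻¹ (k : ℕ) :=
        Module.End.mapsTo_genEigenspace_of_comm (Commute.refl f) μ⁻¹ k hb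
      rw [Module.End.mem_genEigenspace_nat, LinearMap.mem_ker] at h6
      rw [h4, map_neg, map_smul, h6, smul_zero, neg_zero]
    · rintro ⟨a, ha, rfl⟩
      have h1 : (f - μ⁻¹ • (1 : Module.End ℂ V)) a ∈ f.genEigenspace μ⁻¹ (k : ℕ) := by
        change a ∈ f.genEigenspace μ⁻¹ ((k + 1 : ℕ) : ℕ∞) at ha
        rw [Module.End.mem_genEigenspace_nat, LinearMap.mem_ker] at ha ⊢
        rwa [pow_succ] at ha
      obtain ⟨d, hd, h2⟩ := exists_mem_genEigenspace_apply_eq (inv_ne_zero hμ) k _ h1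
      have h3 : a = f (μ • (a - d)) := by
        have h4 : f d = f a - μ⁻¹ • a := h2
        rw [map_smul, map_sub, h4, sub_sub_cancel, smul_inv_smul₀ hμ]
      obtain ⟨hm, h5⟩ := H.exists_apply (μ • (a - d))
      refine ⟨⟨_, hm⟩, ⟨-(μ • d), Submodule.neg_mem _ (Submodule.smul_mem _ _ hd), ?_⟩,
        congrArg g h3.symm⟩
      change _ = T _ - μ • g (f (μ • (a - d)))
      rw [h5, ← h3, ← map_smul, ← map_sub]
      congr 1
      rw [smul_sub]; abel

theorem IsInverseOn.maxGenEigenspace_eq (H : IsInverseOn T f g) {μ : ℂ} (hμ : μ ≠ 0) :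
    maxGenEigenspace T μ = (f.maxGenEigenspace μ⁻¹).map g := by
  rw [maxGenEigenspace, ← Module.End.iSup_genEigenspace_eq, Submodule.map_iSup]
  exact iSup_congr fun k => H.genEigenspace_eq hμ k

theorem IsInverseOn.isEigenvalue_iff (H : IsInverseOn T f g) {μ : ℂ} (hμ : μ ≠ 0) :
    IsEigenvalue T μ ↔ f.HasEigenvalue μ⁻¹ := by
  constructor
  · rintro ⟨v, hv, hTv⟩
    obtain ⟨a, ha⟩ := H.exists_eq v
    have h1 := H.eq_of_apply v (μ • a) (by rw [hTv, map_smul, ha])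
    have h2 : a = f (μ • a) := H.injective (ha.symm.trans h1)
    refine Module.End.hasEigenvalue_of_hasEigenvector (x := a)
      ⟨Module.End.mem_eigenspace_iff.2 ?_, fun h0 => hv (Subtype.ext ?_)⟩
    · rw [eq_inv_smul_iff₀ hμ, ← map_smul, ← h2]
    · rw [ha, h0, map_zero]; rfl
  · intro h
    obtain ⟨a, ha⟩ := h.exists_hasEigenvector
    have h1 : a = f (μ • a) := by rw [map_smul, ha.apply_eq_smul, smul_inv_smul₀ hμ]
    obtain ⟨hm, h2⟩ := H.exists_apply (μ • a)
    refine ⟨⟨_, hm⟩, fun h0 => ha.2 (H.injective ?_), ?_⟩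
    · rw [map_zero, h1]; exact congrArg Subtype.val h0
    · rw [h2, map_smul]
      exact congrArg (fun z => μ • g z) h1

/-- The unstable eigenvalues of `T` are counted by a spectral subspace of its inverse. -/
theorem IsInverseOn.hasUnstableCount (H : IsInverseOn T f g) {U : Set ℂ}
    (hS : IsSpectralSub f U (spectralSpace f U))
    (hU : ∀ lam, f.HasEigenvalue lam → lam ≠ 0 → (lam ∈ U ↔ 0 < lam.re)) (h0 : (0 : ℂ) ∉ U) :
    HasUnstableCount T (Module.finrank ℂ (spectralSpace f U)) := by
  have hfinS := hS.finite
  have hle : ∀ lam ∈ U, f.maxGenEigenspace lam ≤ spectralSpace f U := fun lam hlam =>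
    le_iSup₂_of_le lam hlam le_rfl
  set Ev : Set ℂ := {lam | f.HasEigenvalue lam ∧ lam ∈ U} with hEv
  have hEfin : Ev.Finite := by
    refine (Module.End.finite_hasEigenvalue (f.restrict hS.invariant)).subset ?_
    rintro lam ⟨hlam, hlU⟩
    obtain ⟨x, hx⟩ := hlam.exists_hasEigenvector
    have hxS : x ∈ spectralSpace f U :=
      hle lam hlU (Module.End.eigenspace_le_maxGenEigenspace hx.1)
    exact Module.End.hasEigenvalue_of_hasEigenvector (x := ⟨x, hxS⟩)
      ⟨Module.End.mem_eigenspace_iff.2 (Subtype.ext hx.apply_eq_smul),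
        fun h => hx.2 (congrArg Subtype.val h)⟩
  have hre : ∀ μ : ℂ, 0 < μ.re → 0 < (μ⁻¹).re := fun μ h => by
    rw [Complex.inv_re]
    exact div_pos h (Complex.normSq_pos.2 fun h0 => by simp [h0] at h)
  have hiff : ∀ μ : ℂ, μ ∈ unstableEigenvalues T ↔ μ⁻¹ ∈ Ev := fun μ => by
    constructor
    · rintro ⟨h1, h2⟩
      have hμ : μ ≠ 0 := fun h => by simp [h] at h2
      have h3 := (H.isEigenvalue_iff hμ).1 h1
      exact ⟨h3, (hU _ h3 (inv_ne_zero hμ)).2 (hre μ h2)⟩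
    · rintro ⟨h1, h2⟩
      have hμ : μ⁻¹ ≠ 0 := fun h => h0 (h ▸ h2)
      refine ⟨(H.isEigenvalue_iff (fun h => hμ (by rw [h, inv_zero]))).2 h1, ?_⟩
      simpa using hre _ ((hU _ h1 hμ).1 h2)
  have hfin : (unstableEigenvalues T).Finite := by
    refine (hEfin.image fun z => z⁻¹).subset fun μ hμ => ⟨μ⁻¹, (hiff μ).1 hμ, inv_inv μ⟩
  have hmax : ∀ μ ∈ unstableEigenvalues T,
      maxGenEigenspace T μ = (f.maxGenEigenspace μ⁻¹).map g := fun μ hμ =>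
    H.maxGenEigenspace_eq fun h => by have := hμ.2; simp [h] at this
  have hfd : ∀ lam ∈ U, FiniteDimensional ℂ (f.maxGenEigenspace lam) := fun lam hlam =>
    Submodule.finiteDimensional_of_le (hle lam hlam)
  refine ⟨hfin, fun μ hμ => ?_, ?_⟩
  · rw [hmax μ hμ]
    have := hfd _ ((hiff μ).1 hμ).2
    infer_instance
  · rw [finrank_spectralSpace_eq_sum f U hEfin.toFinset
      (fun μ hμ => ((hEfin.mem_toFinset).1 hμ).2) (fun μ hμU hμ => ?_)
      (fun μ hμ => hfd μ ((hEfin.mem_toFinset).1 hμ).2)]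
    · refine Finset.sum_bij (fun μ _ => μ⁻¹) (fun μ hμ => ?_) (fun a _ b _ h => inv_injective h)
        (fun lam hlam => ?_) fun μ hμ => ?_
      · rw [Set.Finite.mem_toFinset] at hμ ⊢
        exact (hiff μ).1 hμ
      · rw [Set.Finite.mem_toFinset] at hlam
        exact ⟨lam⁻¹, by rw [Set.Finite.mem_toFinset, hiff, inv_inv]; exact hlam, inv_inv lam⟩
      · rw [hmax μ ((Set.Finite.mem_toFinset _).1 hμ)]
        exact (Submodule.equivMapOfInjective g H.injective _).symm.finrank_eq
    · by_contra hne
      refine hμ ((hEfin.mem_toFinset).2 ⟨?_, hμU⟩)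
      exact Module.End.HasUnifEigenvalue.lt (k := ⊤) zero_lt_one hne

end Inverse

/-! ### The linearization in coefficient space -/

section Linearization

theorem contDiffOn_D {v : ℝ → ℂ} {n j : ℕ} (hv : ContDiffOn ℝ (n : WithTop ℕ∞) v segm)
    (hj : j < n) : ContDiffOn ℝ 1 (D j v) segm := by
  refine (contDiffOn_one_iff_derivWithin uniqueDiffOn_segm).2
    ⟨hv.differentiableOn_iteratedDerivWithin (by exact_mod_cast hj) uniqueDiffOn_segm, ?_⟩
  have := hv.continuousOn_iteratedDerivWithin (m := j + 1) (by exact_mod_cast hj) uniqueDiffOn_segm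
  exact this.congr fun x _ => by rw [iteratedDerivWithin_succ]; rfl

/-- The Chebyshev series as a function on `[-1, 1]`, extended by `0`. -/
def seriesFun : Ell1 ℂ →ₗ[ℂ] (ℝ → ℂ) where
  toFun a := segm.indicator (G0 a)
  map_add' a b := by
    ext x
    by_cases hx : x ∈ segm
    · simp only [Set.indicator_of_mem hx, Pi.add_apply, G0_add a b hx]
    · simp only [Set.indicator_of_notMem hx, Pi.add_apply, add_zero]
  map_smul' c a := by
    ext x
    by_cases hx : x ∈ segm
    · simp only [Set.indicator_of_mem hx, Pi.smul_apply, G0_smul, RingHom.id_apply, smul_eq_mul]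
    · simp only [Set.indicator_of_notMem hx, Pi.smul_apply, smul_zero, RingHom.id_apply]

theorem seriesFun_of_mem (a : Ell1 ℂ) {x : ℝ} (hx : x ∈ segm) : seriesFun a x = G0 a x :=
  Set.indicator_of_mem hx _

theorem seriesFun_of_notMem (a : Ell1 ℂ) {x : ℝ} (hx : x ∉ segm) : seriesFun a x = 0 :=
  Set.indicator_of_notMem hx _

theorem seriesFun_injective : Function.Injective seriesFun := fun a b h =>
  G0_injective fun x hx => by rw [← seriesFun_of_mem a hx, h, seriesFun_of_mem b hx]

theorem eq_seriesFun {v : ℝ → ℂ} (h0 : ∀ x, x ∉ segm → v x = 0) {a : Ell1 ℂ}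
    (h : ∀ x ∈ segm, v x = G0 a x) : v = seriesFun a := by
  ext x
  by_cases hx : x ∈ segm
  · rw [seriesFun_of_mem a hx, h x hx]
  · rw [seriesFun_of_notMem a hx, h0 x hx]

variable (p : Problem)

theorem Problem.SolvesLinear.congr {w u v : ℝ → ℂ} (h : p.SolvesLinear w u)
    (huv : ∀ x ∈ segm, v x = u x) : p.SolvesLinear w v := by
  refine ⟨h.1.congr huv, fun x hx => ?_, (p.BC_iff v).2 fun k => ?_⟩
  · rw [D_congr huv _ hx, h.2.1 x hx]
  · rw [← (p.BC_iff u).1 h.2.2 k]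
    exact Finset.sum_congr rfl fun j _ => by rw [D_congr huv _ (p.bcPoint k).2]

theorem Problem.solvesLinear_seriesFun (hB : IsUnit p.bcMatrix) (W : Ell1 ℂ) :
    p.SolvesLinear (G0 W) (seriesFun (p.solCLM ℂ 0 W)) :=
  (p.solvesLinear_solCLM hB W).congr p fun _ hx => seriesFun_of_mem _ hx

theorem Problem.eval_D_steady (hB : IsUnit p.bcMatrix) (U : Ell1 ℝ)
    (q : MvPolynomial (Fin (2 * p.m)) ℝ) {x : ℝ} (hx : x ∈ segm) :
    MvPolynomial.eval (fun l : Fin (2 * p.m) => D (l : ℕ) (p.steady U) x) q =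
      MvPolynomial.aeval (fun l : Fin (2 * p.m) => G0 (p.solCLM ℝ (l : ℕ) U) x) q := by
  rw [← MvPolynomial.aeval_eq_eval]
  congr 2
  funext l
  exact p.D_G0_Linv hB U l.isLt.le hx

theorem Problem.linearization_eq_indicator (w : ℝ → ℝ) (v : (p.linearization w).domain) :
    p.linearization w v = segm.indicator fun x =>
      (-1 : ℂ) ^ (p.m + 1) * D (2 * p.m) (v : ℝ → ℂ) x + ∑ i : Fin (2 * p.m),
        MvPolynomial.eval (fun l : Fin (2 * p.m) => D (l : ℕ) w x) (MvPolynomial.pderiv i p.Q) •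
          D (i : ℕ) (v : ℝ → ℂ) x := rfl

theorem Problem.linearization_apply (w : ℝ → ℝ) (v : (p.linearization w).domain) {x : ℝ}
    (hx : x ∈ segm) :
    p.linearization w v x = (-1 : ℂ) ^ (p.m + 1) * D (2 * p.m) (v : ℝ → ℂ) x +
      ∑ i : Fin (2 * p.m),
        ((MvPolynomial.eval (fun l : Fin (2 * p.m) => D (l : ℕ) w x)
          (MvPolynomial.pderiv i p.Q) : ℝ) : ℂ) * D (i : ℕ) (v : ℝ → ℂ) x := by
  rw [p.linearization_eq_indicator, Set.indicator_of_mem hx]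
  simp only [Complex.real_smul]

theorem Problem.linearization_apply_of_notMem (w : ℝ → ℝ) (v : (p.linearization w).domain)
    {x : ℝ} (hx : x ∉ segm) : p.linearization w v x = 0 := by
  rw [p.linearization_eq_indicator, Set.indicator_of_notMem hx]

theorem Problem.seriesFun_mem_domain (hB : IsUnit p.bcMatrix) (w : ℝ → ℝ) (W : Ell1 ℂ) :
    seriesFun (p.solCLM ℂ 0 W) ∈ (p.linearization w).domain :=
  have h := p.solvesLinear_seriesFun hB W
  ⟨fun _ hx => seriesFun_of_notMem _ hx, h.1, h.2.2⟩

/-- The identity `T 𝒢₀ ℒ⁻¹ = 𝒢₀ Dℱ(U)` which carries the spectral problem to coefficient space. -/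
theorem Problem.linearization_seriesFun (hB : IsUnit p.bcMatrix) (U : Ell1 ℝ) (W : Ell1 ℂ) :
    p.linearization (p.steady U) ⟨_, p.seriesFun_mem_domain hB _ W⟩ =
      seriesFun (p.DF ℂ (toComplex U) W) := by
  have h := p.solvesLinear_seriesFun hB W
  refine eq_seriesFun (fun x hx => p.linearization_apply_of_notMem _ _ hx) fun x hx => ?_
  rw [p.linearization_apply _ _ hx, p.G0_DF_toComplex hB U W hx]
  refine congrArg₂ (· + ·) (h.2.1 x hx) (Finset.sum_congr rfl fun i _ => ?_)
  rw [p.eval_D_steady hB U _ hx]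
  exact congrArg _ (p.D_of_solvesLinear hB h i.isLt.le hx)

theorem Problem.exists_eq_seriesFun (v : p.linDomain) : ∃ a, (v : ℝ → ℂ) = seriesFun a := by
  obtain ⟨v, h0, hv, -⟩ := v
  have hm := p.m_pos
  obtain ⟨a, ha⟩ := exists_G0_eq_of_contDiffOn
    (hv.of_le (m := 1) (by exact_mod_cast (by omega : 1 ≤ 2 * p.m)))
  exact ⟨a, eq_seriesFun h0 fun x hx => (ha x hx).symm⟩

/-- Derivatives of `v` of order below `2m` are `C¹`, so they have `ℓ¹` Chebyshev series. With the
lower order terms moved to the right, `v` solves the linear problem with data in `ℓ¹`. -/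
theorem Problem.exists_eq_seriesFun_solCLM (hB : IsUnit p.bcMatrix) (U : Ell1 ℝ)
    (v : (p.linearization (p.steady U)).domain) (W : Ell1 ℂ) (h : p.linearization (p.steady U) v = seriesFun W) :
    ∃ Z, (v : ℝ → ℂ) = seriesFun (p.solCLM ℂ 0 Z) := by
  obtain ⟨h0, hv, hbc⟩ := v.2
  choose b hb using fun i : Fin (2 * p.m) => exists_G0_eq_of_contDiffOn (contDiffOn_D hv i.isLt)
  have hq : ∀ i : Fin (2 * p.m), ∃ q : Ell1 ℂ, ∀ x ∈ segm, G0 q x =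
      ((MvPolynomial.aeval (fun l : Fin (2 * p.m) => G0 (p.solCLM ℝ (l : ℕ) U) x)
        (MvPolynomial.pderiv i p.Q) : ℝ) : ℂ) := fun i => by
    obtain ⟨Ψ, hΨ, -⟩ := exists_superposition (𝕜 := ℝ) (MvPolynomial.pderiv i p.Q)
    refine ⟨mapSeq Complex.ofRealCLM (Ψ fun l => p.solCLM ℝ (l : ℕ) U), fun x hx => ?_⟩
    rw [G0_mapSeq _ _ hx, hΨ _ x hx]; rfl
  choose q hq using hq
  have hsol : p.SolvesLinear (G0 (W - ∑ i, chebMul ℂ (q i) (b i))) (v : ℝ → ℂ) := by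
    refine ⟨hv, fun x hx => ?_, hbc⟩
    rw [G0_sub _ _ hx, G0_sum _ _ hx, ← seriesFun_of_mem W hx, ← h, p.linearization_apply _ _ hx,
      eq_sub_iff_add_eq]
    refine congrArg₂ (· + ·) rfl (Finset.sum_congr rfl fun i _ => ?_)
    rw [G0_chebMul _ _ hx, hq i x hx, hb i x hx, p.eval_D_steady hB U _ hx]
  refine ⟨W - ∑ i, chebMul ℂ (q i) (b i), eq_seriesFun h0 fun x hx => ?_⟩
  rw [← p.D_of_solvesLinear hB hsol (Nat.zero_le _) hx, D_zero]

end Linearization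

/-! ### The pseudo-diagonalized operator -/

section Block

variable {N : ℕ}

theorem blockOp_apply (B : Matrix (Fin (N + 1)) (Fin (N + 1)) ℂ) (a : Ell1 ℂ) (k : ℕ) :
    blockOp B a k = if h : k < N + 1 then B.mulVec (fun n => a (n : ℕ)) ⟨k, h⟩ else a k := rfl

/-- `blockOp B` as a bounded operator. -/
def blockCLM (B : Matrix (Fin (N + 1)) (Fin (N + 1)) ℂ) : Ell1 ℂ →L[ℂ] Ell1 ℂ :=
  let L : Ell1 ℂ →ₗ[ℂ] Ell1 ℂ :=
    { toFun := blockOp B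
      map_add' := fun a b => by
        ext k
        simp only [blockOp_apply, lp.coeFn_add, Pi.add_apply]
        split_ifs
        · exact congrFun (B.mulVec_add (fun n => a (n : ℕ)) fun n => b (n : ℕ)) _
        · rfl
      map_smul' := fun c a => by
        ext k
        simp only [blockOp_apply, lp.coeFn_smul, Pi.smul_apply, RingHom.id_apply]
        split_ifs
        · exact congrFun (B.mulVec_smul c fun n => a (n : ℕ)) _
        · rfl }
  { L with
    -- Each output coordinate depends on finitely many input coordinates, so the graph is closed and
    -- no norm estimate is needed.
    cont := L.continuous_of_seq_closed_graph fun u x y hu hLu => by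
      have hc : ∀ {s : ℕ → Ell1 ℂ} {z : Ell1 ℂ}, Tendsto s atTop (𝓝 z) → ∀ k : ℕ,
          Tendsto (fun n => s n k) atTop (𝓝 (z k)) := fun hs k =>
        ((coordCLM ℂ k).continuous.tendsto _).comp hs
      ext k
      refine tendsto_nhds_unique (hc hLu k) ?_
      change Tendsto (fun n => blockOp B (u n) k) atTop (𝓝 (blockOp B x k))
      simp only [blockOp_apply]
      split_ifs with h
      · exact tendsto_finsetSum Finset.univ fun (j : Fin (N + 1)) _ =>
          (hc hu (j : ℕ)).const_mul (B ⟨k, h⟩ j)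
      · exact hc hu k }

theorem blockOp_mul (B C : Matrix (Fin (N + 1)) (Fin (N + 1)) ℂ) (a : Ell1 ℂ) :
    blockOp B (blockOp C a) = blockOp (B * C) a := by
  ext k
  simp only [blockOp_apply]
  split_ifs
  · rw [← Matrix.mulVec_mulVec]
    congr 2
    funext n
    exact dif_pos n.isLt
  · rfl

theorem blockOp_one (a : Ell1 ℂ) :
    blockOp (1 : Matrix (Fin (N + 1)) (Fin (N + 1)) ℂ) a = a := by
  ext k
  simp only [blockOp_apply, Matrix.one_mulVec]
  split_ifs <;> rfl

theorem blockOp_basisVec (B : Matrix (Fin (N + 1)) (Fin (N + 1)) ℂ) {n : ℕ} (hn : N < n) :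
    blockOp B (basisVec ℂ n) = basisVec ℂ n := by
  ext k
  rw [blockOp_apply]
  split_ifs with h
  · have : (fun j : Fin (N + 1) => basisVec ℂ n (j : ℕ)) = 0 := by
      funext j
      rw [basisVec_apply, if_neg (by omega)]; rfl
    rw [this, Matrix.mulVec_zero, basisVec_apply, if_neg (by omega)]; rfl
  · rfl

end Block

/-! ### Gershgorin disks in normalized coordinates, and the final count -/

section Gershgorin

variable (p : Problem) {N : ℕ} {P₀ : Matrix (Fin (N + 1)) (Fin (N + 1)) ℂ} {U : Ell1 ℝ}

theorem xi_ne_zero (n : ℕ) : xi n ≠ 0 := by unfold xi; split_ifs <;> norm_num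

theorem xi_pos (n : ℕ) : 0 < xi n := by unfold xi; split_ifs <;> norm_num

theorem Problem.matM_eq {M : Ell1 ℂ →L[ℂ] Ell1 ℂ} (hM : ∀ a, p.opM P₀ U a = M a) (k n : ℕ) :
    p.matM P₀ U k n = (((xi k)⁻¹ * xi n : ℝ) : ℂ) * M (basisVec ℂ n) k := by
  rw [Problem.matM, hM, unitSeq, single_eq_smul_basisVec, map_smul, coeff, lp.coeFn_smul,
    Pi.smul_apply, Complex.real_smul, smul_eq_mul]
  push_cast
  rw [mul_assoc]; rfl

/-- Passing to the normalized basis multiplies the `(k, n)` entry by `ξ_k / ξ_n`: the diagonal is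
unchanged, and the weighted column sums become plain `ℓ¹` norms. -/
theorem Problem.gershDisk_eq {M : Ell1 ℂ →L[ℂ] Ell1 ℂ} (hM : ∀ a, p.opM P₀ U a = M a) (n : ℕ) :
    p.gershDisk P₀ U n = disk M n := by
  unfold Problem.gershDisk disk
  congr 1
  · rw [p.matM_eq hM, inv_mul_cancel₀ (xi_ne_zero n), Complex.ofReal_one, one_mul]; rfl
  · rw [Problem.gershRadius, diskRadius, norm_eq_tsum, ← tsum_mul_left]
    refine tsum_congr fun k => ?_
    rw [offDiag_apply]
    split_ifs
    · simp
    · rw [p.matM_eq hM, norm_mul, Complex.norm_real, Real.norm_eq_abs, abs_of_pos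
        (mul_pos (inv_pos.2 (xi_pos k)) (xi_pos n))]
      have h1 := xi_ne_zero k
      have h2 := xi_ne_zero n
      field_simp

end Gershgorin

theorem Problem.hasUnstableCount_of_gershgorin (p : Problem) (hB : IsUnit p.bcMatrix)
    {A : Ell1 ℝ →L[ℝ] Ell1 ℝ} {Ubar Utilde : Ell1 ℝ} {Y Z₁ : ℝ} {Z₂ : ℝ → ℝ} {r : ℝ}
    (hNK : p.NewtonKantorovich A Ubar Y Z₁ Z₂ r) (hU : Utilde ∈ Metric.closedBall Ubar r)
    {lmax : ℝ} (hlmax : 0 < lmax)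
    (hbound : ∀ μ : ℂ, IsEigenvalue (p.linearization (p.steady Utilde)) μ → 0 ≤ μ.re → ‖μ‖ ≤ lmax)
    {N : ℕ} {P₀ : Matrix (Fin (N + 1)) (Fin (N + 1)) ℂ} (hP₀ : IsUnit P₀)
    {nu : ℕ} (hcount : (p.unstableDisks P₀ Utilde).encard = nu)
    (hdisj : ∀ n ∉ p.unstableDisks P₀ Utilde, ∀ k ∈ p.unstableDisks P₀ Utilde,
      Disjoint (p.gershDisk P₀ Utilde n) (p.gershDisk P₀ Utilde k))
    (hstable : ∀ n ∉ p.unstableDisks P₀ Utilde,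
      p.gershDisk P₀ Utilde n ⊆ {z : ℂ | z.re < 0} ∪ Metric.ball 0 (1 / lmax)) :
    HasUnstableCount (p.linearization (p.steady Utilde)) nu := by
  obtain ⟨e, he⟩ := p.exists_equiv_DF hB fun _ => p.DF_real_injective hNK hU
  have hdet := (Matrix.isUnit_iff_isUnit_det P₀).1 hP₀
  have hinv1 : ∀ a, blockOp P₀⁻¹ (blockOp P₀ a) = a := fun a => by
    rw [blockOp_mul, Matrix.nonsing_inv_mul _ hdet, blockOp_one]
  have hinv2 : ∀ a, blockOp P₀ (blockOp P₀⁻¹ a) = a := fun a => by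
    rw [blockOp_mul, Matrix.mul_nonsing_inv _ hdet, blockOp_one]
  set M : Ell1 ℂ →L[ℂ] Ell1 ℂ :=
    blockCLM P₀⁻¹ ∘L (e.symm : Ell1 ℂ →L[ℂ] Ell1 ℂ) ∘L p.solCLM ℂ 0 ∘L blockCLM P₀ with hMdef
  have hM : ∀ a, M a = blockOp P₀⁻¹ (e.symm (p.solCLM ℂ 0 (blockOp P₀ a))) := fun _ => rfl
  have hopM : ∀ a, p.opM P₀ Utilde a = M a := fun a => by
    rw [Problem.opM, ← he, ContinuousLinearMap.inverse_equiv, p.Linv_eq hB]; rfl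
  have hdisk := p.gershDisk_eq hopM
  have hcol : Tendsto (fun n => M (basisVec ℂ n)) atTop (𝓝 0) := by
    have hm := p.m_pos
    have h1 := ((blockCLM P₀⁻¹ ∘L (e.symm : Ell1 ℂ →L[ℂ] Ell1 ℂ)).continuous.tendsto 0).comp
      (p.tendsto_solCLM_basisVec (𝕜 := ℂ) (j := 0) (by omega))
    rw [map_zero] at h1
    -- Beyond index `N` the block fixes the basis vectors, so these columns are those of `𝒫⁻¹ Dℱ⁻¹
    -- ℒ⁻¹`.
    refine h1.congr' ((eventually_gt_atTop N).mono fun n hn => ?_)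
    change _ = M (basisVec ℂ n)
    rw [hM, blockOp_basisVec _ hn]; rfl
  have hinverse : IsInverseOn (p.linearization (p.steady Utilde)) (M : Module.End ℂ (Ell1 ℂ))
      (seriesFun ∘ₗ ((e : Ell1 ℂ →L[ℂ] Ell1 ℂ) ∘L blockCLM P₀ : Ell1 ℂ →L[ℂ] Ell1 ℂ)) := by
    have hg : ∀ a, (seriesFun ∘ₗ ((e : Ell1 ℂ →L[ℂ] Ell1 ℂ) ∘L blockCLM P₀ :
        Ell1 ℂ →L[ℂ] Ell1 ℂ)) a = seriesFun (e (blockOp P₀ a)) := fun _ => rfl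
    have hgM : ∀ w, e (blockOp P₀ (M w)) = p.solCLM ℂ 0 (blockOp P₀ w) := fun w => by
      rw [hM, hinv2, e.apply_symm_apply]
    have hDF : ∀ a, p.DF ℂ (toComplex Utilde) a = e a := fun a => by rw [← he]; rfl
    refine ⟨fun a b h => ?_, fun w => ?_, fun v => ?_, fun v w h => ?_⟩
    · have h1 := e.injective (seriesFun_injective h)
      rw [← hinv1 a, ← hinv1 b]
      exact congrArg _ h1
    · have h1 : ∀ (z W : Ell1 ℂ), z = p.solCLM ℂ 0 W →
          ∃ h : seriesFun z ∈ (p.linearization (p.steady Utilde)).domain,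
            p.linearization (p.steady Utilde) ⟨_, h⟩ = seriesFun (e W) := by
        rintro _ W rfl
        exact ⟨p.seriesFun_mem_domain hB _ W, by rw [p.linearization_seriesFun hB, hDF]⟩
      exact h1 _ _ (hgM w)
    · obtain ⟨a, ha⟩ := p.exists_eq_seriesFun v
      exact ⟨blockOp P₀⁻¹ (e.symm a), by rw [hg, hinv2, e.apply_symm_apply, ha]⟩
    · rw [hg] at h
      obtain ⟨Z, hZ⟩ := p.exists_eq_seriesFun_solCLM hB Utilde v _ h
      have h1 : v = ⟨_, p.seriesFun_mem_domain hB _ Z⟩ := Subtype.ext hZ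
      rw [h1, p.linearization_seriesFun hB, hDF] at h
      have h2 : Z = blockOp P₀ w := e.injective (seriesFun_injective h)
      change (v : ℝ → ℂ) = seriesFun (e (blockOp P₀ (M w)))
      rw [hgM, hZ, h2]
  have hfin : (p.unstableDisks P₀ Utilde).Finite := Set.finite_of_encard_eq_coe hcount
  have hmem : ∀ n, n ∈ hfin.toFinset ↔ n ∈ p.unstableDisks P₀ Utilde := fun n =>
    hfin.mem_toFinset
  have hcard : hfin.toFinset.card = nu := by
    rw [hfin.encard_eq_coe_toFinset_card] at hcount
    exact_mod_cast hcount
  have hre : ∀ k ∈ hfin.toFinset, ∀ z ∈ disk M k, 0 < z.re := fun k hk z hz => by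
    rw [← hdisk] at hz
    exact (hmem k).1 hk hz
  obtain ⟨hS, hrank⟩ := compact_gershgorin hcol hfin.toFinset
    (fun n hn k hk => by
      rw [← hdisk, ← hdisk]
      exact hdisj n (fun h => hn ((hmem n).2 h)) k ((hmem k).1 hk))
    fun k hk h0 => by simpa using hre k hk 0 h0
  rw [← hcard, ← hrank]
  refine hinverse.hasUnstableCount hS (fun lam hlam hlam0 => ⟨fun h => ?_, fun h => ?_⟩)
    fun h => ?_
  · obtain ⟨k, hk, hz⟩ := Set.mem_iUnion₂.1 h
    exact hre k hk lam hz
  · obtain ⟨x, hx⟩ := hlam.exists_hasEigenvector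
    obtain ⟨n, hn⟩ := exists_mem_disk (M := M) hx.2 hx.apply_eq_smul
    refine Set.mem_iUnion₂.2 ⟨n, (hmem n).2 ?_, hn⟩
    by_contra hnS
    rw [← hdisk] at hn
    rcases hstable n hnS hn with h1 | h1
    · exact lt_asymm h h1
    · have h2 : IsEigenvalue (p.linearization (p.steady Utilde)) lam⁻¹ :=
        (hinverse.isEigenvalue_iff (inv_ne_zero hlam0)).2 (by rwa [inv_inv])
      have h3 := hbound _ h2 (by
        rw [Complex.inv_re]
        exact div_nonneg h.le (Complex.normSq_nonneg _))
      rw [mem_ball_zero_iff, lt_div_iff₀ hlmax] at h1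
      rw [norm_inv, inv_le_iff_one_le_mul₀ (norm_pos_iff.2 hlam0), mul_comm] at h3
      exact absurd h3 (not_le.2 h1)
  · obtain ⟨k, hk, hz⟩ := Set.mem_iUnion₂.1 h
    simpa using hre k hk 0 hz

end GegenbauerStability

end

theorem mainTheorem3
    (p : GegenbauerStability.Problem)
    -- the linear boundary value problem is well posed
    (hB : IsUnit p.bcMatrix)
    -- the Newton-Kantorovich conditions hold, and `Utilde` is the zero which they provide
    (A : GegenbauerStability.Ell1 ℝ →L[ℝ] GegenbauerStability.Ell1 ℝ)
    (Ubar Utilde : GegenbauerStability.Ell1 ℝ) (Y Z₁ : ℝ) (Z₂ : ℝ → ℝ) (r : ℝ)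
    (hNK : p.NewtonKantorovich A Ubar Y Z₁ Z₂ r)
    (hU : Utilde ∈ Metric.closedBall Ubar r) (hzero : p.F ℝ Utilde = 0)
    -- a priori bound on the eigenvalues with nonnegative real part
    (lmax : ℝ) (hlmax : 0 < lmax)
    (hbound : ∀ μ : ℂ,
      GegenbauerStability.IsEigenvalue (p.linearization (p.steady Utilde)) μ →
        0 ≤ μ.re → ‖μ‖ ≤ lmax)
    -- the pseudo-diagonalization
    (N : ℕ) (P₀ : Matrix (Fin (N + 1)) (Fin (N + 1)) ℂ) (hP₀ : IsUnit P₀)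
    -- the Gershgorin disks
    (nu : ℕ) (hcount : (p.unstableDisks P₀ Utilde).encard = nu)
    (hdisj : ∀ n ∉ p.unstableDisks P₀ Utilde, ∀ k ∈ p.unstableDisks P₀ Utilde,
      Disjoint (p.gershDisk P₀ Utilde n) (p.gershDisk P₀ Utilde k))
    (hstable : ∀ n ∉ p.unstableDisks P₀ Utilde,
      p.gershDisk P₀ Utilde n ⊆ {z : ℂ | z.re < 0} ∪ Metric.ball 0 (1 / lmax)) :
    GegenbauerStability.HasUnstableCount (p.linearization (p.steady Utilde)) nu :=
  p.hasUnstableCount_of_gershgorin hB hNK hU hlmax hbound hP₀ hcount hdisj hstable
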